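/- Conventions. Let $\Bbbk$ be a field. Paths of a quiver are composed from left to right. For a finite quiver $Q$, let $J_Q\subset \Bbbk Q$ be the ideal of the path algebra generated by the arrows; an ideal $I$ is admissible if $J_Q^m\subseteq I\subseteq J_Q^2$ for some $m\ge 2$. For a finite dimensional algebra $\Lambda$, $\mathrm{mod}\,\Lambda$ denotes the finitely generated right $\Lambda$-modules (so $\mathrm{mod}\,\Lambda^{op}$ is the category of finitely generated left $\Lambda$-modules), and $\Omega(M)$ is the kernel of the projective cover $P(M)\to M$. For a class $\mathcal C$ of modules, $\mathrm{add}\,\mathcal C$ consists of all modules isomorphic to finite (possibly empty) direct sums of direct summands of modules in $\mathcal C$, and $\mathrm{add}\,V=\mathrm{add}\{V\}$. Let $K_0(\Lambda)$ be the abelian group generated by the symbols $[M]$, $M\in\mathrm{mod}\,\Lambda$, modulo $[M]-[M']-[M'']$ whenever $M\cong M'\oplus M''$ and $[P]$ for $P$ projective; let $\bar\Omega$ be the endomorphism $[M]\mapsto[\Omega(M)]$, and let $\langle \mathrm{add}\, M\rangle$ be the subgroup generated by the classes of the indecomposable summands of $M$. The Igusa–Todorov function $\phi(M)$ is the least $k\ge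 0$ such that $\bar\Omega$ is injective on $\bar\Omega^m\langle\mathrm{add}\,M\rangle$ for all $m\ge k$, and $\phi\dim(\mathcal D)=\sup_{M\in\mathcal D}\phi(M)$. A subcategory $\mathcal D\subseteq \mathrm{mod}\,\Lambda$ is a $0$-Igusa–Todorov subcategory if $\mathcal D=\mathrm{add}\,\mathcal D$, $\Omega(\mathcal D)\subseteq \mathcal D$ and $\phi\dim(\mathcal D)=0$. For $n\ge 0$, $\Lambda$ is $(n,V,\mathcal D)$-LIT if $\mathcal D$ is a $0$-Igusa–Todorov subcategory, $V\in\mathrm{mod}\,\Lambda$, and every $M\in\mathrm{mod}\,\Lambda$ admits an exact sequence $$0\to V_1\oplus D_1\to V_0\oplus D_0\to \Omega^n(M)\to 0$$ with $V_0,V_1\in\mathrm{add}\,V$ and $D_0,D_1\in\mathcal D$. It is $n$-LIT if it is $(n,V,\mathcal D)$-LIT for some $V,\mathcal D$, and $n$-Igusa–Todorov if it is $(n,V,\{0\})$-LIT for some $V$. Proposition 3.6. Let $A=\Bbbk Q_A/I_A$ and $B=\Bbbk Q_B/I_B$ be finite dimensional algebras, with $Q_A,Q_B$ finite quivers and $I_A,I_B$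 admissible ideals, and let $C=\Bbbk Q_C/I_C$ be a finite dimensional algebra, $Q_C$ a finite quiver, such that - (H1) the vertex set of $Q_C$ is the disjoint union of the vertex sets of $Q_A$ and $Q_B$; - (H2) the arrows of $Q_C$ are the arrows of $Q_A$, the arrows of $Q_B$, a family of arrows $\alpha_j$ ($j\in J$) each going from a vertex of $Q_A$ to a vertex of $Q_B$, and a family of arrows $\beta_k$ ($k\in K$) each going from a vertex of $Q_B$ to a vertex of $Q_A$; - (H3, with equality) $I_C=\langle I_A,\ I_B,\ \alpha\alpha_j,\ \beta\beta_k,\ \alpha_j\beta_k,\ \beta_k\alpha_j\rangle$, where $\alpha$ runs over the arrows of $Q_A$, $\beta$ over the arrows of $Q_B$, $j\in J$ and $k\in K$. Let $n\ge 0$. If $A^{op}$ and $B^{op}$ are $n$-Igusa–Todorov, then $C^{op}$ is $(n+1)$-Igusa–Todorov. If $A^{op}$ and $B^{op}$ are $n$-LIT, then $C^{op}$ is $(n+1)$-LIT. -/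

import Mathlib

universe u

open CategoryTheory

noncomputable section

/-! ### Path algebras and bound quiver algebras -/

/-- The type of all paths of a quiver (including the trivial path at each vertex). -/
abbrev QuiverPath (V : Type u) [Quiver.{u} V] : Type u :=
  Σ a b : V, Quiver.Path a b

/-- The underlying vector space of the path algebra: the `k`-vector space with basis the paths. -/
def PathAlgebra (k : Type u) [Field k] (V : Type u) [Quiver.{u} V] : Type u :=
  QuiverPath V →₀ k

namespace PathAlgebra

variable {k : Type u} [Field k] {V : Type u} [Quiver.{u} V]

instance : AddCommGroup (PathAlgebra k V) :=
  inferInstanceAs (AddCommGroup (QuiverPath V →₀ k))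

instance : Module k (PathAlgebra k V) :=
  inferInstanceAs (Module k (QuiverPath V →₀ k))

/-- The basis element attached to a path. -/
def ofPath {a b : V} (p : Quiver.Path a b) : PathAlgebra k V :=
  Finsupp.single (⟨a, b, p⟩ : QuiverPath V) (1 : k)

/-- The basis element attached to an arrow. -/
def ofArrow {a b : V} (e : a ⟶ b) : PathAlgebra k V := ofPath e.toPath

open Classical in
/-- The product of two paths: the concatenation "first `p`, then `q`" if `p` ends where `q`
starts, and zero otherwise. -/
def mulPath (p q : QuiverPath V) : PathAlgebra k V :=
  if h : q.1 = p.2.1 then ofPath (p.2.2.comp (q.2.2.cast h rfl)) else 0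

/-- The bilinear extension of the product of paths. -/
def mulLin : PathAlgebra k V →ₗ[k] PathAlgebra k V →ₗ[k] PathAlgebra k V :=
  Finsupp.linearCombination k fun p : QuiverPath V =>
    (Finsupp.linearCombination k fun q : QuiverPath V => (mulPath p q : PathAlgebra k V) :
      PathAlgebra k V →ₗ[k] PathAlgebra k V)

instance : Mul (PathAlgebra k V) := ⟨fun x y => mulLin x y⟩

theorem mul_def (x y : PathAlgebra k V) : x * y = mulLin x y := rfl

/-- The identity of the path algebra is the sum of the trivial paths. -/
instance [Fintype V] : One (PathAlgebra k V) := ⟨∑ a : V, ofPath (Quiver.Path.nil : Quiver.Path a a)⟩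

theorem one_def [Fintype V] :
    (1 : PathAlgebra k V) = ∑ a : V, ofPath (Quiver.Path.nil : Quiver.Path a a) := rfl

theorem mulLin_ofPath_ofPath {a b c d : V} (p : Quiver.Path a b) (q : Quiver.Path c d) :
    mulLin (ofPath p : PathAlgebra k V) (ofPath q) = mulPath ⟨a, b, p⟩ ⟨c, d, q⟩ := by
  have h : mulLin (ofPath p : PathAlgebra k V) =
      (1 : k) • (Finsupp.linearCombination k fun r : QuiverPath V =>
        (mulPath ⟨a, b, p⟩ r : PathAlgebra k V)) :=
    Finsupp.linearCombination_single k (1 : k) (⟨a, b, p⟩ : QuiverPath V)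
  rw [h, one_smul]
  exact (Finsupp.linearCombination_single k (1 : k) (⟨c, d, q⟩ : QuiverPath V)).trans (one_smul _ _)

theorem ofPath_mul_ofPath {a b c : V} (p : Quiver.Path a b) (q : Quiver.Path b c) :
    (ofPath p * ofPath q : PathAlgebra k V) = ofPath (p.comp q) := by
  rw [mul_def, mulLin_ofPath_ofPath]
  simp [mulPath]

theorem ofPath_mul_ofPath_of_ne {a b c d : V} (p : Quiver.Path a b) (q : Quiver.Path c d)
    (h : c ≠ b) : (ofPath p * ofPath q : PathAlgebra k V) = 0 := by
  rw [mul_def, mulLin_ofPath_ofPath]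
  simp [mulPath, h]

/-- An additive, homogeneous property that holds for paths holds for all elements. -/
theorem induction_paths {motive : PathAlgebra k V → Prop} (x : PathAlgebra k V)
    (zero : motive 0) (add : ∀ x y, motive x → motive y → motive (x + y))
    (path : ∀ (c : k) (a b : V) (p : Quiver.Path a b), motive (c • ofPath p)) : motive x := by
  refine Finsupp.induction_linear x zero add ?_
  rintro ⟨a, b, p⟩ c
  have := path c a b p
  rwa [show (c • ofPath p : PathAlgebra k V) = Finsupp.single (⟨a, b, p⟩ : QuiverPath V) c by
    simp [ofPath]; exact (Finsupp.smul_single _ _ _).trans (by simp)] at this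

theorem path_assoc {a b c d e f : V} (p : Quiver.Path a b) (q : Quiver.Path c d)
    (r : Quiver.Path e f) :
    (ofPath p * ofPath q * ofPath r : PathAlgebra k V) = ofPath p * (ofPath q * ofPath r) := by
  have hz : ∀ x : PathAlgebra k V, 0 * x = 0 := fun x => by simp [mul_def]
  have hz' : ∀ x : PathAlgebra k V, x * 0 = 0 := fun x => by simp [mul_def]
  by_cases h : c = b
  · subst h
    by_cases h' : e = d
    · subst h'
      simp only [ofPath_mul_ofPath, Quiver.Path.comp_assoc]
    · rw [ofPath_mul_ofPath, ofPath_mul_ofPath_of_ne _ _ h', ofPath_mul_ofPath_of_ne _ _ h', hz']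
  · by_cases h' : e = d
    · subst h'
      rw [ofPath_mul_ofPath, ofPath_mul_ofPath_of_ne _ _ h, ofPath_mul_ofPath_of_ne _ _ h, hz]
    · rw [ofPath_mul_ofPath_of_ne _ _ h, ofPath_mul_ofPath_of_ne _ _ h', hz, hz']

instance : NonUnitalRing (PathAlgebra k V) :=
  { (inferInstance : AddCommGroup (PathAlgebra k V)),
    (inferInstance : Mul (PathAlgebra k V)) with
    left_distrib := fun x y z => by simp [mul_def]
    right_distrib := fun x y z => by simp [mul_def]
    zero_mul := fun x => by simp [mul_def]
    mul_zero := fun x => by simp [mul_def]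
    mul_assoc := fun x y z => by
      induction x using induction_paths with
      | zero => simp [mul_def]
      | add x x' hx hx' => simp only [mul_def, map_add, LinearMap.add_apply] at *; rw [hx, hx']
      | path c a b p =>
        induction y using induction_paths with
        | zero => simp [mul_def]
        | add y y' hy hy' => simp only [mul_def, map_add, LinearMap.add_apply] at *; rw [hy, hy']
        | path c' a' b' p' =>
          induction z using induction_paths with
          | zero => simp [mul_def]
          | add z z' hz hz' => simp only [mul_def, map_add] at *; rw [hz, hz']
          | path c'' a'' b'' p'' =>
            have := path_assoc (k := k) p p' p''
            simp only [mul_def] at this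
            simp only [mul_def, map_smul, LinearMap.smul_apply, this] }

instance [Fintype V] : Ring (PathAlgebra k V) :=
  { (inferInstance : NonUnitalRing (PathAlgebra k V)),
    (inferInstance : One (PathAlgebra k V)) with
    one_mul := fun x => by
      induction x using induction_paths with
      | zero => simp
      | add x x' hx hx' => rw [mul_add, hx, hx']
      | path c a b p =>
        have h : (1 : PathAlgebra k V) * ofPath p = ofPath p := by
          rw [one_def, Finset.sum_mul, Finset.sum_eq_single a]
          · rw [ofPath_mul_ofPath, Quiver.Path.nil_comp]
          · intro b _ hb
            exact ofPath_mul_ofPath_of_ne _ _ (Ne.symm hb)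
          · simp
        rw [mul_def] at h ⊢
        rw [map_smul, h]
    mul_one := fun x => by
      induction x using induction_paths with
      | zero => simp
      | add x x' hx hx' => rw [add_mul, hx, hx']
      | path c a b p =>
        have h : ofPath p * (1 : PathAlgebra k V) = ofPath p := by
          rw [one_def, Finset.mul_sum, Finset.sum_eq_single b]
          · rw [ofPath_mul_ofPath, Quiver.Path.comp_nil]
          · intro b _ hb
            exact ofPath_mul_ofPath_of_ne _ _ hb
          · simp
        rw [mul_def] at h ⊢
        rw [map_smul, LinearMap.smul_apply, h] }

instance [Fintype V] : Algebra k (PathAlgebra k V) :=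
  Algebra.ofModule (fun c x y => by simp [mul_def]) (fun c x y => by simp [mul_def])

/-- The `m`-th power of the ideal generated by the arrows: the ideal generated by (in fact, the
linear span of) all paths of length at least `m`. -/
def arrowIdealPow (k : Type u) [Field k] (V : Type u) [Quiver.{u} V] (m : ℕ) :
    TwoSidedIdeal (PathAlgebra k V) :=
  TwoSidedIdeal.span {x | ∃ (a b : V) (p : Quiver.Path a b), m ≤ p.length ∧ x = ofPath p}

/-- Admissible ideals of a path algebra: `J ^ m ⊆ I ⊆ J ^ 2` for some `m ≥ 2`, where `J` is the
ideal generated by the arrows. -/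
def IsAdmissible (I : TwoSidedIdeal (PathAlgebra k V)) : Prop :=
  I ≤ arrowIdealPow k V 2 ∧ ∃ m : ℕ, 2 ≤ m ∧ arrowIdealPow k V m ≤ I

/-- The linear map of path algebras induced by a morphism of quivers. -/
def map {W : Type u} [Quiver.{u} W] (F : V ⥤q W) : PathAlgebra k V →ₗ[k] PathAlgebra k W :=
  Finsupp.linearCombination k fun p : QuiverPath V => (ofPath (F.mapPath p.2.2) : PathAlgebra k W)

end PathAlgebra

/-- The bound quiver algebra `kQ / I`. -/
abbrev BoundQuiverAlgebra {k : Type u} [Field k] {V : Type u} [Quiver.{u} V] [Fintype V]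
    (I : TwoSidedIdeal (PathAlgebra k V)) : Type u :=
  I.ringCon.Quotient

instance BoundQuiverAlgebra.isArtinianRing {k : Type u} [Field k] {V : Type u} [Quiver.{u} V]
    [Fintype V] (I : TwoSidedIdeal (PathAlgebra k V)) [Module.Finite k (BoundQuiverAlgebra I)] :
    IsArtinianRing (BoundQuiverAlgebra I) :=
  IsArtinianRing.of_finite k _

/-! ### Gluing two quivers -/

/-- The vertices of the quiver obtained from two quivers `Q_A`, `Q_B` (with vertex sets `VA`, `VB`)
by adding a family of arrows from `Q_A` to `Q_B` and a family of arrows from `Q_B` to `Q_A`: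
the disjoint union of the two vertex sets. Here `J a b` is the set of added arrows from
`a ∈ VA` to `b ∈ VB`, and `K b a` is the set of added arrows from `b ∈ VB` to `a ∈ VA`. -/
def GluedQuiver {VA VB : Type u} (_J : VA → VB → Type u) (_K : VB → VA → Type u) : Type u :=
  VA ⊕ VB

namespace GluedQuiver

variable {VA VB : Type u} [Quiver.{u} VA] [Quiver.{u} VB]
  {J : VA → VB → Type u} {K : VB → VA → Type u}

instance [Fintype VA] [Fintype VB] : Fintype (GluedQuiver J K) :=
  inferInstanceAs (Fintype (VA ⊕ VB))

/-- A vertex of `Q_A`, as a vertex of the glued quiver. -/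
def inA (J : VA → VB → Type u) (K : VB → VA → Type u) (a : VA) : GluedQuiver J K := Sum.inl a

/-- A vertex of `Q_B`, as a vertex of the glued quiver. -/
def inB (J : VA → VB → Type u) (K : VB → VA → Type u) (b : VB) : GluedQuiver J K := Sum.inr b

/-- The arrows of the glued quiver: those of `Q_A`, those of `Q_B`, and the added ones. -/
instance : Quiver.{u} (GluedQuiver J K) where
  Hom
    | Sum.inl a, Sum.inl a' => a ⟶ a'
    | Sum.inl a, Sum.inr b => J a b
    | Sum.inr b, Sum.inl a => K b a
    | Sum.inr b, Sum.inr b' => b ⟶ b'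

/-- The inclusion of the quiver `Q_A` into the glued quiver. -/
def inclA (J : VA → VB → Type u) (K : VB → VA → Type u) : VA ⥤q GluedQuiver J K where
  obj := inA J K
  map e := e

/-- The inclusion of the quiver `Q_B` into the glued quiver. -/
def inclB (J : VA → VB → Type u) (K : VB → VA → Type u) : VB ⥤q GluedQuiver J K where
  obj := inB J K
  map e := e

/-- An added arrow from `Q_A` to `Q_B`, as an arrow of the glued quiver. -/
def arrowAB (K : VB → VA → Type u) {a : VA} {b : VB} (j : J a b) : inA J K a ⟶ inB J K b := j

/-- An added arrow from `Q_B` to `Q_A`, as an arrow of the glued quiver. -/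
def arrowBA (J : VA → VB → Type u) {b : VB} {a : VA} (l : K b a) : inB J K b ⟶ inA J K a := l

open PathAlgebra in
/-- The ideal `⟨I_A, I_B, α α_j, β β_k, α_j β_k, β_k α_j⟩` of the path algebra of the glued quiver,
where `α`, `β` run through the arrows of `Q_A`, `Q_B`, and the `α_j`, `β_k` are the added arrows
from `Q_A` to `Q_B` and from `Q_B` to `Q_A`. (Products of arrows which do not compose vanish.) -/
def gluedIdeal {k : Type u} [Field k] (J : VA → VB → Type u) (K : VB → VA → Type u)
    (IA : TwoSidedIdeal (PathAlgebra k VA)) (IB : TwoSidedIdeal (PathAlgebra k VB)) :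
    TwoSidedIdeal (PathAlgebra k (GluedQuiver J K)) :=
  TwoSidedIdeal.span
    ({x | ∃ y ∈ IA, x = PathAlgebra.map (inclA J K) y} ∪
     {x | ∃ y ∈ IB, x = PathAlgebra.map (inclB J K) y} ∪
     {x | ∃ (a a' : VA) (b : VB) (e : a ⟶ a') (j : J a' b),
        x = ofArrow ((inclA J K).map e) * ofArrow (arrowAB K j)} ∪
     {x | ∃ (b b' : VB) (a : VA) (e : b ⟶ b') (l : K b' a),
        x = ofArrow ((inclB J K).map e) * ofArrow (arrowBA J l)} ∪
     {x | ∃ (a a' : VA) (b : VB) (j : J a b) (l : K b a'),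
        x = ofArrow (arrowAB K j) * ofArrow (arrowBA J l)} ∪
     {x | ∃ (b b' : VB) (a : VA) (l : K b a) (j : J a b'),
        x = ofArrow (arrowBA J l) * ofArrow (arrowAB K j)})

end GluedQuiver

/-! ### Finitely generated modules, syzygies and Igusa-Todorov functions

All notions below are stated for left modules over a ring `R`. A right module over the opposite
algebra of `R` is the same thing as a left `R`-module, so that these are the notions for the
category `mod Rᵒᵖ` of finitely generated right modules over the opposite algebra of `R`. -/

namespace IgusaTodorov

variable {R : Type u} [Ring R]

/-- Projective covers: surjections from a projective module with superfluous kernel. -/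
def IsProjectiveCover {P M : Type u} [AddCommGroup P] [Module R P] [AddCommGroup M] [Module R M]
    (f : P →ₗ[R] M) : Prop :=
  Module.Projective R P ∧ Function.Surjective f ∧
    ∀ L : Submodule R P, L ⊔ LinearMap.ker f = ⊤ → L = ⊤

/-- Over a left Artinian ring, finitely generated modules have projective covers. -/
theorem exists_projectiveCover [IsArtinianRing R] (M : FGModuleCat.{u} R) :
    ∃ (P : FGModuleCat.{u} R) (f : P →ₗ[R] M), IsProjectiveCover f := by
  classical
  let S : Set ℕ∞ := {l | ∃ (P : FGModuleCat.{u} R) (f : P →ₗ[R] M),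
    Module.Projective R P ∧ Function.Surjective f ∧ Module.length R P = l}
  have hS : S.Nonempty := by
    obtain ⟨n, f, hf⟩ := Module.Finite.exists_fin' R M
    exact ⟨_, FGModuleCat.of R (Fin n → R), f, inferInstanceAs (Module.Projective R (Fin n → R)),
      hf, rfl⟩
  obtain ⟨P, f, hP, hf, hl⟩ := WellFounded.min_mem (wellFounded_lt (α := ℕ∞)) S hS
  refine ⟨P, f, hP, hf, fun L hL => ?_⟩
  -- lift `f` through `L`
  have hfL : Function.Surjective (f.comp L.subtype) := by
    intro m
    obtain ⟨p, rfl⟩ := hf m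
    have hp : p ∈ L ⊔ LinearMap.ker f := hL ▸ Submodule.mem_top
    obtain ⟨x, hx, y, hy, rfl⟩ := Submodule.mem_sup.mp hp
    exact ⟨⟨x, hx⟩, by simpa using hy⟩
  obtain ⟨g, hg⟩ := Module.projective_lifting_property (f.comp L.subtype) f hfL
  let h : Module.End R P := L.subtype.comp g
  have hh : f.comp h = f := hg
  have hpow : ∀ n : ℕ, f.comp (h ^ n) = f := by
    intro n
    induction n with
    | zero => rfl
    | succ n ih => rw [pow_succ, Module.End.mul_eq_comp, ← LinearMap.comp_assoc, ih, hh]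
  obtain ⟨N, hN⟩ := Filter.eventually_atTop.mp h.eventually_isCompl_ker_pow_range_pow
  have hc := hN (N + 1) (Nat.le_succ N)
  set T := LinearMap.range (h ^ (N + 1)) with hT
  have hTproj : Module.Projective R T := by
    refine Module.Projective.of_split T.subtype (T.projectionOnto _ hc.symm) ?_
    ext x
    simp
  have hTL : T ≤ L := by
    rintro _ ⟨x, rfl⟩
    rw [pow_succ', Module.End.mul_apply]
    exact (g _).2
  have hTsurj : Function.Surjective (f.comp T.subtype) := by
    intro m
    obtain ⟨p, rfl⟩ := hf m
    exact ⟨⟨(h ^ (N + 1)) p, p, rfl⟩, LinearMap.congr_fun (hpow (N + 1)) p⟩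
  have hTtop : T = ⊤ := by
    by_contra hne
    have hlt : Module.length R T < Module.length R P := Submodule.length_lt hne
    rw [hl] at hlt
    refine WellFounded.not_lt_min (wellFounded_lt (α := ℕ∞)) S ?_ hlt
    exact ⟨FGModuleCat.of R T, f.comp T.subtype, hTproj, hTsurj, rfl⟩
  exact top_le_iff.mp (hTtop ▸ hTL)

section Syzygy

variable [IsArtinianRing R]

/-- The projective cover `P(M)` of a finitely generated module (unique up to isomorphism). -/
def projCover (M : FGModuleCat.{u} R) : FGModuleCat.{u} R := (exists_projectiveCover M).choose

/-- The projection `P(M) → M`. -/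
def projCoverMap (M : FGModuleCat.{u} R) : projCover M →ₗ[R] M :=
  (exists_projectiveCover M).choose_spec.choose

theorem projCoverMap_spec (M : FGModuleCat.{u} R) : IsProjectiveCover (projCoverMap M) :=
  (exists_projectiveCover M).choose_spec.choose_spec

/-- The syzygy `Ω(M)`: the kernel of the projective cover `P(M) → M`. -/
def syzygy (M : FGModuleCat.{u} R) : FGModuleCat.{u} R :=
  FGModuleCat.of R (LinearMap.ker (projCoverMap M))

end Syzygy

/-- The defining relations of `K₀`: `[M] - [M'] - [M'']` if `M ≅ M' ⊕ M''`, and `[P]` if `P` is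
projective. -/
def K0Relations (R : Type u) [Ring R] : Set (FreeAbelianGroup (FGModuleCat.{u} R)) :=
  {x | ∃ M M' M'' : FGModuleCat.{u} R, Nonempty (M ≃ₗ[R] (M' × M'')) ∧
      x = FreeAbelianGroup.of M - FreeAbelianGroup.of M' - FreeAbelianGroup.of M''} ∪
  {x | ∃ P : FGModuleCat.{u} R, Module.Projective R P ∧ x = FreeAbelianGroup.of P}

/-- The abelian group generated by the symbols `[M]`, `M` a finitely generated module, modulo
the relations above. -/
abbrev K0 (R : Type u) [Ring R] : Type (u + 1) :=
  FreeAbelianGroup (FGModuleCat.{u} R) ⧸ AddSubgroup.closure (K0Relations R)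

/-- The class `[M]` in `K₀`. -/
def cls (M : FGModuleCat.{u} R) : K0 R := QuotientAddGroup.mk (FreeAbelianGroup.of M)

theorem cls_eq_add {M M' M'' : FGModuleCat.{u} R} (e : M ≃ₗ[R] (M' × M'')) :
    cls M = cls M' + cls M'' := by
  have h : (QuotientAddGroup.mk (FreeAbelianGroup.of M - FreeAbelianGroup.of M'
      - FreeAbelianGroup.of M'') : K0 R) = 0 :=
    (QuotientAddGroup.eq_zero_iff _).mpr
      (AddSubgroup.subset_closure (Or.inl ⟨M, M', M'', ⟨e⟩, rfl⟩))
  have h' : cls M - cls M' - cls M'' = 0 := h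
  rw [sub_sub, sub_eq_zero] at h'
  exact h'

theorem cls_eq_zero {P : FGModuleCat.{u} R} (h : Module.Projective R P) : cls P = 0 :=
  (QuotientAddGroup.eq_zero_iff _).mpr (AddSubgroup.subset_closure (Or.inr ⟨P, h, rfl⟩))

/-- Two finitely generated kernels of projective presentations of the same module have the same
class in `K₀` (a form of the lemma of Schanuel). -/
theorem cls_ker_eq {P Q K L : FGModuleCat.{u} R} {M : Type u} [AddCommGroup M] [Module R M]
    (hP : Module.Projective R P) (hQ : Module.Projective R Q)
    (f : P →ₗ[R] M) (g : Q →ₗ[R] M) (hf : Function.Surjective f) (hg : Function.Surjective g)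
    (eK : K ≃ₗ[R] LinearMap.ker f) (eL : L ≃ₗ[R] LinearMap.ker g) : cls K = cls L := by
  -- `ker (f, -g)` is isomorphic to both `K ⊕ Q` and `L ⊕ P`
  obtain ⟨s, hs⟩ := Module.projective_lifting_property f g hf
  obtain ⟨t, ht⟩ := Module.projective_lifting_property g f hg
  have hs' : ∀ x, f (s x) = g x := LinearMap.congr_fun hs
  have ht' : ∀ x, g (t x) = f x := LinearMap.congr_fun ht
  let W : Submodule R (P × Q) := LinearMap.ker (f.coprod (-g))
  have hW : ∀ x : P × Q, x ∈ W ↔ f x.1 = g x.2 := fun x => by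
    simp [W, ← sub_eq_add_neg, sub_eq_zero]
  let e₁ : (LinearMap.ker f × Q) ≃ₗ[R] W :=
    { toFun := fun x => ⟨(x.1.1 + s x.2, x.2), by
        rw [hW]; simp [hs']⟩
      map_add' := fun x y => by
        ext <;> simp; abel
      map_smul' := fun c x => by
        ext <;> simp
      invFun := fun w => (⟨w.1.1 - s w.1.2, by
        have := (hW w.1).mp w.2
        simp [hs', this]⟩, w.1.2)
      left_inv := fun x => by ext <;> simp
      right_inv := fun w => by ext <;> simp }
  let e₂ : (LinearMap.ker g × P) ≃ₗ[R] W :=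
    { toFun := fun x => ⟨(x.2, x.1.1 + t x.2), by
        rw [hW]; simp [ht']⟩
      map_add' := fun x y => by
        ext <;> simp; abel
      map_smul' := fun c x => by
        ext <;> simp
      invFun := fun w => (⟨w.1.2 - t w.1.1, by
        have := (hW w.1).mp w.2
        simp [ht', this]⟩, w.1.1)
      left_inv := fun x => by ext <;> simp
      right_inv := fun w => by ext <;> simp }
  let d : (K × Q) ≃ₗ[R] (L × P) :=
    (eK.prodCongr (LinearEquiv.refl R Q)).trans
      (e₁.trans (e₂.symm.trans (eL.symm.prodCongr (LinearEquiv.refl R P))))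
  have h₁ : cls (FGModuleCat.of R (K × Q)) = cls K + cls Q := cls_eq_add (LinearEquiv.refl R _)
  have h₂ : cls (FGModuleCat.of R (K × Q)) = cls L + cls P := cls_eq_add d
  rw [cls_eq_zero hP, add_zero] at h₂
  rw [cls_eq_zero hQ, add_zero] at h₁
  rw [← h₁, h₂]

section Phi

variable [IsArtinianRing R]

/-- The homomorphism on the free group induced by `M ↦ [Ω(M)]`. -/
def syzygyLift (R : Type u) [Ring R] [IsArtinianRing R] :
    FreeAbelianGroup (FGModuleCat.{u} R) →+ K0 R :=
  FreeAbelianGroup.lift fun M => cls (syzygy M)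

theorem syzygyLift_eq_zero (x : FreeAbelianGroup (FGModuleCat.{u} R))
    (hx : x ∈ AddSubgroup.closure (K0Relations R)) : syzygyLift R x = 0 := by
  refine (AddSubgroup.closure_le (syzygyLift R).ker).mpr ?_ hx
  rintro x (⟨M, M', M'', ⟨e⟩, rfl⟩ | ⟨P, hP, rfl⟩)
  · have h : cls (syzygy M) = cls (syzygy M') + cls (syzygy M'') := by
      have hM := projCoverMap_spec M
      have hM' := projCoverMap_spec M'
      have hM'' := projCoverMap_spec M''
      have := hM'.1
      have := hM''.1
      let c : (projCover M' × projCover M'') →ₗ[R] (M' × M'') :=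
        (projCoverMap M').prodMap (projCoverMap M'')
      have hc : ∀ x, x ∈ LinearMap.ker c ↔
          x.1 ∈ LinearMap.ker (projCoverMap M') ∧ x.2 ∈ LinearMap.ker (projCoverMap M'') :=
        fun x => by simp [c]
      let d : (LinearMap.ker (projCoverMap M') × LinearMap.ker (projCoverMap M''))
          ≃ₗ[R] LinearMap.ker c :=
        { toFun := fun x => ⟨(x.1.1, x.2.1), (hc _).mpr ⟨x.1.2, x.2.2⟩⟩
          map_add' := fun x y => rfl
          map_smul' := fun a x => rfl
          invFun := fun w => (⟨w.1.1, ((hc _).mp w.2).1⟩, ⟨w.1.2, ((hc _).mp w.2).2⟩)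
          left_inv := fun x => rfl
          right_inv := fun w => rfl }
      have hker : LinearMap.ker (e.toLinearMap.comp (projCoverMap M)) =
          LinearMap.ker (projCoverMap M) := by
        ext x; simp
      rw [← cls_eq_add (M := FGModuleCat.of R (syzygy M' × syzygy M'')) (LinearEquiv.refl R _)]
      refine cls_ker_eq (P := projCover M)
        (Q := FGModuleCat.of R (projCover M' × projCover M'')) hM.1
        (inferInstanceAs (Module.Projective R (projCover M' × projCover M'')))
        (e.toLinearMap.comp (projCoverMap M)) c (e.surjective.comp hM.2.1)
        (Function.Surjective.prodMap hM'.2.1 hM''.2.1)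
        (LinearEquiv.ofEq _ _ hker.symm) d
    simp [syzygyLift, AddMonoidHom.mem_ker, h]
  · have h : cls (syzygy P) = 0 := by
      have hz : cls (FGModuleCat.of R (LinearMap.ker (LinearMap.id : P →ₗ[R] P))) = 0 := by
        refine cls_eq_zero ?_
        have : Subsingleton (LinearMap.ker (LinearMap.id : P →ₗ[R] P)) := by
          rw [LinearMap.ker_id]; infer_instance
        exact Module.Projective.of_free
      rw [← hz]
      exact cls_ker_eq (P := projCover P) (Q := P) (projCoverMap_spec P).1 hP (projCoverMap P)
        LinearMap.id (projCoverMap_spec P).2.1 Function.surjective_id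
        (LinearEquiv.refl R _) (LinearEquiv.refl R _)
    simp [syzygyLift, AddMonoidHom.mem_ker, h]

/-- The endomorphism of `K₀` induced by `Ω`: it sends `[M]` to `[Ω(M)]`. -/
def omegaBar (R : Type u) [Ring R] [IsArtinianRing R] : K0 R →+ K0 R :=
  QuotientAddGroup.lift _ (syzygyLift R) syzygyLift_eq_zero

/-- `N` is (isomorphic to) a direct summand of `M`. -/
def IsSummand (N M : FGModuleCat.{u} R) : Prop :=
  ∃ N' : FGModuleCat.{u} R, Nonempty (M ≃ₗ[R] (N × N'))

/-- Indecomposable modules. -/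
def IsIndecomposable (N : FGModuleCat.{u} R) : Prop :=
  Nontrivial N ∧ ∀ X Y : FGModuleCat.{u} R, Nonempty (N ≃ₗ[R] (X × Y)) →
    Subsingleton X ∨ Subsingleton Y

/-- `⟨add M⟩`: the subgroup of `K₀` generated by the classes of the indecomposable direct
summands of `M`. -/
def addSubgroupOf (M : FGModuleCat.{u} R) : AddSubgroup (K0 R) :=
  AddSubgroup.closure {x | ∃ N, IsIndecomposable N ∧ IsSummand N M ∧ x = cls N}

/-- The least `k` such that `f` is injective on `f ^ m (X)` for all `m ≥ k` (and `⊤` if there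
is no such `k`, which does not happen for the finitely generated subgroups `⟨add M⟩`). -/
def fittingIndex {G : Type*} [AddCommGroup G] (f : G →+ G) (X : AddSubgroup G) : ℕ∞ :=
  ⨅ (k : ℕ) (_ : ∀ m : ℕ, k ≤ m → Set.InjOn f (f^[m] '' (X : Set G))), (k : ℕ∞)

/-- The Igusa-Todorov function `φ`. -/
def phi (M : FGModuleCat.{u} R) : ℕ∞ := fittingIndex (omegaBar R) (addSubgroupOf M)

/-- The `φ`-dimension of a subcategory. -/
def phiDim (D : Set (FGModuleCat.{u} R)) : ℕ∞ := ⨆ M ∈ D, phi M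

/-- `add C`: all modules isomorphic to a finite direct sum of direct summands of modules in `C`. -/
def addClosure (C : Set (FGModuleCat.{u} R)) : Set (FGModuleCat.{u} R) :=
  {M | ∃ (r : ℕ) (N : Fin r → FGModuleCat.{u} R), (∀ i, ∃ X ∈ C, IsSummand (N i) X) ∧
    Nonempty (M ≃ₗ[R] (∀ i, N i))}

/-- `0`-Igusa-Todorov subcategories. -/
structure IsZeroIT (D : Set (FGModuleCat.{u} R)) : Prop where
  add_eq : D = addClosure D
  syzygy_mem : ∀ M ∈ D, syzygy M ∈ D
  phiDim_eq : phiDim D = 0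

/-- The subcategory `C` is `(n, V, D)`-Lat-Igusa-Todorov: `D` is a `0`-Igusa-Todorov subcategory
and each `M` in `C` admits an exact sequence `0 → V₁ ⊕ D₁ → V₀ ⊕ D₀ → Ωⁿ(M) → 0` with `V₀`, `V₁`
in `add V` and `D₀`, `D₁` in `D`. -/
def IsLITWith (n : ℕ) (V : FGModuleCat.{u} R) (D C : Set (FGModuleCat.{u} R)) : Prop :=
  IsZeroIT D ∧ ∀ M ∈ C, ∃ V₁ ∈ addClosure {V}, ∃ V₀ ∈ addClosure {V}, ∃ D₁ ∈ D, ∃ D₀ ∈ D,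
    ∃ (f : (V₁ × D₁) →ₗ[R] (V₀ × D₀)) (g : (V₀ × D₀) →ₗ[R] (syzygy^[n] M : FGModuleCat.{u} R)),
      Function.Injective f ∧ Function.Exact f g ∧ Function.Surjective g

end Phi

/-- The opposite algebra of `R` is `n`-LIT: for some `V` and `D`, the category of all finitely
generated right modules over the opposite algebra (that is, of all finitely generated left
`R`-modules) is `(n, V, D)`-LIT. -/
def IsLITOp (n : ℕ) (R : Type u) [Ring R] [IsArtinianRing R] : Prop :=
  ∃ (V : FGModuleCat.{u} R) (D : Set (FGModuleCat.{u} R)), IsLITWith n V D Set.univ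

/-- The opposite algebra of `R` is `n`-Igusa-Todorov: the case where `D` consists of the zero
modules only. -/
def IsIgusaTodorovOp (n : ℕ) (R : Type u) [Ring R] [IsArtinianRing R] : Prop :=
  ∃ V : FGModuleCat.{u} R, IsLITWith n V {M | Subsingleton M} Set.univ

end IgusaTodorov

end

/-!
Let `R = A × B` and let `E ⊆ C` be the span of the added arrows. Then `C = R ⊕ E` with `E ^ 2 = 0`
by the relations (H3). As a right `R`-module `E` is a direct sum of projective modules `ε R ≅ f R`,
one for each added arrow `ε`, with `f` the idempotent at its target; hence `Ind = C ⊗_R -` is exact,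
and it preserves projective covers and syzygies. On the left `R` acts on `ε R` through a character,
so that `E ⊗_R X` is semisimple for every `X`.

Every projective `C`-module embeds in an induced module, so a syzygy of `C`-modules is a submodule
`W` of some `Ind Y`. The kernel `L` of `W → Y` is semisimple, and an `R`-complement `X` of `L` in
`W` generates a copy of `Ind X`, so that `W ≅ Ind X ⊕ S` with `S` a quotient of `L`. Therefore
`Ω ^ (n + 1) M ≅ Ind (Ω ^ n X) ⊕ Ω ^ n S`. Inducing the presentation of `Ω ^ n X` and adding
`Ω ^ n (C / rad C)` to `Ind V` gives the presentation required for `C`, with the `0`-Igusa–Todorov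
subcategory of modules isomorphic to some `Ind X` with `X` in the subcategory given over `R`.
-/

noncomputable section

namespace IgusaTodorov

/-! ### Projective covers and syzygies -/

section Cover

variable {R S : Type*} [Ring R] [Ring S] {σ : R →+* S} [RingHomSurjective σ]
  {P Q : Type*} [AddCommGroup P] [Module R P] [AddCommGroup Q]

/-- Superfluous (small) submodules: those which do not help to generate the module. -/
def IsSuperfluous (K : Submodule R P) : Prop :=
  ∀ L : Submodule R P, L ⊔ K = ⊤ → L = ⊤

theorem IsSuperfluous.mono {K L : Submodule R P} (hL : IsSuperfluous L) (h : K ≤ L) :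
    IsSuperfluous K :=
  fun N hN => hL N (top_le_iff.mp (hN.ge.trans (sup_le_sup_left h N)))

theorem IsSuperfluous.sup {K L : Submodule R P} (hK : IsSuperfluous K) (hL : IsSuperfluous L) :
    IsSuperfluous (K ⊔ L) :=
  fun N hN => hK N (hL _ (by rwa [sup_assoc]))

theorem IsSuperfluous.map [Module S Q] {K : Submodule R P} (hK : IsSuperfluous K)
    (i : P →ₛₗ[σ] Q) : IsSuperfluous (K.map i) := by
  intro L hL
  have hcomap : L.comap i = ⊤ := by
    refine hK _ (eq_top_iff.mpr fun x _ => ?_)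
    obtain ⟨l, hl, _, ⟨y, hy, rfl⟩, hxy⟩ :=
      Submodule.mem_sup.mp (hL.ge (Submodule.mem_top (x := i x)))
    refine Submodule.mem_sup.mpr ⟨x - y, ?_, y, hy, sub_add_cancel x y⟩
    rwa [Submodule.mem_comap, map_sub, ← hxy, add_sub_cancel_right]
  have hK' : K.map i ≤ L := Submodule.map_le_iff_le_comap.mpr (hcomap ▸ le_top)
  rwa [sup_eq_left.mpr hK'] at hL

theorem IsSuperfluous.comap [Module S Q] {K : Submodule S Q} (hK : IsSuperfluous K)
    {w : P →ₛₗ[σ] Q} (hw : IsSuperfluous (LinearMap.ker w)) (hsurj : Function.Surjective w) :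
    IsSuperfluous (K.comap w) := by
  intro L hL
  refine hw L ?_
  rw [← Submodule.comap_map_eq, hK (L.map w) ?_, Submodule.comap_top]
  rw [← Submodule.map_comap_eq_of_surjective hsurj K, ← Submodule.map_sup, hL, Submodule.map_top,
    LinearMap.range_eq_top.mpr hsurj]

theorem isSuperfluous_smul_top {I : Ideal R} (hI : I • I = ⊥) :
    IsSuperfluous (I • ⊤ : Submodule R P) := by
  intro L hL
  have hle : I • (⊤ : Submodule R P) ≤ L := calc
    I • (⊤ : Submodule R P) = I • L ⊔ (I • I) • ⊤ := by
      rw [Submodule.smul_assoc, ← Submodule.smul_sup, hL]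
    _ ≤ L := by
      rw [hI, Submodule.bot_smul, sup_bot_eq]
      exact Submodule.smul_le_right
  rwa [sup_eq_left.mpr hle] at hL

theorem IsSuperfluous.surjective_of_comp {M : Type*} [AddCommGroup M] [Module R M] [Module R Q]
    {g : P →ₗ[R] M} (hg : IsSuperfluous (LinearMap.ker g)) {s : Q →ₗ[R] P}
    (hs : Function.Surjective (g ∘ₗ s)) : Function.Surjective s := by
  refine LinearMap.range_eq_top.mp (hg _ ?_)
  rw [← Submodule.comap_map_eq, ← LinearMap.range_comp, LinearMap.range_eq_top.mpr hs,
    Submodule.comap_top]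

end Cover

section ProjectiveCover

variable {R : Type u} [Ring R] {P Q M N : Type u} [AddCommGroup P] [Module R P] [AddCommGroup Q]
  [Module R Q] [AddCommGroup M] [Module R M] [AddCommGroup N] [Module R N]
  {f : P →ₗ[R] M}

theorem IsProjectiveCover.isSuperfluous_ker (hf : IsProjectiveCover f) :
    IsSuperfluous (LinearMap.ker f) :=
  hf.2.2

theorem IsProjectiveCover.exists_equiv {g : Q →ₗ[R] M} (hf : IsProjectiveCover f)
    (hg : IsProjectiveCover g) : ∃ e : P ≃ₗ[R] Q, g ∘ₗ e = f := by
  have := hf.1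
  have := hg.1
  obtain ⟨s, hs⟩ := Module.projective_lifting_property g f hg.2.1
  have hsurj : Function.Surjective s :=
    hg.isSuperfluous_ker.surjective_of_comp (hs ▸ hf.2.1)
  obtain ⟨t, ht⟩ := Module.projective_lifting_property s LinearMap.id hsurj
  have hft : f ∘ₗ t = g := by rw [← hs, LinearMap.comp_assoc, ht, LinearMap.comp_id]
  have htsurj : Function.Surjective t :=
    hf.isSuperfluous_ker.surjective_of_comp (hft ▸ hg.2.1)
  have hleft : Function.LeftInverse s t := LinearMap.congr_fun ht
  exact ⟨LinearEquiv.ofBijective s ⟨(hleft.rightInverse_of_surjective htsurj).injective, hsurj⟩, hs⟩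

theorem IsProjectiveCover.nonempty_ker_equiv {g : Q →ₗ[R] M} (hf : IsProjectiveCover f)
    (hg : IsProjectiveCover g) : Nonempty (LinearMap.ker f ≃ₗ[R] LinearMap.ker g) := by
  obtain ⟨e, rfl⟩ := hf.exists_equiv hg
  exact ⟨e.ofSubmodule' (LinearMap.ker g)⟩

theorem IsProjectiveCover.comp_equiv (hf : IsProjectiveCover f) (e : M ≃ₗ[R] N) :
    IsProjectiveCover (e.toLinearMap ∘ₗ f) := by
  refine ⟨hf.1, e.surjective.comp hf.2.1, ?_⟩
  rw [LinearEquiv.ker_comp]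
  exact hf.2.2

theorem IsProjectiveCover.prodMap {g : Q →ₗ[R] N} (hf : IsProjectiveCover f)
    (hg : IsProjectiveCover g) : IsProjectiveCover (f.prodMap g) := by
  have := hf.1
  have := hg.1
  refine ⟨inferInstance, hf.2.1.prodMap hg.2.1, ?_⟩
  rw [LinearMap.ker_prodMap, LinearMap.prod_eq_sup_map]
  exact (hf.isSuperfluous_ker.map _).sup (hg.isSuperfluous_ker.map _)

end ProjectiveCover

section Syzygy

/-- A product submodule, as the product of its two factors. -/
def prodSubmoduleEquiv {R M N : Type*} [Ring R] [AddCommGroup M] [Module R M] [AddCommGroup N]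
    [Module R N] (p : Submodule R M) (q : Submodule R N) : p.prod q ≃ₗ[R] (p × q) where
  toFun x := (⟨x.1.1, x.2.1⟩, ⟨x.1.2, x.2.2⟩)
  map_add' _ _ := rfl
  map_smul' _ _ := rfl
  invFun x := ⟨(x.1, x.2), x.1.2, x.2.2⟩

variable {R : Type u} [Ring R] [IsArtinianRing R]

theorem IsProjectiveCover.nonempty_syzygy_equiv {P : Type u} [AddCommGroup P] [Module R P]
    {M : FGModuleCat.{u} R} {f : P →ₗ[R] M} (hf : IsProjectiveCover f) :
    Nonempty (syzygy M ≃ₗ[R] LinearMap.ker f) :=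
  (projCoverMap_spec M).nonempty_ker_equiv hf

theorem syzygy_congr {M N : FGModuleCat.{u} R} (e : M ≃ₗ[R] N) :
    Nonempty (syzygy M ≃ₗ[R] syzygy N) := by
  obtain ⟨d⟩ := ((projCoverMap_spec M).comp_equiv e).nonempty_syzygy_equiv (M := N)
  rw [LinearEquiv.ker_comp] at d
  exact ⟨d.symm⟩

theorem syzygy_prod (M N : FGModuleCat.{u} R) :
    Nonempty (syzygy (FGModuleCat.of R (M × N)) ≃ₗ[R] (syzygy M × syzygy N)) := by
  obtain ⟨d⟩ := ((projCoverMap_spec M).prodMap (projCoverMap_spec N)).nonempty_syzygy_equiv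
    (M := FGModuleCat.of R (M × N))
  rw [LinearMap.ker_prodMap] at d
  exact ⟨d.trans (prodSubmoduleEquiv _ _)⟩

theorem syzygy_subsingleton (M : FGModuleCat.{u} R) [Subsingleton M] :
    Subsingleton (syzygy M) := by
  obtain ⟨d⟩ := IsProjectiveCover.nonempty_syzygy_equiv (M := M) (f := LinearMap.id)
    ⟨Module.Projective.of_free, Function.surjective_id, fun _ _ => Subsingleton.elim _ _⟩
  exact d.toEquiv.subsingleton

end Syzygy
/-! ### Direct summands and additive closures -/

section Add

variable {R : Type u} [Ring R]

theorem IsSummand.of_equiv {M N : FGModuleCat.{u} R} (e : M ≃ₗ[R] N) : IsSummand M N :=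
  ⟨FGModuleCat.of R PUnit, ⟨e.symm.trans LinearEquiv.prodUnique.symm⟩⟩

theorem IsSummand.fst (M N : FGModuleCat.{u} R) : IsSummand M (FGModuleCat.of R (M × N)) :=
  ⟨N, ⟨LinearEquiv.refl _ _⟩⟩

theorem IsSummand.snd (M N : FGModuleCat.{u} R) : IsSummand N (FGModuleCat.of R (M × N)) :=
  ⟨M, ⟨LinearEquiv.prodComm _ _ _⟩⟩

theorem IsSummand.trans {L M N : FGModuleCat.{u} R} (h : IsSummand L M) (h' : IsSummand M N) :
    IsSummand L N := by
  obtain ⟨X, ⟨e⟩⟩ := h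
  obtain ⟨Y, ⟨d⟩⟩ := h'
  exact ⟨FGModuleCat.of R (X × Y), ⟨d.trans ((e.prodCongr (LinearEquiv.refl R Y)).trans
    (LinearEquiv.prodAssoc R L X Y))⟩⟩

variable {C : Set (FGModuleCat.{u} R)}

theorem addClosure_of_subsingleton (M : FGModuleCat.{u} R) [Subsingleton M] :
    M ∈ addClosure C :=
  ⟨0, fun i => i.elim0, fun i => i.elim0, ⟨LinearEquiv.ofSubsingleton _ _⟩⟩

theorem addClosure_congr {M N : FGModuleCat.{u} R} (e : M ≃ₗ[R] N) (h : M ∈ addClosure C) :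
    N ∈ addClosure C := by
  obtain ⟨r, X, hX, ⟨d⟩⟩ := h
  exact ⟨r, X, hX, ⟨e.symm.trans d⟩⟩

theorem addClosure_cons {M N X : FGModuleCat.{u} R} (hX : ∃ Y ∈ C, IsSummand X Y)
    (hN : N ∈ addClosure C) (e : M ≃ₗ[R] (X × N)) : M ∈ addClosure C := by
  obtain ⟨r, Y, hY, ⟨d⟩⟩ := hN
  exact ⟨r + 1, Fin.cons X Y, fun i => Fin.cases hX hY i,
    ⟨e.trans (((LinearEquiv.refl R X).prodCongr d).trans
      (Fin.consLinearEquiv R fun i =>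
        ((Fin.cons X Y : Fin (r + 1) → FGModuleCat.{u} R) i : Type u)))⟩⟩

theorem addClosure_of_isSummand {M X : FGModuleCat.{u} R} (hX : X ∈ C) (h : IsSummand M X) :
    M ∈ addClosure C :=
  addClosure_cons ⟨X, hX, h⟩ (addClosure_of_subsingleton (FGModuleCat.of R PUnit))
    LinearEquiv.prodUnique.symm

theorem addClosure_induction {motive : FGModuleCat.{u} R → Prop}
    (zero : ∀ M : FGModuleCat.{u} R, Subsingleton M → motive M)
    (congr : ∀ M N : FGModuleCat.{u} R, (M ≃ₗ[R] N) → motive M → motive N)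
    (cons : ∀ X N : FGModuleCat.{u} R, (∃ Y ∈ C, IsSummand X Y) → motive N →
      motive (FGModuleCat.of R (X × N)))
    {M : FGModuleCat.{u} R} (hM : M ∈ addClosure C) : motive M := by
  obtain ⟨r, N, hN, ⟨e⟩⟩ := hM
  induction r generalizing M with
  | zero => exact zero M e.toEquiv.subsingleton
  | succ r ih =>
    refine congr (FGModuleCat.of R (N 0 × ∀ i : Fin r, N i.succ)) M
      ((Fin.consLinearEquiv R fun i => (N i : Type u)).trans e.symm)
      (cons _ (FGModuleCat.of R (∀ i : Fin r, N i.succ)) (hN 0) ?_)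
    exact ih (M := FGModuleCat.of R (∀ i : Fin r, N i.succ)) (fun i => N i.succ)
      (fun i => hN i.succ) (LinearEquiv.refl _ _)

theorem addClosure_prod {M N : FGModuleCat.{u} R} (hM : M ∈ addClosure C)
    (hN : N ∈ addClosure C) : FGModuleCat.of R (M × N) ∈ addClosure C := by
  refine addClosure_induction (C := C)
    (motive := fun M => FGModuleCat.of R (M × N) ∈ addClosure C) ?_ ?_ ?_ hM
  · intro M hM
    have : Unique M := ⟨⟨0⟩, fun _ => Subsingleton.elim _ _⟩
    exact addClosure_congr (M := N) LinearEquiv.uniqueProd.symm hN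
  · intro M M' e h
    exact addClosure_congr (M := FGModuleCat.of R (M × N)) (e.prodCongr (LinearEquiv.refl R N)) h
  · intro X M hX h
    exact addClosure_cons hX h (LinearEquiv.prodAssoc R X M N)

theorem eq_addClosure (zero : ∀ M : FGModuleCat.{u} R, Subsingleton M → M ∈ C)
    (summand : ∀ X Y : FGModuleCat.{u} R, IsSummand X Y → Y ∈ C → X ∈ C)
    (prod : ∀ X Y : FGModuleCat.{u} R, X ∈ C → Y ∈ C → FGModuleCat.of R (X × Y) ∈ C) :
    C = addClosure C := by
  refine Set.Subset.antisymm
    (fun M hM => addClosure_of_isSummand hM (IsSummand.of_equiv (LinearEquiv.refl R M)))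
    fun M hM => ?_
  refine addClosure_induction (C := C) zero
    (fun M N e h => summand _ _ (IsSummand.of_equiv e.symm) h) ?_ hM
  rintro X N ⟨Y, hY, hXY⟩ hN
  exact prod _ _ (summand _ _ hXY hY) hN

end Add

/-! ### Operations preserving finite direct sums -/

section AdditiveOp

variable {R S : Type u} [Ring R] [Ring S]

/-- Operations on finitely generated modules which preserve isomorphism and finite direct sums.
Both additive functors and the syzygy, which is not a functor on modules, are of this kind. -/
structure IsAdditiveOp (T : FGModuleCat.{u} R → FGModuleCat.{u} S) : Prop where
  congr : ∀ {M N : FGModuleCat.{u} R}, (M ≃ₗ[R] N) → Nonempty (T M ≃ₗ[S] T N)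
  prod : ∀ M N : FGModuleCat.{u} R, Nonempty (T (FGModuleCat.of R (M × N)) ≃ₗ[S] (T M × T N))
  subsingleton : ∀ M : FGModuleCat.{u} R, Subsingleton M → Subsingleton (T M)

namespace IsAdditiveOp

theorem iterate {T : FGModuleCat.{u} R → FGModuleCat.{u} R} (hT : IsAdditiveOp T) (n : ℕ) :
    IsAdditiveOp T^[n] := by
  induction n with
  | zero => exact ⟨fun e => ⟨e⟩, fun _ _ => ⟨LinearEquiv.refl _ _⟩, fun _ h => h⟩
  | succ n ih =>
    refine ⟨fun e => ?_, fun M N => ?_, fun M hM => ih.subsingleton _ (hT.subsingleton M hM)⟩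
    · obtain ⟨d⟩ := hT.congr e
      exact ih.congr d
    · obtain ⟨d⟩ := hT.prod M N
      obtain ⟨d₁⟩ := ih.congr (N := FGModuleCat.of R (T M × T N)) d
      obtain ⟨d₂⟩ := ih.prod (T M) (T N)
      exact ⟨d₁.trans d₂⟩

variable {T : FGModuleCat.{u} R → FGModuleCat.{u} S} (hT : IsAdditiveOp T)
include hT

theorem nonempty_equiv_prod {M X Y : FGModuleCat.{u} R} (e : M ≃ₗ[R] (X × Y)) :
    Nonempty (T M ≃ₗ[S] (T X × T Y)) := by
  obtain ⟨d⟩ := hT.congr (N := FGModuleCat.of R (X × Y)) e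
  obtain ⟨d'⟩ := hT.prod X Y
  exact ⟨d.trans d'⟩

theorem isSummand {M N : FGModuleCat.{u} R} (h : IsSummand M N) : IsSummand (T M) (T N) := by
  obtain ⟨X, ⟨e⟩⟩ := h
  exact ⟨T X, hT.nonempty_equiv_prod e⟩

theorem mem_addClosure {C : Set (FGModuleCat.{u} R)} {C' : Set (FGModuleCat.{u} S)}
    (hC : ∀ X ∈ C, ∃ Y ∈ C', IsSummand (T X) Y) {M : FGModuleCat.{u} R} (hM : M ∈ addClosure C) :
    T M ∈ addClosure C' := by
  refine addClosure_induction (motive := fun M => T M ∈ addClosure C') ?_ ?_ ?_ hM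
  · intro M hM
    have := hT.subsingleton M hM
    exact addClosure_of_subsingleton _
  · intro M N e h
    obtain ⟨d⟩ := hT.congr e
    exact addClosure_congr d h
  · rintro X N ⟨Y, hY, hXY⟩ hN
    obtain ⟨d⟩ := hT.prod X N
    obtain ⟨Z, hZ, hYZ⟩ := hC Y hY
    exact addClosure_cons ⟨Z, hZ, (hT.isSummand hXY).trans hYZ⟩ hN d

end IsAdditiveOp

theorem isAdditiveOp_syzygy [IsArtinianRing R] : IsAdditiveOp (syzygy (R := R)) :=
  ⟨syzygy_congr, syzygy_prod, fun M _ => syzygy_subsingleton M⟩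

theorem isAdditiveOp_iterate_syzygy [IsArtinianRing R] (n : ℕ) :
    IsAdditiveOp (syzygy (R := R))^[n] :=
  isAdditiveOp_syzygy.iterate n

end AdditiveOp

/-! ### The Grothendieck group and the Igusa-Todorov function -/

section Phi

variable {R : Type u} [Ring R]

theorem cls_congr {M N : FGModuleCat.{u} R} (e : M ≃ₗ[R] N) : cls M = cls N := by
  have h := cls_eq_add (M := M) (M' := N) (M'' := FGModuleCat.of R PUnit)
    (e.trans LinearEquiv.prodUnique.symm)
  rwa [cls_eq_zero (P := FGModuleCat.of R PUnit) Module.Projective.of_free, add_zero] at h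

theorem cls_of_subsingleton (M : FGModuleCat.{u} R) [Subsingleton M] : cls M = 0 :=
  cls_eq_zero Module.Projective.of_free

theorem K0_hom_ext {G : Type*} [AddCommGroup G] {f g : K0 R →+ G}
    (h : ∀ M, f (cls M) = g (cls M)) : f = g :=
  QuotientAddGroup.addMonoidHom_ext _ (FreeAbelianGroup.lift_ext _ _ h)

theorem cls_mem_addSubgroupOf [IsArtinianRing R] {N M : FGModuleCat.{u} R} (h : IsSummand N M) :
    cls N ∈ addSubgroupOf M := by
  induction hl : Module.length R N using WellFoundedLT.induction generalizing N with
  | _ l ih =>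
    by_cases hN : IsIndecomposable N
    · exact AddSubgroup.subset_closure ⟨N, hN, h, rfl⟩
    rcases subsingleton_or_nontrivial N with hs | hs
    · exact cls_of_subsingleton N ▸ zero_mem _
    simp only [IsIndecomposable, hs, true_and, not_forall, not_or,
      not_subsingleton_iff_nontrivial] at hN
    obtain ⟨X, Y, ⟨e⟩, hX, hY⟩ := hN
    have hlen : Module.length R X + Module.length R Y = l := by
      rw [← hl, e.length_eq, Module.length_prod]
    have hX' : Module.length R X < l := by
      rw [← hlen, add_comm]
      exact ENat.lt_add_left Module.length_ne_top (Module.length_pos_iff.mpr hY)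
    have hY' : Module.length R Y < l := hlen ▸
      ENat.lt_add_left Module.length_ne_top (Module.length_pos_iff.mpr hX)
    rw [cls_eq_add e]
    exact add_mem (ih _ hX' (IsSummand.trans ⟨Y, ⟨e⟩⟩ h) rfl)
      (ih _ hY' (IsSummand.trans ⟨X, ⟨e.trans (LinearEquiv.prodComm R X Y)⟩⟩ h) rfl)

theorem addSubgroupOf_le [IsArtinianRing R] {M : FGModuleCat.{u} R} {H : AddSubgroup (K0 R)} :
    addSubgroupOf M ≤ H ↔ ∀ N, IsSummand N M → cls N ∈ H := by
  refine ⟨fun h N hN => h (cls_mem_addSubgroupOf hN), fun h => (AddSubgroup.closure_le H).mpr ?_⟩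
  rintro _ ⟨N, -, hN, rfl⟩
  exact h N hN

theorem fittingIndex_eq_zero_iff {G : Type*} [AddCommGroup G] (f : G →+ G) (X : AddSubgroup G) :
    fittingIndex f X = 0 ↔ ∀ m : ℕ, Set.InjOn f^[m] (X : Set G) := by
  have hindex : fittingIndex f X = 0 ↔ ∀ m : ℕ, Set.InjOn f (f^[m] '' (X : Set G)) := by
    constructor
    · intro h
      by_contra hm
      have hone : (1 : ℕ∞) ≤ fittingIndex f X := le_iInf₂ fun k hk =>
        Nat.one_le_cast.mpr (Nat.one_le_iff_ne_zero.mpr fun h0 => hm fun m => hk m (h0 ▸ m.zero_le))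
      exact absurd (h ▸ hone) (by simp)
    · exact fun h => le_antisymm (iInf₂_le 0 fun m _ => h m) zero_le
  rw [hindex]
  constructor
  · intro h m
    induction m with
    | zero => exact Set.injOn_id _
    | succ m ih =>
      rw [Function.iterate_succ']
      exact (h m).comp ih (Set.mapsTo_image _ _)
  · intro h m
    exact Set.InjOn.image_of_comp (by rw [← Function.iterate_succ']; exact h (m + 1))

section K0map

variable {S : Type u} [Ring S] {T : FGModuleCat.{u} R → FGModuleCat.{u} S}

/-- Operations sending projective modules to projective modules. -/
def PreservesProjective (T : FGModuleCat.{u} R → FGModuleCat.{u} S) : Prop :=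
  ∀ P : FGModuleCat.{u} R, Module.Projective R P → Module.Projective S (T P)

/-- The homomorphism of groups `K₀` induced by an additive operation preserving projectives. -/
def K0map (hT : IsAdditiveOp T) (hproj : PreservesProjective T) : K0 R →+ K0 S :=
  QuotientAddGroup.lift _ (FreeAbelianGroup.lift fun M => cls (T M)) <| by
    rw [AddSubgroup.closure_le]
    rintro x (⟨M, M', M'', ⟨e⟩, rfl⟩ | ⟨P, hP, rfl⟩)
    · obtain ⟨d⟩ := hT.nonempty_equiv_prod e
      simp [cls_eq_add d]
    · simp [cls_eq_zero (hproj P hP)]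

variable {hT : IsAdditiveOp T} {hproj : PreservesProjective T}

theorem K0map_cls (M : FGModuleCat.{u} R) : K0map hT hproj (cls M) = cls (T M) :=
  FreeAbelianGroup.lift_apply_of _ _

theorem addSubgroupOf_le_comap_K0map [IsArtinianRing R] [IsArtinianRing S] (M : FGModuleCat.{u} R) :
    addSubgroupOf M ≤ (addSubgroupOf (T M)).comap (K0map hT hproj) := by
  refine addSubgroupOf_le.mpr fun N hN => ?_
  rw [AddSubgroup.mem_comap, K0map_cls]
  exact cls_mem_addSubgroupOf (hT.isSummand hN)

end K0map

variable [IsArtinianRing R]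

theorem omegaBar_cls (M : FGModuleCat.{u} R) : omegaBar R (cls M) = cls (syzygy M) :=
  FreeAbelianGroup.lift_apply_of _ _

theorem phiDim_eq_zero_iff (D : Set (FGModuleCat.{u} R)) :
    phiDim D = 0 ↔ ∀ M ∈ D, ∀ m, Set.InjOn (omegaBar R)^[m] (addSubgroupOf M : Set (K0 R)) := by
  simp only [phiDim, ENat.iSup_eq_zero, phi, fittingIndex_eq_zero_iff]

namespace IsZeroIT

variable {D : Set (FGModuleCat.{u} R)} (hD : IsZeroIT D)
include hD

theorem of_subsingleton (M : FGModuleCat.{u} R) [Subsingleton M] : M ∈ D := by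
  rw [hD.add_eq]
  exact addClosure_of_subsingleton M

theorem prod {M N : FGModuleCat.{u} R} (hM : M ∈ D) (hN : N ∈ D) :
    FGModuleCat.of R (M × N) ∈ D := by
  rw [hD.add_eq] at hM hN ⊢
  exact addClosure_prod hM hN

theorem of_isSummand {M N : FGModuleCat.{u} R} (h : IsSummand M N) (hN : N ∈ D) : M ∈ D := by
  rw [hD.add_eq]
  exact addClosure_of_isSummand hN h

theorem congr {M N : FGModuleCat.{u} R} (e : M ≃ₗ[R] N) (hM : M ∈ D) : N ∈ D :=
  hD.of_isSummand (IsSummand.of_equiv e.symm) hM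

theorem injOn {M : FGModuleCat.{u} R} (hM : M ∈ D) (m : ℕ) :
    Set.InjOn (omegaBar R)^[m] (addSubgroupOf M : Set (K0 R)) :=
  (phiDim_eq_zero_iff D).mp hD.phiDim_eq M hM m

end IsZeroIT

end Phi

/-! ### Additive functors -/

/-- Additive functors between categories of finitely generated modules, acting on unbundled linear
maps. -/
structure ModFunctor (R S : Type u) [Ring R] [Ring S] where
  obj : FGModuleCat.{u} R → FGModuleCat.{u} S
  map : ∀ {M N : FGModuleCat.{u} R}, (M →ₗ[R] N) → (obj M →ₗ[S] obj N)
  map_id : ∀ M : FGModuleCat.{u} R, map (LinearMap.id : M →ₗ[R] M) = LinearMap.id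
  map_comp : ∀ {L M N : FGModuleCat.{u} R} (g : M →ₗ[R] N) (f : L →ₗ[R] M),
    map (g.comp f) = (map g).comp (map f)
  map_add : ∀ {M N : FGModuleCat.{u} R} (f g : M →ₗ[R] N), map (f + g) = map f + map g

namespace ModFunctor

section General

variable {R S : Type u} [Ring R] [Ring S] (F : ModFunctor R S)

theorem map_zero (M N : FGModuleCat.{u} R) : F.map (0 : M →ₗ[R] N) = 0 := by
  have h := F.map_add (0 : M →ₗ[R] N) 0
  rwa [add_zero, left_eq_add] at h

theorem map_map {L M N : FGModuleCat.{u} R} (g : M →ₗ[R] N) (f : L →ₗ[R] M) (x : F.obj L) :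
    F.map g (F.map f x) = F.map (g.comp f) x := by
  rw [F.map_comp, LinearMap.comp_apply]

/-- The isomorphism `F(e)` induced by an isomorphism `e`. -/
def mapEquiv {M N : FGModuleCat.{u} R} (e : M ≃ₗ[R] N) : F.obj M ≃ₗ[S] F.obj N :=
  LinearEquiv.ofLinearMap (F.map e.toLinearMap) (F.map e.symm.toLinearMap)
    (by rw [← F.map_comp, LinearEquiv.comp_symm, F.map_id])
    (by rw [← F.map_comp, LinearEquiv.symm_comp, F.map_id])

/-- Additive functors preserve binary direct sums. -/
def prodEquiv (M N : FGModuleCat.{u} R) :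
    F.obj (FGModuleCat.of R (M × N)) ≃ₗ[S] (F.obj M × F.obj N) := by
  let p₁ : FGModuleCat.of R (M × N) →ₗ[R] M := LinearMap.fst R M N
  let p₂ : FGModuleCat.of R (M × N) →ₗ[R] N := LinearMap.snd R M N
  let i₁ : M →ₗ[R] FGModuleCat.of R (M × N) := LinearMap.inl R M N
  let i₂ : N →ₗ[R] FGModuleCat.of R (M × N) := LinearMap.inr R M N
  refine LinearEquiv.ofLinearMap ((F.map p₁).prod (F.map p₂)) ((F.map i₁).coprod (F.map i₂)) ?_ ?_
  · have h₁₁ : p₁.comp i₁ = LinearMap.id := rfl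
    have h₁₂ : p₁.comp i₂ = 0 := rfl
    have h₂₁ : p₂.comp i₁ = 0 := rfl
    have h₂₂ : p₂.comp i₂ = LinearMap.id := rfl
    refine LinearMap.ext fun x => Prod.ext ?_ ?_
    · simp [F.map_map, h₁₁, h₁₂, F.map_id, F.map_zero]
    · simp [F.map_map, h₂₁, h₂₂, F.map_id, F.map_zero]
  · have h : i₁.comp p₁ + i₂.comp p₂ = LinearMap.id :=
      LinearMap.ext fun x => Prod.ext (add_zero x.1) (zero_add x.2)
    refine LinearMap.ext fun x => ?_
    change F.map i₁ (F.map p₁ x) + F.map i₂ (F.map p₂ x) = x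
    rw [F.map_map, F.map_map, ← LinearMap.add_apply, ← F.map_add, h, F.map_id, LinearMap.id_apply]

theorem obj_subsingleton (M : FGModuleCat.{u} R) [Subsingleton M] : Subsingleton (F.obj M) := by
  have h : (LinearMap.id : M →ₗ[R] M) = 0 := Subsingleton.elim _ _
  have h' := F.map_id M
  rw [h, F.map_zero] at h'
  refine ⟨fun x y => ?_⟩
  have hx := LinearMap.congr_fun h' x
  have hy := LinearMap.congr_fun h' y
  exact hx.symm.trans hy

theorem isAdditiveOp : IsAdditiveOp F.obj :=
  ⟨fun e => ⟨F.mapEquiv e⟩, fun M N => ⟨F.prodEquiv M N⟩, fun M _ => F.obj_subsingleton M⟩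

/-- Exact functors. -/
def IsExact : Prop :=
  ∀ ⦃L M N : FGModuleCat.{u} R⦄ (f : L →ₗ[R] M) (g : M →ₗ[R] N), Function.Exact f g →
    Function.Exact (F.map f) (F.map g)

/-- Functors preserving projective covers. -/
def PreservesCover : Prop :=
  ∀ ⦃P M : FGModuleCat.{u} R⦄ (f : P →ₗ[R] M), IsProjectiveCover f → IsProjectiveCover (F.map f)

variable {F}

theorem IsExact.injective (hF : F.IsExact) {M N : FGModuleCat.{u} R} {f : M →ₗ[R] N}
    (hf : Function.Injective f) : Function.Injective (F.map f) := by
  have h := hF (0 : M →ₗ[R] M) f ((LinearMap.exact_zero_iff_injective M f).mpr hf)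
  rwa [F.map_zero, LinearMap.exact_zero_iff_injective] at h

theorem IsExact.surjective (hF : F.IsExact) {M N : FGModuleCat.{u} R} {f : M →ₗ[R] N}
    (hf : Function.Surjective f) : Function.Surjective (F.map f) := by
  have h := hF f (0 : N →ₗ[R] N) ((LinearMap.exact_zero_iff_surjective N f).mpr hf)
  rwa [F.map_zero, LinearMap.exact_zero_iff_surjective] at h

theorem PreservesCover.preservesProjective (hF : F.PreservesCover) :
    PreservesProjective F.obj :=
  fun P hP => (hF (LinearMap.id : P →ₗ[R] P) ⟨hP, Function.surjective_id, fun L hL => by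
    simpa using hL⟩).1

variable [IsArtinianRing R] [IsArtinianRing S]

theorem PreservesCover.nonempty_syzygy_equiv (hF : F.PreservesCover) (hE : F.IsExact)
    (M : FGModuleCat.{u} R) : Nonempty (syzygy (F.obj M) ≃ₗ[S] F.obj (syzygy M)) := by
  obtain ⟨e⟩ := (hF _ (projCoverMap_spec M)).nonempty_syzygy_equiv
  let i : syzygy M →ₗ[R] projCover M := (LinearMap.ker (projCoverMap M)).subtype
  have hker : LinearMap.ker (F.map (projCoverMap M)) = LinearMap.range (F.map i) :=
    (hE i (projCoverMap M) (LinearMap.exact_subtype_ker_map _)).linearMap_ker_eq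
  exact ⟨e.trans ((LinearEquiv.ofEq _ _ hker).trans
    (LinearEquiv.ofInjective (F.map i) (hE.injective (f := i) Subtype.val_injective)).symm)⟩

theorem PreservesCover.nonempty_iterate_syzygy_equiv (hF : F.PreservesCover) (hE : F.IsExact)
    (n : ℕ) (M : FGModuleCat.{u} R) : Nonempty ((syzygy^[n] (F.obj M) : FGModuleCat.{u} S) ≃ₗ[S]
      F.obj (syzygy^[n] M)) := by
  induction n generalizing M with
  | zero => exact ⟨LinearEquiv.refl _ _⟩
  | succ n ih =>
    obtain ⟨e⟩ := hF.nonempty_syzygy_equiv hE M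
    obtain ⟨e'⟩ := (isAdditiveOp_iterate_syzygy n).congr e
    obtain ⟨e''⟩ := ih (syzygy M)
    exact ⟨e'.trans e''⟩

theorem PreservesCover.semiconj_K0map (hF : F.PreservesCover) (hE : F.IsExact) :
    Function.Semiconj (K0map F.isAdditiveOp hF.preservesProjective) (omegaBar R) (omegaBar S) := by
  refine DFunLike.congr_fun
    (f := (K0map F.isAdditiveOp hF.preservesProjective).comp (omegaBar R))
    (g := (omegaBar S).comp (K0map F.isAdditiveOp hF.preservesProjective))
    (K0_hom_ext fun M => ?_)
  obtain ⟨e⟩ := hF.nonempty_syzygy_equiv hE M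
  rw [AddMonoidHom.comp_apply, AddMonoidHom.comp_apply, omegaBar_cls, K0map_cls, K0map_cls,
    omegaBar_cls, cls_congr e]

end General

end ModFunctor

section Presentation

variable {R : Type u} [Ring R]

/-- A module `Z` admits an exact sequence `0 → V₁ ⊕ D₁ → V₀ ⊕ D₀ → Z → 0` with `V₀`, `V₁` in
`add V` and `D₀`, `D₁` in `D`. -/
def IsLITPresented (V : FGModuleCat.{u} R) (D : Set (FGModuleCat.{u} R)) (Z : FGModuleCat.{u} R) :
    Prop :=
  ∃ V₁ ∈ addClosure {V}, ∃ V₀ ∈ addClosure {V}, ∃ D₁ ∈ D, ∃ D₀ ∈ D,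
    ∃ (f : (V₁ × D₁) →ₗ[R] (V₀ × D₀)) (g : (V₀ × D₀) →ₗ[R] Z),
      Function.Injective f ∧ Function.Exact f g ∧ Function.Surjective g

variable {V : FGModuleCat.{u} R} {D : Set (FGModuleCat.{u} R)}

theorem IsLITPresented.congr {Z Z' : FGModuleCat.{u} R} (h : IsLITPresented V D Z)
    (e : Z ≃ₗ[R] Z') : IsLITPresented V D Z' := by
  obtain ⟨V₁, hV₁, V₀, hV₀, D₁, hD₁, D₀, hD₀, f, g, hf, hfg, hg⟩ := h
  exact ⟨V₁, hV₁, V₀, hV₀, D₁, hD₁, D₀, hD₀, f, e.toLinearMap ∘ₗ g, hf,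
    hfg.comp_injective e e.injective (map_zero e), e.surjective.comp hg⟩

theorem IsLITPresented.map {S : Type u} [Ring S] {F : ModFunctor R S} (hF : F.IsExact)
    {V' : FGModuleCat.{u} S} {D' : Set (FGModuleCat.{u} S)} (hV : IsSummand (F.obj V) V')
    (hD : ∀ X ∈ D, F.obj X ∈ D') {Z : FGModuleCat.{u} R} (h : IsLITPresented V D Z) :
    IsLITPresented V' D' (F.obj Z) := by
  obtain ⟨V₁, hV₁, V₀, hV₀, D₁, hD₁, D₀, hD₀, f, g, hf, hfg, hg⟩ := h
  have hadd : ∀ X ∈ addClosure {V}, F.obj X ∈ addClosure {V'} := fun X hX =>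
    F.isAdditiveOp.mem_addClosure (by rintro _ rfl; exact ⟨V', rfl, hV⟩) hX
  let f' : FGModuleCat.of R (V₁ × D₁) →ₗ[R] FGModuleCat.of R (V₀ × D₀) := f
  let g' : FGModuleCat.of R (V₀ × D₀) →ₗ[R] Z := g
  let e₁ := F.prodEquiv V₁ D₁
  let e₀ := F.prodEquiv V₀ D₀
  refine ⟨_, hadd V₁ hV₁, _, hadd V₀ hV₀, _, hD D₁ hD₁, _, hD D₀ hD₀,
    e₀.toLinearMap ∘ₗ F.map f' ∘ₗ e₁.symm.toLinearMap, F.map g' ∘ₗ e₀.symm.toLinearMap,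
    e₀.injective.comp ((hF.injective (f := f') hf).comp e₁.symm.injective), ?_,
    (hF.surjective (f := g') hg).comp e₀.symm.surjective⟩
  refine (LinearEquiv.conj_exact_iff_exact (F.map f' ∘ₗ e₁.symm.toLinearMap) (F.map g') e₀).mpr ?_
  rw [Function.Exact, LinearMap.coe_comp, LinearEquiv.coe_coe, e₁.symm.surjective.range_comp]
  exact hF f' g' hfg

theorem IsLITPresented.prod
    (hD : ∀ X Y : FGModuleCat.{u} R, X ∈ D → Y ∈ D → FGModuleCat.of R (X × Y) ∈ D)
    {Z Z' : FGModuleCat.{u} R} (h : IsLITPresented V D Z) (h' : IsLITPresented V D Z') :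
    IsLITPresented V D (FGModuleCat.of R (Z × Z')) := by
  obtain ⟨V₁, hV₁, V₀, hV₀, D₁, hD₁, D₀, hD₀, f, g, hf, hfg, hg⟩ := h
  obtain ⟨W₁, hW₁, W₀, hW₀, E₁, hE₁, E₀, hE₀, f', g', hf', hfg', hg'⟩ := h'
  let e₁ := LinearEquiv.prodProdProdComm R V₁ W₁ D₁ E₁
  let e₀ := LinearEquiv.prodProdProdComm R V₀ D₀ W₀ E₀
  have hexact : Function.Exact (f.prodMap f') (g.prodMap g') := fun x => by
    simp only [LinearMap.prodMap_apply, Prod.mk_eq_zero, hfg x.1, hfg' x.2,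
      LinearMap.coe_prodMap, Set.range_prodMap, Set.mem_prod]
  refine ⟨_, addClosure_prod hV₁ hW₁, _, addClosure_prod hV₀ hW₀, _, hD _ _ hD₁ hE₁, _,
    hD _ _ hD₀ hE₀, e₀.toLinearMap ∘ₗ f.prodMap f' ∘ₗ e₁.toLinearMap,
    g.prodMap g' ∘ₗ e₀.symm.toLinearMap,
    e₀.injective.comp ((hf.prodMap hf').comp e₁.injective), ?_,
    (hg.prodMap hg').comp e₀.symm.surjective⟩
  refine (LinearEquiv.conj_exact_iff_exact (f.prodMap f' ∘ₗ e₁.toLinearMap)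
    (g.prodMap g') e₀).mpr ?_
  rw [Function.Exact, LinearMap.coe_comp, LinearEquiv.coe_coe, e₁.surjective.range_comp]
  exact hexact

theorem IsLITPresented.of_mem_addClosure
    (hD : ∀ X : FGModuleCat.{u} R, Subsingleton X → X ∈ D) {Z : FGModuleCat.{u} R}
    (hZ : Z ∈ addClosure {V}) : IsLITPresented V D Z := by
  let e : (Z × PUnit.{u + 1}) ≃ₗ[R] Z := LinearEquiv.prodUnique
  exact ⟨FGModuleCat.of R PUnit, addClosure_of_subsingleton _, Z, hZ, FGModuleCat.of R PUnit,
    hD _ inferInstance, FGModuleCat.of R PUnit, hD _ inferInstance, 0, e.toLinearMap,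
    Function.injective_of_subsingleton _,
    (LinearMap.exact_zero_iff_injective _ e.toLinearMap).mpr e.injective, e.surjective⟩

end Presentation

/-! ### Change of rings -/

section Restrict

variable {R S T : Type u} [Ring R] [Ring S] [Ring T]

/-- The restriction of scalars of an `S`-module along `σ : R →+* S`, as a type synonym. -/
def Restrict (_σ : R →+* S) (X : Type u) : Type u := X

variable (σ : R →+* S) (X Y : Type u) [AddCommGroup X] [Module S X] [AddCommGroup Y] [Module S Y]

instance : AddCommGroup (Restrict σ X) := inferInstanceAs (AddCommGroup X)

instance : Module R (Restrict σ X) := Module.compHom X σ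

/-- The identity of `X`, as a semilinear map from the restriction of scalars. -/
def ofRestrict : Restrict σ X →ₛₗ[σ] X where
  toFun x := x
  map_add' _ _ := rfl
  map_smul' _ _ := rfl

variable {σ X Y}

/-- A `τ ∘ σ`-semilinear map, as a `σ`-semilinear map to the restriction of scalars along `τ`. -/
def toRestrict {M L : Type u} [AddCommGroup M] [Module R M] [AddCommGroup L] [Module T L]
    {τ : S →+* T} {ρ : R →+* T} [RingHomCompTriple σ τ ρ] (f : M →ₛₗ[ρ] L) :
    M →ₛₗ[σ] Restrict τ L where
  toFun := f
  map_add' := map_add f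
  map_smul' r x := (map_smulₛₗ f r x).trans
    (congrArg (· • f x) (RingHomCompTriple.comp_apply (σ₁₂ := σ) (σ₂₃ := τ)).symm)

/-- A linear map, as a linear map of restrictions of scalars. -/
def restrictMap (σ : R →+* S) (f : X →ₗ[S] Y) : Restrict σ X →ₗ[R] Restrict σ Y :=
  toRestrict (f.comp (ofRestrict σ X))

theorem finite_restrict [RingHomSurjective σ] [Module.Finite S X] :
    Module.Finite R (Restrict σ X) := by
  obtain ⟨s, hs⟩ := Module.Finite.fg_top (R := S) (M := X)
  refine ⟨⟨(s : Finset (Restrict σ X)), ?_⟩⟩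
  refine Submodule.map_injective_of_injective (f := ofRestrict σ X) Function.injective_id ?_
  rw [Submodule.map_span, Submodule.map_top, LinearMap.range_eq_top.mpr Function.surjective_id]
  exact (congrArg (Submodule.span S) (Set.image_id _)).trans hs

end Restrict

section ScalarExtension

variable {R S T : Type u} [Ring R] [Ring S] [Ring T] {σ : R →+* S} {τ : S →+* T}
  {M M' N N' : Type u} [AddCommGroup M] [Module R M] [AddCommGroup M'] [Module R M']
  [AddCommGroup N] [Module S N] [AddCommGroup N'] [Module S N']

/-- `u : M → N` exhibits `N` as the extension of scalars `S ⊗ M` of the `R`-module `M` along `σ`.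
The universal property replaces the tensor product, as `R` is not commutative. -/
def IsScalarExtension (u : M →ₛₗ[σ] N) : Prop :=
  ∀ ⦃L : Type u⦄ [AddCommGroup L] [Module S L] (f : M →ₛₗ[σ] L), ∃! g : N →ₗ[S] L, g.comp u = f

namespace IsScalarExtension

variable {u : M →ₛₗ[σ] N} (hu : IsScalarExtension u)
include hu

theorem hom_ext {L : Type u} [AddCommGroup L] [Module S L] {g g' : N →ₗ[S] L}
    (h : g.comp u = g'.comp u) : g = g' :=
  (hu (g'.comp u)).unique h rfl

theorem eq_top {L : Submodule S N} (h : ∀ x, u x ∈ L) : L = ⊤ := by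
  have hzero : L.mkQ = 0 :=
    hu.hom_ext (LinearMap.ext fun x => (Submodule.Quotient.mk_eq_zero L).mpr (h x))
  rw [← L.ker_mkQ, hzero, LinearMap.ker_zero]

theorem comp {P : Type u} [AddCommGroup P] [Module T P] {ρ : R →+* T} [RingHomCompTriple σ τ ρ]
    {v : N →ₛₗ[τ] P} (hv : IsScalarExtension v) :
    IsScalarExtension (v.comp u : M →ₛₗ[ρ] P) := by
  intro L _ _ f
  obtain ⟨g, hg, -⟩ := hu (toRestrict (τ := τ) f)
  obtain ⟨h, hh, -⟩ := hv ((ofRestrict τ L).comp g)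
  refine ⟨h, LinearMap.ext fun x => ?_, fun h' hh' => hv.hom_ext ?_⟩
  · exact (LinearMap.congr_fun hh (u x)).trans (LinearMap.congr_fun hg x)
  · have hg' : (toRestrict (h'.comp v) : N →ₗ[S] Restrict τ L) = g :=
      hu.hom_ext (LinearMap.ext fun x =>
        (LinearMap.congr_fun hh' x).trans (LinearMap.congr_fun hg x).symm)
    exact LinearMap.ext fun y => (LinearMap.congr_fun hg' y).trans (LinearMap.congr_fun hh y).symm

theorem exists_equiv {u' : M →ₛₗ[σ] N'} (hu' : IsScalarExtension u') :
    ∃ e : N ≃ₗ[S] N', e.toLinearMap.comp u = u' := by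
  obtain ⟨g, hg, -⟩ := hu u'
  obtain ⟨g', hg', -⟩ := hu' u
  refine ⟨LinearEquiv.ofLinearMap g g' (hu'.hom_ext ?_) (hu.hom_ext ?_), hg⟩
  · rw [LinearMap.comp_assoc, hg', hg, LinearMap.id_comp]
  · rw [LinearMap.comp_assoc, hg, hg', LinearMap.id_comp]

theorem finite [Module.Finite R M] : Module.Finite S N := by
  obtain ⟨s, hs⟩ := Module.Finite.fg_top (R := R) (M := M)
  classical
  refine ⟨⟨s.image u, hu.eq_top fun x => ?_⟩⟩
  have hx : x ∈ (Submodule.span S (s.image u : Set N)).comap u := by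
    refine (Submodule.span_le (s := (s : Set M)).mpr fun y hy => ?_)
      (hs ▸ Submodule.mem_top (x := x))
    exact Submodule.subset_span (Finset.mem_coe.mpr (Finset.mem_image_of_mem u hy))
  exact hx

theorem projective [Module.Projective R M] : Module.Projective S N := by
  refine Module.Projective.of_lifting_property fun {X Y} _ _ _ _ f g hf => ?_
  obtain ⟨h, hh⟩ := Module.projective_lifting_property
    (restrictMap σ f) (toRestrict (g.comp u) : M →ₗ[R] Restrict σ Y) hf
  obtain ⟨h', hh', -⟩ := hu ((ofRestrict σ X).comp h)
  refine ⟨h', hu.hom_ext (LinearMap.ext fun x => ?_)⟩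
  exact (congrArg f (LinearMap.congr_fun hh' x)).trans (LinearMap.congr_fun hh x)

end IsScalarExtension

theorem isScalarExtension_id : IsScalarExtension (LinearMap.id : M →ₗ[R] M) :=
  fun _ _ _ f => ⟨f, LinearMap.comp_id f, fun g hg => (LinearMap.comp_id g).symm.trans hg⟩

theorem isScalarExtension_ofRestrict [RingHomSurjective σ] :
    IsScalarExtension (ofRestrict σ N) := by
  refine fun L _ _ f => ⟨{ f with map_smul' := fun s x => ?_ }, rfl, fun g hg => ?_⟩
  · obtain ⟨r, rfl⟩ := RingHomSurjective.is_surjective (σ := σ) s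
    exact map_smulₛₗ f r x
  · exact LinearMap.ext fun x => LinearMap.congr_fun hg x

variable (σ) in
/-- A construction of the extension of scalars along `σ` for all finitely generated modules. -/
structure ScalarExtension where
  obj : FGModuleCat.{u} R → FGModuleCat.{u} S
  unit : ∀ M : FGModuleCat.{u} R, M →ₛₗ[σ] obj M
  isScalarExtension : ∀ M, IsScalarExtension (unit M)

namespace ScalarExtension

variable (E : ScalarExtension σ)

/-- The linear map `S ⊗ M → S ⊗ N` induced by `M → N`. -/
def map {M N : FGModuleCat.{u} R} (f : M →ₗ[R] N) : E.obj M →ₗ[S] E.obj N :=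
  (E.isScalarExtension M ((E.unit N).comp f)).choose

theorem map_comp_unit {M N : FGModuleCat.{u} R} (f : M →ₗ[R] N) :
    (E.map f).comp (E.unit M) = (E.unit N).comp f :=
  (E.isScalarExtension M ((E.unit N).comp f)).choose_spec.1

theorem map_unit {M N : FGModuleCat.{u} R} (f : M →ₗ[R] N) (x : M) :
    E.map f (E.unit M x) = E.unit N (f x) :=
  LinearMap.congr_fun (E.map_comp_unit f) x

/-- Extension of scalars, as an additive functor. -/
def functor : ModFunctor R S where
  obj := E.obj
  map := E.map
  map_id M := (E.isScalarExtension M).hom_ext (LinearMap.ext fun x => E.map_unit _ x)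
  map_comp g f := (E.isScalarExtension _).hom_ext (LinearMap.ext fun x => by
    simp only [LinearMap.comp_apply, map_unit])
  map_add f g := (E.isScalarExtension _).hom_ext (LinearMap.ext fun x => by
    simp only [LinearMap.comp_apply, LinearMap.add_apply, map_unit, map_add])

theorem map_surjective {M N : FGModuleCat.{u} R} {f : M →ₗ[R] N} (hf : Function.Surjective f) :
    Function.Surjective (E.map f) := by
  refine LinearMap.range_eq_top.mp ((E.isScalarExtension N).eq_top fun y => ?_)
  obtain ⟨x, rfl⟩ := hf y
  exact ⟨E.unit M x, E.map_unit f x⟩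

theorem preservesProjective : PreservesProjective E.functor.obj :=
  fun P _ => (E.isScalarExtension P).projective

theorem preservesCover (h : ∀ ⦃P M : FGModuleCat.{u} R⦄ (f : P →ₗ[R] M),
      IsProjectiveCover f → IsSuperfluous (LinearMap.ker (E.map f))) :
    E.functor.PreservesCover := fun P _ f hf =>
  ⟨E.preservesProjective P hf.1, E.map_surjective hf.2.1, h f hf⟩

theorem nonempty_obj_obj_equiv {τ : S →+* R} [RingHomCompTriple σ τ (RingHom.id R)]
    (E' : ScalarExtension τ) (M : FGModuleCat.{u} R) :
    Nonempty (E'.obj (E.obj M) ≃ₗ[R] M) := by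
  obtain ⟨e, -⟩ := ((E.isScalarExtension M).comp (ρ := RingHom.id R)
    (E'.isScalarExtension (E.obj M))).exists_equiv isScalarExtension_id
  exact ⟨e⟩

end ScalarExtension

end ScalarExtension

section Reduce

variable {R S : Type u} [Ring R] [Ring S] (p : R →+* S) (M : Type u) [AddCommGroup M] [Module R M]

/-- The quotient of `M` by the kernel of `p`, which is the extension of scalars of `M` along a
surjective ring homomorphism `p`. -/
def Reduce : Type u := M ⧸ (RingHom.ker p • ⊤ : Submodule R M)

instance : AddCommGroup (Reduce p M) :=
  inferInstanceAs (AddCommGroup (M ⧸ (RingHom.ker p • ⊤ : Submodule R M)))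

theorem isTorsionBySet_quotient_ker_smul_top :
    Module.IsTorsionBySet R (M ⧸ (RingHom.ker p • ⊤ : Submodule R M)) (RingHom.ker p) := by
  rintro x ⟨r, hr⟩
  obtain ⟨m, rfl⟩ := Submodule.mkQ_surjective _ x
  exact (Submodule.Quotient.mk_eq_zero _).mpr (Submodule.smul_mem_smul hr trivial)

instance : Module (R ⧸ RingHom.ker p) (Reduce p M) :=
  (isTorsionBySet_quotient_ker_smul_top p M).module

variable [RingHomSurjective p]

variable {p} in
/-- The inverse of the isomorphism `R / ker p ≅ S`. -/
def kerQuotientEquiv : S ≃+* R ⧸ RingHom.ker p :=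
  (RingHom.quotientKerEquivOfSurjective (RingHomSurjective.is_surjective (σ := p))).symm

instance : Module S (Reduce p M) :=
  Module.compHom (Reduce p M) (kerQuotientEquiv (p := p)).toRingHom

/-- The canonical semilinear map to the extension of scalars. -/
def toReduce : M →ₛₗ[p] Reduce p M where
  toFun := (RingHom.ker p • ⊤ : Submodule R M).mkQ
  map_add' _ _ := rfl
  map_smul' r x := by
    have h : Ideal.Quotient.mk (RingHom.ker p) r = kerQuotientEquiv (p r) :=
      ((RingEquiv.symm_apply_eq _).mpr rfl).symm
    let x' : Reduce p M := (RingHom.ker p • ⊤ : Submodule R M).mkQ x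
    exact congrArg (· • x') h

theorem toReduce_surjective : Function.Surjective (toReduce p M) :=
  Submodule.mkQ_surjective _

theorem ker_toReduce : LinearMap.ker (toReduce p M) = RingHom.ker p • ⊤ :=
  Submodule.ext fun _ => Submodule.Quotient.mk_eq_zero _

theorem isScalarExtension_toReduce : IsScalarExtension (toReduce p M) := by
  intro L _ _ f
  have hker : RingHom.ker p • ⊤ ≤ LinearMap.ker f := Submodule.smul_le.mpr fun r hr x _ => by
    rw [LinearMap.mem_ker, map_smulₛₗ, RingHom.mem_ker.mp hr, zero_smul]
  refine ⟨{ Submodule.liftQ _ f hker with map_smul' := fun s x => ?_ }, LinearMap.ext fun x => rfl,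
    fun g hg => ?_⟩
  · obtain ⟨r, rfl⟩ := RingHomSurjective.is_surjective (σ := p) s
    obtain ⟨m, rfl⟩ := toReduce_surjective p M x
    rw [← map_smulₛₗ]
    exact map_smulₛₗ f r m
  · refine LinearMap.ext fun x => ?_
    obtain ⟨m, rfl⟩ := toReduce_surjective p M x
    exact LinearMap.congr_fun hg m

/-- Extension of scalars along a surjective ring homomorphism. -/
def reduce : ScalarExtension p where
  obj M :=
    have := (isScalarExtension_toReduce p M).finite
    FGModuleCat.of S (Reduce p M)
  unit M := toReduce p M
  isScalarExtension M := isScalarExtension_toReduce p M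

theorem ker_reduce_map_le {M N : FGModuleCat.{u} R} {f : M →ₗ[R] N}
    (hf : Function.Surjective f) :
    LinearMap.ker ((reduce p).map f) ≤ (LinearMap.ker f).map ((reduce p).unit M) := by
  intro z hz
  obtain ⟨x, rfl⟩ := toReduce_surjective p M z
  have hx : f x ∈ LinearMap.ker (toReduce p N) := ((reduce p).map_unit f x).symm.trans hz
  rw [ker_toReduce, ← LinearMap.range_eq_top.mpr hf, ← Submodule.map_top, ← Submodule.map_smul'',
    ← ker_toReduce] at hx
  obtain ⟨w, hw, hwx⟩ := hx
  refine ⟨x - w, ?_, ?_⟩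
  · rw [SetLike.mem_coe, LinearMap.mem_ker, map_sub, hwx, sub_self]
  · exact (map_sub (toReduce p M) x w).trans
      ((congrArg _ (LinearMap.mem_ker.mp hw)).trans (sub_zero _))

theorem reduce_preservesCover : (reduce p).functor.PreservesCover :=
  (reduce p).preservesCover fun P _ _ hf =>
    (hf.isSuperfluous_ker.map (toReduce p P)).mono (ker_reduce_map_le p hf.2.1)

end Reduce

/-! ### Products of rings -/

section DirectFactor

variable {R S : Type u} [Ring R] [Ring S]

/-- `p` is the projection of `R` onto the direct factor corresponding to the central idempotent
`e`. -/
structure IsDirectFactor (p : R →+* S) (e : R) : Prop where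
  map_eq_one : p e = 1
  commute : ∀ r, Commute e r
  mul_eq_zero : ∀ r, p r = 0 → e * r = 0

section Restrict

variable (p : R →+* S) [RingHomSurjective p]

instance (X : Type u) [AddCommGroup X] [Module S X] [Module.Finite S X] :
    Module.Finite R (Restrict p X) :=
  finite_restrict

/-- Restriction of scalars along a surjective ring homomorphism, as an additive functor. -/
def restrict : ModFunctor S R where
  obj X := FGModuleCat.of R (Restrict p X)
  map {X Y} f := (restrictMap p f : Restrict p X →ₗ[R] Restrict p Y)
  map_id _ := rfl
  map_comp _ _ := rfl
  map_add _ _ := rfl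

theorem restrict_isExact : (restrict p).IsExact := fun _ _ _ _ _ h => h

theorem nonempty_reduce_restrict_equiv (X : FGModuleCat.{u} S) :
    Nonempty ((reduce p).obj ((restrict p).obj X) ≃ₗ[S] X) := by
  obtain ⟨d, -⟩ := ((reduce p).isScalarExtension ((restrict p).obj X)).exists_equiv
    (isScalarExtension_ofRestrict (σ := p) (N := X))
  exact ⟨d⟩

end Restrict

namespace IsDirectFactor

variable {p : R →+* S} {e : R} (hp : IsDirectFactor p e)
include hp

theorem smul_ker_smul_top {M : Type u} [AddCommGroup M] [Module R M] {x : M}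
    (hx : x ∈ RingHom.ker p • (⊤ : Submodule R M)) : e • x = 0 := by
  refine Submodule.smul_induction_on hx (fun r hr x _ => ?_) fun x y hx hy => ?_
  · rw [smul_smul, hp.mul_eq_zero r hr, zero_smul]
  · rw [smul_add, hx, hy, add_zero]

theorem smul_map_restrict {X Y : Type u} [AddCommGroup X] [Module S X] [AddCommGroup Y] [Module R Y]
    (f : Restrict p X →ₗ[R] Y) (x : Restrict p X) : e • f x = f x := by
  have hx : e • x = x := (congrArg (· • (ofRestrict p X x)) hp.map_eq_one).trans (one_smul S _)
  rw [← map_smul, hx]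

variable [RingHomSurjective p]

/-- The section `x̄ ↦ e x` of the canonical map from `M` to its extension of scalars. -/
def reduceSection (M : Type u) [AddCommGroup M] [Module R M] :
    Restrict p (Reduce p M) →ₗ[R] M where
  __ := (RingHom.ker p • ⊤ : Submodule R M).liftQ
    { toFun := fun x => e • x
      map_add' := smul_add e
      map_smul' := fun r x => by rw [smul_smul, smul_smul, (hp.commute r).eq, RingHom.id_apply] }
    fun _ => hp.smul_ker_smul_top
  map_smul' r x := by
    obtain ⟨m, rfl⟩ := toReduce_surjective p M x
    have h : p r • toReduce p M m = toReduce p M (r • m) := (map_smulₛₗ _ r m).symm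
    refine (congrArg _ h).trans ?_
    change e • r • m = r • e • m
    rw [smul_smul, smul_smul, (hp.commute r).eq]

theorem reduceSection_toReduce {M : Type u} [AddCommGroup M] [Module R M] (x : M) :
    hp.reduceSection M (toReduce p M x) = e • x :=
  rfl

theorem toReduce_reduceSection {M : Type u} [AddCommGroup M] [Module R M] (x : Reduce p M) :
    toReduce p M (hp.reduceSection M x) = x := by
  obtain ⟨m, rfl⟩ := toReduce_surjective p M x
  rw [reduceSection_toReduce, map_smulₛₗ, hp.map_eq_one, one_smul]

theorem reduce_isExact : (reduce p).functor.IsExact := by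
  refine fun L M N f g hfg x => ⟨fun hx => ?_, ?_⟩
  · obtain ⟨x, rfl⟩ := toReduce_surjective p M x
    have hgx : g x ∈ RingHom.ker p • (⊤ : Submodule R N) := by
      rw [← ker_toReduce]
      exact ((reduce p).map_unit g x).symm.trans hx
    obtain ⟨y, hy⟩ := (hfg (e • x)).mp (by rw [map_smul, hp.smul_ker_smul_top hgx])
    refine ⟨toReduce p L y, ((reduce p).map_unit f y).trans ?_⟩
    rw [hy]
    exact hp.toReduce_reduceSection (toReduce p M x)
  · rintro ⟨y, rfl⟩
    rw [ModFunctor.map_map, hfg.linearMap_comp_eq_zero, ModFunctor.map_zero]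
    rfl

theorem projective_restrict {P : Type u} [AddCommGroup P] [Module S P] [Module.Projective S P] :
    Module.Projective R (Restrict p P) := by
  refine Module.Projective.of_lifting_property fun {X Y} _ _ _ _ f g hf => ?_
  obtain ⟨g', hg', -⟩ := isScalarExtension_ofRestrict (σ := p) ((toReduce p Y).comp g)
  obtain ⟨f', hf', -⟩ := isScalarExtension_toReduce p X ((toReduce p Y).comp f)
  have hf'surj : Function.Surjective f' := fun y => by
    obtain ⟨y, rfl⟩ := toReduce_surjective p Y y
    obtain ⟨x, rfl⟩ := hf y
    exact ⟨toReduce p X x, LinearMap.congr_fun hf' x⟩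
  obtain ⟨h, hh⟩ := Module.projective_lifting_property f' g' hf'surj
  refine ⟨(hp.reduceSection X).comp (restrictMap p h), LinearMap.ext fun z => ?_⟩
  have hz : toReduce p Y (f (hp.reduceSection X (h z))) = toReduce p Y (g z) := calc
    _ = f' (toReduce p X (hp.reduceSection X (h z))) := (LinearMap.congr_fun hf' _).symm
    _ = g' z := by rw [toReduce_reduceSection]; exact LinearMap.congr_fun hh z
    _ = _ := LinearMap.congr_fun hg' z
  have hsmul := congrArg (hp.reduceSection Y) hz
  rw [reduceSection_toReduce, reduceSection_toReduce, hp.smul_map_restrict g] at hsmul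
  exact (hp.smul_map_restrict (f ∘ₗ hp.reduceSection X) (h z)).symm.trans hsmul

theorem restrict_preservesProjective : PreservesProjective (restrict p).obj :=
  fun P _ => hp.projective_restrict (P := P)

end IsDirectFactor

end DirectFactor

section Factor

variable {R S : Type u} [Ring R] [Ring S] [IsArtinianRing R] [IsArtinianRing S]

theorem ModFunctor.PreservesCover.K0map_eq {F : ModFunctor R S} (hF : F.PreservesCover)
    (hE : F.IsExact) {D : Set (FGModuleCat.{u} S)} (hD : IsZeroIT D) {M : FGModuleCat.{u} R}
    (hM : F.obj M ∈ D) {m : ℕ} {x y : K0 R} (hx : x ∈ addSubgroupOf M) (hy : y ∈ addSubgroupOf M)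
    (hxy : (omegaBar R)^[m] x = (omegaBar R)^[m] y) :
    K0map F.isAdditiveOp hF.preservesProjective x =
      K0map F.isAdditiveOp hF.preservesProjective y := by
  have hsemi := (hF.semiconj_K0map hE).iterate_right m
  refine hD.injOn hM m (addSubgroupOf_le_comap_K0map M hx) (addSubgroupOf_le_comap_K0map M hy) ?_
  rw [← hsemi x, ← hsemi y, hxy]

end Factor

section ComplementaryFactors

variable {R A B : Type u} [Ring R] [Ring A] [Ring B] {p : R →+* A} {q : R →+* B}
  [RingHomSurjective p] [RingHomSurjective q] {e e' : R}

namespace IsDirectFactor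

theorem map_eq_zero {S : Type u} [Ring S] {p : R →+* S} (hp : IsDirectFactor p e)
    (he : e + e' = 1) : p e' = 0 := by
  have h := congrArg p he
  rwa [map_add, hp.map_eq_one, map_one, add_eq_left] at h

variable (hp : IsDirectFactor p e) (hq : IsDirectFactor q e') (he : e + e' = 1)
include hp hq he

theorem toReduce_reduceSection_eq_zero {M : Type u} [AddCommGroup M] [Module R M]
    (y : Reduce q M) : toReduce p M (hq.reduceSection M y) = 0 := by
  obtain ⟨x, rfl⟩ := toReduce_surjective q M y
  rw [reduceSection_toReduce, map_smulₛₗ, hp.map_eq_zero he, zero_smul]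

theorem nonempty_equiv_prod (M : FGModuleCat.{u} R) :
    Nonempty (M ≃ₗ[R] ((restrict p).obj ((reduce p).obj M) ×
      (restrict q).obj ((reduce q).obj M))) := by
  have he' : e' + e = 1 := (add_comm _ _).trans he
  let f : M →ₗ[R] Restrict p (Reduce p M) := toRestrict (toReduce p M)
  let g : M →ₗ[R] Restrict q (Reduce q M) := toRestrict (toReduce q M)
  let s := hp.reduceSection M
  let t := hq.reduceSection M
  have hfs : ∀ x, f (s x) = x := hp.toReduce_reduceSection
  have hgt : ∀ x, g (t x) = x := hq.toReduce_reduceSection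
  have hft : ∀ x, f (t x) = 0 := hp.toReduce_reduceSection_eq_zero hq he
  have hgs : ∀ x, g (s x) = 0 := hq.toReduce_reduceSection_eq_zero hp he'
  have hprod : (f.prod g).comp (s.coprod t) = LinearMap.id := LinearMap.ext fun x => by
    simp [hfs, hgt, hft, hgs]
  have hcoprod : (s.coprod t).comp (f.prod g) = LinearMap.id := LinearMap.ext fun x => by
    have h : e • x + e' • x = x := by rw [← add_smul, he, one_smul]
    exact h
  exact ⟨LinearEquiv.ofLinearMap _ _ hprod hcoprod⟩

theorem subsingleton_reduce_restrict (X : FGModuleCat.{u} A) :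
    Subsingleton ((reduce q).obj ((restrict p).obj X)) := by
  have hzero : ∀ x : Restrict p X, toReduce q (Restrict p X) x = 0 := fun x => by
    have hx : e • x = x := hp.smul_map_restrict LinearMap.id x
    rw [← hx, map_smulₛₗ, hq.map_eq_zero ((add_comm _ _).trans he), zero_smul]
  refine subsingleton_of_forall_eq (0 : Reduce q (Restrict p X)) fun y => ?_
  obtain ⟨x, rfl⟩ := toReduce_surjective q _ y
  exact hzero x

end IsDirectFactor

variable {DA : Set (FGModuleCat.{u} A)} {DB : Set (FGModuleCat.{u} B)}

variable (p q DA DB) in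
/-- The modules over a product of two rings whose components over the factors lie in given
classes. -/
def factorClass : Set (FGModuleCat.{u} R) :=
  {M | (reduce p).obj M ∈ DA ∧ (reduce q).obj M ∈ DB}

variable (hp : IsDirectFactor p e) (hq : IsDirectFactor q e') (he : e + e' = 1)
include hp hq he

theorem factorClass_subsingleton : factorClass p q {M : FGModuleCat.{u} A | Subsingleton M}
    {M : FGModuleCat.{u} B | Subsingleton M} = {M : FGModuleCat.{u} R | Subsingleton M} := by
  refine Set.ext fun M => ⟨fun ⟨hA, hB⟩ => ?_, fun (hM : Subsingleton M) =>
    ⟨(reduce p).functor.obj_subsingleton M, (reduce q).functor.obj_subsingleton M⟩⟩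
  obtain ⟨d⟩ := hp.nonempty_equiv_prod hq he M
  have hA' : Subsingleton ((reduce p).obj M) := hA
  have hB' : Subsingleton ((reduce q).obj M) := hB
  have := (restrict p).obj_subsingleton ((reduce p).obj M)
  have := (restrict q).obj_subsingleton ((reduce q).obj M)
  exact d.toEquiv.subsingleton

theorem eq_of_K0map_reduce_eq {x y : K0 R}
    (hA : K0map (reduce p).functor.isAdditiveOp (reduce p).preservesProjective x =
      K0map (reduce p).functor.isAdditiveOp (reduce p).preservesProjective y)
    (hB : K0map (reduce q).functor.isAdditiveOp (reduce q).preservesProjective x =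
      K0map (reduce q).functor.isAdditiveOp (reduce q).preservesProjective y) : x = y := by
  let F := (K0map (restrict p).isAdditiveOp hp.restrict_preservesProjective).comp
    (K0map (reduce p).functor.isAdditiveOp (reduce p).preservesProjective)
  let G := (K0map (restrict q).isAdditiveOp hq.restrict_preservesProjective).comp
    (K0map (reduce q).functor.isAdditiveOp (reduce q).preservesProjective)
  have hFG : F + G = AddMonoidHom.id (K0 R) := K0_hom_ext fun M => by
    obtain ⟨d⟩ := hp.nonempty_equiv_prod hq he M
    simp only [F, G, AddMonoidHom.add_apply, AddMonoidHom.comp_apply, K0map_cls,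
      AddMonoidHom.id_apply]
    exact (cls_eq_add d).symm
  have hF : F x = F y :=
    congrArg (K0map (restrict p).isAdditiveOp hp.restrict_preservesProjective) hA
  have hG : G x = G y :=
    congrArg (K0map (restrict q).isAdditiveOp hq.restrict_preservesProjective) hB
  calc x = F x + G x := (DFunLike.congr_fun hFG x).symm
    _ = F y + G y := by rw [hF, hG]
    _ = y := DFunLike.congr_fun hFG y

variable [IsArtinianRing A] [IsArtinianRing B] [IsArtinianRing R]

theorem factorClass_isZeroIT (hA : IsZeroIT DA) (hB : IsZeroIT DB) :
    IsZeroIT (factorClass p q DA DB) where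
  add_eq := by
    refine eq_addClosure (fun M _ => ?_) (fun X Y hXY hY => ?_) fun X Y hX hY => ?_
    · have := (reduce p).functor.obj_subsingleton M
      have := (reduce q).functor.obj_subsingleton M
      exact ⟨hA.of_subsingleton ((reduce p).functor.obj M),
        hB.of_subsingleton ((reduce q).functor.obj M)⟩
    · exact ⟨hA.of_isSummand ((reduce p).functor.isAdditiveOp.isSummand hXY) hY.1,
        hB.of_isSummand ((reduce q).functor.isAdditiveOp.isSummand hXY) hY.2⟩
    · exact ⟨hA.congr (M := FGModuleCat.of A ((reduce p).obj X × (reduce p).obj Y))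
          ((reduce p).functor.prodEquiv X Y).symm (hA.prod hX.1 hY.1),
        hB.congr (M := FGModuleCat.of B ((reduce q).obj X × (reduce q).obj Y))
          ((reduce q).functor.prodEquiv X Y).symm (hB.prod hX.2 hY.2)⟩
  syzygy_mem M hM := by
    obtain ⟨d⟩ := (reduce_preservesCover p).nonempty_syzygy_equiv hp.reduce_isExact M
    obtain ⟨d'⟩ := (reduce_preservesCover q).nonempty_syzygy_equiv hq.reduce_isExact M
    exact ⟨hA.congr d (hA.syzygy_mem _ hM.1), hB.congr d' (hB.syzygy_mem _ hM.2)⟩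
  phiDim_eq := (phiDim_eq_zero_iff _).mpr fun _ hM _ _ hx _ hy hxy =>
    eq_of_K0map_reduce_eq hp hq he
      ((reduce_preservesCover p).K0map_eq hp.reduce_isExact hA hM.1 hx hy hxy)
      ((reduce_preservesCover q).K0map_eq hq.reduce_isExact hB hM.2 hx hy hxy)

omit hq he [IsArtinianRing B] in
theorem isLITPresented_restrict_reduce {n : ℕ} {V : FGModuleCat.{u} A} {V' : FGModuleCat.{u} R}
    {D' : Set (FGModuleCat.{u} R)} (hA : IsLITWith n V DA Set.univ)
    (hV : IsSummand ((restrict p).obj V) V') (hD : ∀ X ∈ DA, (restrict p).obj X ∈ D')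
    (M : FGModuleCat.{u} R) :
    IsLITPresented V' D' ((restrict p).obj ((reduce p).obj (syzygy^[n] M))) := by
  obtain ⟨d⟩ := (reduce_preservesCover p).nonempty_iterate_syzygy_equiv hp.reduce_isExact n M
  have h : IsLITPresented V DA (syzygy^[n] ((reduce p).obj M)) := hA.2 _ trivial
  exact (h.congr d).map (restrict_isExact p) hV hD

theorem IsLITWith.of_factors {n : ℕ} {VA : FGModuleCat.{u} A} {VB : FGModuleCat.{u} B}
    (hA : IsLITWith n VA DA Set.univ) (hB : IsLITWith n VB DB Set.univ) :
    IsLITWith n (FGModuleCat.of R ((restrict p).obj VA × (restrict q).obj VB))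
      (factorClass p q DA DB) Set.univ := by
  have hD := factorClass_isZeroIT hp hq he hA.1 hB.1
  refine ⟨hD, fun M _ => ?_⟩
  have hDA : ∀ X ∈ DA, (restrict p).obj X ∈ factorClass p q DA DB := fun X hX => by
    obtain ⟨d⟩ := nonempty_reduce_restrict_equiv p X
    have := hp.subsingleton_reduce_restrict hq he X
    exact ⟨hA.1.congr d.symm hX, hB.1.of_subsingleton _⟩
  have hDB : ∀ X ∈ DB, (restrict q).obj X ∈ factorClass p q DA DB := fun X hX => by
    obtain ⟨d⟩ := nonempty_reduce_restrict_equiv q X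
    have := hq.subsingleton_reduce_restrict hp ((add_comm _ _).trans he) X
    exact ⟨hA.1.of_subsingleton _, hB.1.congr d.symm hX⟩
  have hMA := isLITPresented_restrict_reduce hp hA (IsSummand.fst _ ((restrict q).obj VB)) hDA M
  have hMB := isLITPresented_restrict_reduce hq hB (IsSummand.snd ((restrict p).obj VA) _) hDB M
  obtain ⟨d⟩ := hp.nonempty_equiv_prod hq he (syzygy^[n] M)
  exact (hMA.prod (fun _ _ => hD.prod) hMB).congr d.symm

end ComplementaryFactors

section Prod

variable (A B : Type u) [Ring A] [Ring B]

instance : RingHomSurjective (RingHom.fst A B) := ⟨Prod.fst_surjective⟩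

instance : RingHomSurjective (RingHom.snd A B) := ⟨Prod.snd_surjective⟩

theorem isDirectFactor_fst : IsDirectFactor (RingHom.fst A B) (1, 0) where
  map_eq_one := rfl
  commute r := Prod.ext (by simp) (by simp)
  mul_eq_zero r hr := Prod.ext (by simpa using hr) (by simp)

theorem isDirectFactor_snd : IsDirectFactor (RingHom.snd A B) (0, 1) where
  map_eq_one := rfl
  commute r := Prod.ext (by simp) (by simp)
  mul_eq_zero r hr := Prod.ext (by simp) (by simpa using hr)

end Prod

/-! ### Induction along a split square-zero extension -/

section Twist

variable {k R : Type u} [Field k] [Ring R] [Algebra k R]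

/-- `R` as an `R`-bimodule on which `R` acts on the right by multiplication and on the left through
the character `χ`. -/
def Twist (_χ : R →ₐ[k] k) : Type u := R

variable (χ : R →ₐ[k] k)

instance : AddCommGroup (Twist χ) := inferInstanceAs (AddCommGroup R)

instance : Module k (Twist χ) := inferInstanceAs (Module k R)

instance : Module R (Twist χ) := Module.compHom (Twist χ) χ.toRingHom

instance : Module Rᵐᵒᵖ (Twist χ) := inferInstanceAs (Module Rᵐᵒᵖ R)

instance : SMulCommClass R Rᵐᵒᵖ (Twist χ) where
  smul_comm r s x := (smul_mul_assoc (χ r) (show R from x) s.unop).symm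

instance : IsScalarTower k R (Twist χ) where
  smul_assoc a r x := by
    change χ (a • r) • x = a • χ r • x
    rw [map_smul, smul_assoc]

instance : IsScalarTower k Rᵐᵒᵖ (Twist χ) where
  smul_assoc a r x := mul_smul_comm a (show R from x) r.unop

/-- The `i`-th component of the ideal part of an element of a trivial square-zero extension. -/
def coeff {I : Type u} {χ : I → R →ₐ[k] k} (i : I) :
    TrivSqZeroExt R (∀ i, Twist (χ i)) →+ R where
  toFun z := z.snd i
  map_zero' := rfl
  map_add' _ _ := rfl

end Twist

/-- The structure of a split square-zero extension on `C`: it is the sum of a subring `R` and of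
the right modules `ε i R ≅ f i R`, which form an ideal of square zero; the `f i` are necessarily
idempotent. The left action of `R` on `ε i R` factors through a character `χ i`. The
embedding `toExt` records the two components of an element of `C`. -/
structure SquareZeroExtension (k R C I : Type u) [Field k] [Ring R] [Algebra k R] [Ring C]
    [Fintype I] [DecidableEq I] where
  ι : R →+* C
  ε : I → C
  f : I → R
  χ : I → R →ₐ[k] k
  toExt : C →+* TrivSqZeroExt R (∀ i, Twist (χ i))
  toExt_ι : ∀ r, toExt (ι r) = TrivSqZeroExt.inl r
  toExt_ε : ∀ i, toExt (ε i) = TrivSqZeroExt.inr (Pi.single i (f i))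
  eq_add_sum : ∀ c, c = ι (toExt c).fst + ∑ i, ε i * ι (coeff i (toExt c))

namespace SquareZeroExtension

variable {k R C I : Type u} [Field k] [Ring R] [Algebra k R] [Ring C] [Fintype I] [DecidableEq I]
  (D : SquareZeroExtension k R C I)

/-- The projection of `C` to `R`. -/
def π : C →+* R := (TrivSqZeroExt.fstHom ℕ R (∀ i, Twist (D.χ i))).toRingHom.comp D.toExt

/-- The `i`-th coefficient of the component of an element of `C` in the ideal. -/
def ρ (i : I) : C →+ R := (coeff i).comp D.toExt.toAddMonoidHom

/-- The character of `C` induced by `χ i`. -/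
def character (i : I) : C →+* k := (D.χ i).toRingHom.comp D.π

theorem π_ι (r : R) : D.π (D.ι r) = r := congrArg TrivSqZeroExt.fst (D.toExt_ι r)

theorem π_ε (i : I) : D.π (D.ε i) = 0 := congrArg TrivSqZeroExt.fst (D.toExt_ε i)

theorem ρ_ι (i : I) (r : R) : D.ρ i (D.ι r) = 0 :=
  congrArg (coeff i) (D.toExt_ι r)

theorem ρ_ε_self (i : I) : D.ρ i (D.ε i) = D.f i :=
  (congrArg (coeff i) (D.toExt_ε i)).trans
    (Pi.single_eq_same (M := fun i => Twist (D.χ i)) i (D.f i))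

theorem ρ_ε_of_ne {i j : I} (h : j ≠ i) : D.ρ j (D.ε i) = 0 :=
  (congrArg (coeff j) (D.toExt_ε i)).trans
    (Pi.single_eq_of_ne (M := fun i => Twist (D.χ i)) h (D.f i))

theorem ρ_mul (i : I) (c d : C) :
    D.ρ i (c * d) = D.character i c • D.ρ i d + D.ρ i c * D.π d :=
  congrArg (coeff i) (map_mul D.toExt c d)

theorem ρ_one (i : I) : D.ρ i 1 = 0 :=
  congrArg (coeff i) (map_one D.toExt)

theorem eq_ι_add_sum (c : C) : c = D.ι (D.π c) + ∑ i, D.ε i * D.ι (D.ρ i c) := D.eq_add_sum c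

theorem f_mul_ρ (i : I) (c : C) : D.f i * D.ρ i c = D.ρ i c := by
  have h (j : I) (r : R) : D.ρ i (D.ε j * D.ι r) = D.ρ i (D.ε j) * r := by
    rw [ρ_mul, ρ_ι, smul_zero, zero_add, π_ι]
  conv_rhs => rw [D.eq_ι_add_sum c, map_add, ρ_ι, zero_add, map_sum]
  rw [Fintype.sum_eq_single i fun j hj => by rw [h, D.ρ_ε_of_ne hj.symm, zero_mul], h, ρ_ε_self]

theorem ext {c d : C} (hπ : D.π c = D.π d) (hρ : ∀ i, D.ρ i c = D.ρ i d) : c = d := by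
  rw [D.eq_ι_add_sum c, D.eq_ι_add_sum d, hπ]
  simp only [hρ]

theorem mul_eq_zero {c d : C} (hc : D.π c = 0) (hd : D.π d = 0) : c * d = 0 := by
  refine D.ext (by rw [map_mul, hc, zero_mul, map_zero]) fun i => ?_
  rw [ρ_mul, hd, mul_zero, add_zero, character, RingHom.comp_apply, hc, map_zero, zero_smul,
    ← map_zero D.ι, ρ_ι]

theorem mul_ε (c : C) (i : I) : c * D.ε i = D.ε i * D.ι (algebraMap k R (D.character i c)) := by
  refine D.ext (by rw [map_mul, map_mul, π_ε, mul_zero, zero_mul]) fun j => ?_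
  rw [ρ_mul, ρ_mul, π_ε, mul_zero, add_zero, ρ_ι, smul_zero, zero_add, π_ι]
  obtain rfl | h := eq_or_ne j i
  · rw [ρ_ε_self, Algebra.smul_def, Algebra.commutes]
  · rw [D.ρ_ε_of_ne h, smul_zero, zero_mul]

instance : RingHomSurjective D.π := ⟨fun r => ⟨D.ι r, D.π_ι r⟩⟩

instance (i : I) : RingHomSurjective (D.character i) :=
  ⟨fun a => ⟨D.ι (algebraMap k R a), by
    rw [character, RingHom.comp_apply, π_ι]
    exact (D.χ i).commutes a⟩⟩

instance : RingHomCompTriple D.ι D.π (RingHom.id R) := ⟨RingHom.ext D.π_ι⟩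

end SquareZeroExtension

theorem isSemisimpleModule_restrict {R S X : Type u} [Ring R] [Ring S] (σ : R →+* S)
    [RingHomSurjective σ] [AddCommGroup X] [Module S X] [IsSemisimpleModule S X] :
    IsSemisimpleModule R (Restrict σ X) :=
  ((ofRestrict σ X).isSemisimpleModule_iff_of_bijective Function.bijective_id).mpr inferInstance

namespace SquareZeroExtension

variable {k R C I : Type u} [Field k] [Ring R] [Algebra k R] [Ring C] [Fintype I] [DecidableEq I]
  (D : SquareZeroExtension k R C I)

section Ind

variable (X : Type u) [AddCommGroup X] [Module R X]

/-- The underlying group of the induced module `C ⊗ X = X ⊕ ⨁ i, ε i ⊗ f i X`, where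
`ε i ⊗ f i X` is represented by the elements of `X` fixed by `f i`. -/
def indGroup : AddSubgroup (X × (I → X)) where
  carrier := {z | ∀ i, D.f i • z.2 i = z.2 i}
  add_mem' ha hb i := (smul_add _ _ _).trans (congrArg₂ _ (ha i) (hb i))
  zero_mem' _ := smul_zero _
  neg_mem' ha i := (smul_neg _ _).trans (congrArg _ (ha i))

/-- The induced module `C ⊗ X`. -/
abbrev Ind : Type u := D.indGroup X

instance : SMul C (D.Ind X) where
  smul c z := ⟨(D.π c • z.1.1,
    fun i => algebraMap k R (D.character i c) • z.1.2 i + D.ρ i c • z.1.1), fun i => by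
      simp only [smul_add, smul_smul, ← Algebra.commutes, f_mul_ρ]
      rw [mul_smul, z.2 i]⟩

variable {X}

theorem ind_smul_fst (c : C) (z : D.Ind X) : (c • z).1.1 = D.π c • z.1.1 := rfl

theorem ind_smul_snd (c : C) (z : D.Ind X) (i : I) : (c • z).1.2 i =
    algebraMap k R (D.character i c) • z.1.2 i + D.ρ i c • z.1.1 := rfl

theorem ind_ext {z w : D.Ind X} (h₁ : z.1.1 = w.1.1) (h₂ : ∀ i, z.1.2 i = w.1.2 i) : z = w :=
  Subtype.ext (Prod.ext h₁ (funext h₂))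

variable (X) in
instance : Module C (D.Ind X) := Module.ofMinimalAxioms
  (fun c z w => D.ind_ext (smul_add _ _ _) fun i => by
    simp only [ind_smul_snd, AddSubgroup.coe_add, Prod.fst_add, Prod.snd_add, Pi.add_apply,
      smul_add]
    abel)
  (fun c d z => D.ind_ext
    (by simp only [ind_smul_fst, AddSubgroup.coe_add, Prod.fst_add, map_add, add_smul])
    fun i => by
      simp only [ind_smul_snd, AddSubgroup.coe_add, Prod.snd_add, Pi.add_apply, map_add, add_smul]
      abel)
  (fun c d z => D.ind_ext (by simp only [ind_smul_fst, map_mul, mul_smul]) fun i => by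
    simp only [ind_smul_fst, ind_smul_snd, map_mul, ρ_mul, Algebra.smul_def, add_smul, mul_smul,
      smul_add, add_assoc])
  (fun z => D.ind_ext (by simp only [ind_smul_fst, map_one, one_smul]) fun i => by
    simp only [ind_smul_snd, map_one, one_smul, ρ_one, zero_smul, add_zero])

variable (X) in
/-- The projection `C ⊗ X → X`. -/
def proj : D.Ind X →ₛₗ[D.π] X where
  toFun z := z.1.1
  map_add' _ _ := rfl
  map_smul' _ _ := rfl

/-- The `i`-th coordinate of an element of the induced module. -/
def coord (i : I) : D.Ind X →+ X where
  toFun z := z.1.2 i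
  map_zero' := rfl
  map_add' _ _ := rfl

variable (X) in
/-- The unit `X → C ⊗ X`. -/
def unit : X →ₛₗ[D.ι] D.Ind X where
  toFun x := ⟨(x, 0), fun _ => smul_zero _⟩
  map_add' x y := D.ind_ext rfl fun _ => (add_zero _).symm
  map_smul' r x := D.ind_ext (by rw [ind_smul_fst, π_ι]) fun i => by
    rw [ind_smul_snd, ρ_ι, zero_smul, add_zero]
    exact (smul_zero _).symm

theorem proj_unit (x : X) : D.proj X (D.unit X x) = x := rfl

theorem coord_unit (i : I) (x : X) : D.coord i (D.unit X x) = 0 := rfl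

theorem f_smul_coord (i : I) (z : D.Ind X) : D.f i • D.coord i z = D.coord i z := z.2 i

theorem coord_smul (i : I) (c : C) (z : D.Ind X) : D.coord i (c • z) =
    algebraMap k R (D.character i c) • D.coord i z + D.ρ i c • D.proj X z := rfl

theorem proj_sum_ε_smul (z : I → D.Ind X) : D.proj X (∑ i, D.ε i • z i) = 0 := by
  rw [map_sum]
  exact Finset.sum_eq_zero fun i _ => by rw [map_smulₛₗ, π_ε, zero_smul]

theorem coord_sum_ε_smul (z : I → D.Ind X) (i : I) :
    D.coord i (∑ j, D.ε j • z j) = D.f i • D.proj X (z i) := by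
  have hcoord (j : I) : D.coord i (D.ε j • z j) = D.ρ i (D.ε j) • D.proj X (z j) := by
    rw [coord_smul, character, RingHom.comp_apply, π_ε, map_zero, map_zero, zero_smul, zero_add]
  simp only [map_sum, hcoord]
  rw [Finset.sum_eq_single i (fun j _ hj => by rw [D.ρ_ε_of_ne hj.symm, zero_smul])
    fun hi => (hi (Finset.mem_univ i)).elim, ρ_ε_self]

theorem eq_unit_add_sum (z : D.Ind X) :
    z = D.unit X (D.proj X z) + ∑ i, D.ε i • D.unit X (D.coord i z) := by
  refine D.ind_ext ?_ fun i => ?_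
  · change D.proj X z = D.proj X (_ + _)
    rw [map_add, proj_sum_ε_smul, add_zero, proj_unit]
  · change D.coord i z = D.coord i (_ + _)
    rw [map_add, coord_sum_ε_smul, coord_unit, zero_add, proj_unit, f_smul_coord]

variable {N : Type u} [AddCommGroup N] [Module C N]

/-- The linear map from the induced module with given restriction to `X`. -/
def lift (g : X →ₛₗ[D.ι] N) : D.Ind X →ₗ[C] N where
  toFun z := g (D.proj X z) + ∑ i, D.ε i • g (D.coord i z)
  map_add' z w := by
    simp only [map_add, smul_add, Finset.sum_add_distrib]
    abel
  map_smul' c z := by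
    have hc : g (D.π c • D.proj X z) + ∑ i, D.ε i • g (D.ρ i c • D.proj X z) =
        c • g (D.proj X z) := by
      conv_rhs => rw [D.eq_ι_add_sum c, add_smul, Finset.sum_smul]
      simp only [map_smulₛₗ, smul_smul]
    simp only [map_smulₛₗ _ c z, coord_smul, map_add, smul_add, Finset.sum_add_distrib,
      RingHom.id_apply, ← hc, Finset.smul_sum, smul_smul, D.mul_ε c]
    simp only [mul_smul, map_smulₛₗ]
    abel

theorem lift_apply (g : X →ₛₗ[D.ι] N) (z : D.Ind X) :
    D.lift g z = g (D.proj X z) + ∑ i, D.ε i • g (D.coord i z) := rfl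

theorem lift_unit (g : X →ₛₗ[D.ι] N) (x : X) : D.lift g (D.unit X x) = g x := by
  simp only [lift_apply, proj_unit, coord_unit, map_zero, smul_zero, Finset.sum_const_zero,
    add_zero]

variable (X) in
theorem isScalarExtension_unit : IsScalarExtension (D.unit X) := by
  refine fun L _ _ g => ⟨D.lift g, LinearMap.ext (D.lift_unit g), fun h hh => ?_⟩
  refine LinearMap.ext fun z => ?_
  have hunit (x : X) : h (D.unit X x) = g x := LinearMap.congr_fun hh x
  rw [D.eq_unit_add_sum z]
  simp only [map_add, map_sum, map_smul, hunit, lift_unit]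

end Ind

/-- Induction of modules from `R` to `C`. -/
def ind : ScalarExtension D.ι where
  obj X :=
    have := (D.isScalarExtension_unit X).finite
    FGModuleCat.of C (D.Ind X)
  unit X := D.unit X
  isScalarExtension X := D.isScalarExtension_unit X

section Functor

variable {X Y : FGModuleCat.{u} R} (g : X →ₗ[R] Y) (z : D.Ind X)

theorem ind_map_eq : D.ind.map g z =
    D.unit Y (g (D.proj X z)) + ∑ i, D.ε i • D.unit Y (g (D.coord i z)) := by
  have hunit (x : X) : D.ind.map g (D.unit X x) = D.unit Y (g x) := D.ind.map_unit g x
  conv_lhs => rw [D.eq_unit_add_sum z]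
  refine (map_add (D.ind.map g) _ _).trans (congrArg₂ _ (hunit _) ?_)
  refine (map_sum (D.ind.map g) _ _).trans (Finset.sum_congr rfl fun i _ => ?_)
  exact (map_smul (D.ind.map g) _ _).trans (congrArg _ (hunit _))

theorem proj_ind_map : D.proj Y (D.ind.map g z) = g (D.proj X z) := by
  rw [ind_map_eq, map_add, proj_sum_ε_smul, add_zero, proj_unit]

theorem coord_ind_map (i : I) : D.coord i (D.ind.map g z) = g (D.coord i z) := by
  rw [ind_map_eq, map_add, coord_sum_ε_smul, coord_unit, zero_add, proj_unit, ← map_smul,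
    f_smul_coord]

theorem ind_isExact : D.ind.functor.IsExact := by
  refine fun X Y Z g h hgh (z : D.Ind Y) => ⟨fun (hz : D.ind.map h z = 0) => ?_, ?_⟩
  · have hproj : h (D.proj Y z) = 0 := (D.proj_ind_map h z).symm.trans (congrArg (D.proj Z) hz)
    have hcoord (i : I) : h (D.coord i z) = 0 :=
      (D.coord_ind_map h z i).symm.trans (congrArg (D.coord i) hz)
    obtain ⟨x, hx⟩ := (hgh _).mp hproj
    choose y hy using fun i => (hgh _).mp (hcoord i)
    refine ⟨D.unit X x + ∑ i, D.ε i • D.unit X (y i), D.ind_ext ?_ fun i => ?_⟩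
    · refine (D.proj_ind_map g _).trans ?_
      rw [map_add, proj_sum_ε_smul, add_zero, proj_unit, hx]
      rfl
    · refine (D.coord_ind_map g _ i).trans ?_
      rw [map_add, coord_sum_ε_smul, coord_unit, zero_add, proj_unit, map_smul, hy, f_smul_coord]
      rfl
  · rintro ⟨w, rfl⟩
    refine D.ind_ext ?_ fun i => ?_
    · exact (D.proj_ind_map h _).trans ((congrArg h (D.proj_ind_map g w)).trans
        (hgh.apply_apply_eq_zero _))
    · exact (D.coord_ind_map h _ i).trans ((congrArg h (D.coord_ind_map g w i)).trans
        (hgh.apply_apply_eq_zero _))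

end Functor

theorem ker_π_smul_ker_π : RingHom.ker D.π • RingHom.ker D.π = ⊥ :=
  le_bot_iff.mp (Submodule.smul_le.mpr fun _ hc _ hd => D.mul_eq_zero hc hd)

theorem isSuperfluous_ker_π_smul_top {N : Type u} [AddCommGroup N] [Module C N] :
    IsSuperfluous (RingHom.ker D.π • ⊤ : Submodule C N) :=
  isSuperfluous_smul_top D.ker_π_smul_ker_π

theorem sum_ε_smul_mem {N : Type u} [AddCommGroup N] [Module C N] (y : I → N) :
    ∑ i, D.ε i • y i ∈ (RingHom.ker D.π • ⊤ : Submodule C N) :=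
  sum_mem fun i _ => Submodule.smul_mem_smul (D.π_ε i) trivial

theorem isSuperfluous_ker_proj {X : Type u} [AddCommGroup X] [Module R X] :
    IsSuperfluous (LinearMap.ker (D.proj X)) := by
  refine D.isSuperfluous_ker_π_smul_top.mono fun z (hz : D.proj X z = 0) => ?_
  rw [D.eq_unit_add_sum z, hz, map_zero, zero_add]
  exact D.sum_ε_smul_mem _

theorem ind_preservesCover : D.ind.functor.PreservesCover := by
  refine D.ind.preservesCover fun P M f hf => ?_
  have hcomap : IsSuperfluous ((LinearMap.ker f).comap (D.proj P)) :=
    hf.isSuperfluous_ker.comap D.isSuperfluous_ker_proj fun x => ⟨D.unit P x, rfl⟩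
  refine hcomap.mono fun z (hz : D.ind.map f z = 0) => ?_
  exact (D.proj_ind_map f z).symm.trans (congrArg (D.proj M) hz)

end SquareZeroExtension

/-! ### Submodules of induced modules -/

theorem nonempty_equiv_prod_quotient_range {C K N : Type u} [Ring C] [AddCommGroup K] [Module C K]
    [AddCommGroup N] [Module C N] {f : K →ₗ[C] N} (hf : Function.Injective f) {L : Submodule C N}
    [IsSemisimpleModule C L] (h : LinearMap.range f ⊔ L = ⊤) :
    IsSemisimpleModule C (N ⧸ LinearMap.range f) ∧
      Nonempty (N ≃ₗ[C] (K × (N ⧸ LinearMap.range f))) := by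
  let q : L →ₗ[C] N ⧸ LinearMap.range f := (LinearMap.range f).mkQ.comp L.subtype
  have hq : Function.Surjective q := fun y => by
    obtain ⟨n, rfl⟩ := Submodule.mkQ_surjective _ y
    obtain ⟨a, ha, l, hl, rfl⟩ := Submodule.mem_sup.mp (h ▸ Submodule.mem_top (x := n))
    refine ⟨⟨l, hl⟩, (Submodule.Quotient.eq _).mpr ?_⟩
    simpa using ha
  obtain ⟨s, hs⟩ := IsSemisimpleModule.lifting_property q hq LinearMap.id
  have hexact : Function.Exact f (LinearMap.range f).mkQ := LinearMap.exact_map_mkQ_range f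
  exact ⟨IsSemisimpleModule.of_surjective q hq,
    ⟨(hexact.splitSurjectiveEquiv hf ⟨L.subtype.comp s, hs⟩).1⟩⟩

namespace SquareZeroExtension

variable {k R C I : Type u} [Field k] [Ring R] [Algebra k R] [Ring C] [Fintype I] [DecidableEq I]
  (D : SquareZeroExtension k R C I)

section Submodule

variable {X Y N : Type u} [AddCommGroup X] [Module R X] [AddCommGroup Y] [Module R Y]
  [AddCommGroup N] [Module C N]

theorem lift_injective {g : X →ₛₗ[D.ι] N} {j : N →ₗ[C] D.Ind Y}
    (h : Function.Injective fun x => D.proj Y (j (g x))) : Function.Injective (D.lift g) := by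
  refine (injective_iff_map_eq_zero _).mpr fun z hz => ?_
  have hj : j (g (D.proj X z)) + ∑ i, D.ε i • j (g (D.coord i z)) = 0 := by
    simpa only [lift_apply, map_add, map_sum, map_smul, map_zero] using congrArg j hz
  have hzero (x : X) (hx : D.proj Y (j (g x)) = 0) : x = 0 := h (by simp only [hx, map_zero])
  have hproj : D.proj X z = 0 := hzero _ <| by
    simpa only [map_add, proj_sum_ε_smul, add_zero, map_zero] using congrArg (D.proj Y) hj
  refine D.ind_ext hproj fun i => hzero _ ?_
  calc D.proj Y (j (g (D.coord i z))) = D.proj Y (j (g (D.f i • D.coord i z))) := by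
        rw [f_smul_coord]
    _ = D.f i • D.proj Y (j (g (D.coord i z))) := by
        rw [map_smulₛₗ, map_smul, map_smulₛₗ, π_ι]
    _ = 0 := by
        simpa only [hproj, map_zero, zero_add, coord_sum_ε_smul] using congrArg (D.coord i) hj

theorem lift_surjective {s : Reduce D.π N →ₛₗ[D.ι] N} (hs : ∀ y, toReduce D.π N (s y) = y) :
    Function.Surjective (D.lift s) := by
  refine LinearMap.range_eq_top.mp
    (D.isSuperfluous_ker_π_smul_top _ (eq_top_iff.mpr fun n _ => ?_))
  have hn : n - s (toReduce D.π N n) ∈ LinearMap.ker (toReduce D.π N) := by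
    rw [LinearMap.mem_ker, map_sub, hs, sub_self]
  rw [ker_toReduce] at hn
  refine Submodule.mem_sup.mpr ⟨_, ⟨D.unit _ (toReduce D.π N n), rfl⟩, _, hn, ?_⟩
  rw [lift_unit, add_sub_cancel]

variable (N) in
theorem exists_injective_ind [Module.Projective C N] :
    ∃ j : N →ₗ[C] D.Ind (Reduce D.π N), Function.Injective j := by
  have := (isScalarExtension_toReduce D.π N).projective
  obtain ⟨s, hs⟩ := Module.projective_lifting_property
    ((toReduce D.π N).comp (ofRestrict D.ι N) : Restrict D.ι N →ₗ[R] Reduce D.π N) LinearMap.id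
    (toReduce_surjective D.π N)
  obtain ⟨j, hj⟩ := Module.projective_lifting_property (D.lift ((ofRestrict D.ι N).comp s))
    LinearMap.id (D.lift_surjective (LinearMap.congr_fun hs))
  exact ⟨j, Function.LeftInverse.injective (g := D.lift _) (LinearMap.congr_fun hj)⟩

theorem toReduce_map_unit_proj (p : D.Ind X →ₗ[C] N) (z : D.Ind X) :
    toReduce D.π N (p (D.unit X (D.proj X z))) = toReduce D.π N (p z) := by
  have hz : toReduce D.π N (∑ i, D.ε i • p (D.unit X (D.coord i z))) = 0 :=
    (ker_toReduce D.π N).ge (D.sum_ε_smul_mem _)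
  conv_rhs => rw [D.eq_unit_add_sum z]
  simp only [map_add, map_sum, map_smul] at hz ⊢
  rw [hz, add_zero]

theorem nonempty_ind_reduce_equiv {i : N →ₗ[C] D.Ind X} {p : D.Ind X →ₗ[C] N}
    (hpi : ∀ n, p (i n) = n) : Nonempty (D.Ind (Reduce D.π N) ≃ₗ[C] N) := by
  obtain ⟨h, hh, -⟩ := isScalarExtension_toReduce D.π N ((D.proj X).comp i)
  let s : Reduce D.π N →ₛₗ[D.ι] N := p.comp ((D.unit X).comp h)
  have hs (y : Reduce D.π N) : toReduce D.π N (s y) = y := by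
    obtain ⟨n, rfl⟩ := toReduce_surjective D.π N y
    have hn : h (toReduce D.π N n) = D.proj X (i n) := LinearMap.congr_fun hh n
    change toReduce D.π N (p (D.unit X (h (toReduce D.π N n)))) = _
    rw [hn, toReduce_map_unit_proj, hpi]
  have hinj : Function.Injective h :=
    Function.Injective.of_comp (f := fun x => p (D.unit X x)) (Function.LeftInverse.injective hs)
  have hproj : (fun y => D.proj X (i (s y))) = h := funext fun y =>
    (LinearMap.congr_fun hh (s y)).symm.trans (congrArg h (hs y))
  exact ⟨LinearEquiv.ofBijective (D.lift s)
    ⟨D.lift_injective (hproj ▸ hinj), D.lift_surjective hs⟩⟩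

end Submodule

section Split

variable {Y N : Type u} [AddCommGroup Y] [Module R Y] [AddCommGroup N] [Module C N]

variable (Y) in
/-- The target of the coordinates of the induced module `C ⊗ Y`, on which `C` acts through the
characters. -/
abbrev CoordSpace : Type u := ∀ i, Restrict (D.character i) (Restrict (algebraMap k R) Y)

variable (Y) in
/-- The coordinates of an element of the induced module. They are linear over `C` only on the kernel
of the projection to `Y`. -/
def coords : Restrict D.ι (D.Ind Y) →ₗ[R] Restrict D.ι (D.CoordSpace Y) where
  toFun z i := D.coord (X := Y) i z
  map_add' z w := funext fun i => map_add (D.coord (X := Y) i) z w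
  map_smul' r z := funext fun i => (D.coord_smul (X := Y) i (D.ι r) z).trans <| by
    rw [ρ_ι, zero_smul, add_zero]
    rfl

theorem isSemisimpleModule_coordSpace : IsSemisimpleModule C (D.CoordSpace Y) := by
  have (i : I) : IsSemisimpleModule C
      (Restrict (D.character i) (Restrict (algebraMap k R) Y)) :=
    isSemisimpleModule_restrict _
  infer_instance

theorem exists_retraction_ker_proj {j : N →ₗ[C] D.Ind Y} (hj : Function.Injective j) :
    IsSemisimpleModule C (LinearMap.ker ((D.proj Y).comp j)) ∧
      ∃ t : Restrict D.ι N →ₗ[R] Restrict D.ι (LinearMap.ker ((D.proj Y).comp j)),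
        ∀ l : LinearMap.ker ((D.proj Y).comp j), t l.1 = l := by
  have := D.isSemisimpleModule_coordSpace (Y := Y)
  have hproj (l : LinearMap.ker ((D.proj Y).comp j)) : D.proj Y (j l) = 0 := l.2
  let κ : LinearMap.ker ((D.proj Y).comp j) →ₗ[C] D.CoordSpace Y :=
    { toFun := fun l i => D.coord (X := Y) i (j l)
      map_add' := fun l l' => funext fun i =>
        (congrArg (D.coord (X := Y) i) (map_add j l.1 l'.1)).trans (map_add _ _ _)
      map_smul' := fun c l => funext fun i => by
        refine (congrArg (D.coord (X := Y) i) (map_smul j c l.1)).trans ?_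
        rw [coord_smul, hproj l, smul_zero, add_zero]
        rfl }
  have hκ : Function.Injective κ := fun l l' h => Subtype.ext (hj
    (D.ind_ext ((hproj l).trans (hproj l').symm) fun i => congrFun h i))
  obtain ⟨r, hr⟩ := IsSemisimpleModule.extension_property κ hκ LinearMap.id
  exact ⟨.of_injective κ hκ, (restrictMap D.ι r).comp ((D.coords Y).comp (restrictMap D.ι j)),
    LinearMap.congr_fun hr⟩

theorem exists_lift_range_sup_eq_top [IsNoetherianRing R] [Module.Finite R Y]
    {j : N →ₗ[C] D.Ind Y} (hj : Function.Injective j) :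
    ∃ (X : FGModuleCat.{u} R) (g : X →ₛₗ[D.ι] N), Function.Injective (D.lift g) ∧
      LinearMap.range (D.lift g) ⊔ LinearMap.ker ((D.proj Y).comp j) = ⊤ := by
  obtain ⟨-, t, ht⟩ := D.exists_retraction_ker_proj hj
  let g : LinearMap.ker t →ₛₗ[D.ι] N := (ofRestrict D.ι N).comp (LinearMap.ker t).subtype
  let h : LinearMap.ker t →ₗ[R] Y := ((D.proj Y).comp j).comp g
  have hh : Function.Injective h := (injective_iff_map_eq_zero h).mpr fun x hx =>
    Subtype.ext ((congrArg Subtype.val (ht ⟨g x, hx⟩)).symm.trans (congrArg Subtype.val x.2))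
  have := Module.Finite.of_injective h hh
  refine ⟨FGModuleCat.of R (LinearMap.ker t), g, D.lift_injective hh,
    eq_top_iff.mpr fun n _ => ?_⟩
  let l : LinearMap.ker ((D.proj Y).comp j) := t n
  let x : Restrict D.ι N := n - l.1
  have hx : x ∈ LinearMap.ker t := (map_sub t n l.1).trans (sub_eq_zero.mpr (ht l).symm)
  exact Submodule.mem_sup.mpr ⟨_, ⟨D.unit _ ⟨x, hx⟩, D.lift_unit g _⟩, _, l.2,
    sub_add_cancel n l.1⟩

end Split

theorem exists_syzygy_equiv_ind_prod [IsArtinianRing R] [IsArtinianRing C]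
    (M : FGModuleCat.{u} C) :
    ∃ (X : FGModuleCat.{u} R) (S : FGModuleCat.{u} C), IsSemisimpleModule C S ∧
      Nonempty (syzygy M ≃ₗ[C] (D.ind.obj X × S)) := by
  have := (projCoverMap_spec M).1
  obtain ⟨i, hi⟩ := D.exists_injective_ind (projCover M)
  let j : syzygy M →ₗ[C] D.Ind (Reduce D.π (projCover M)) :=
    i.comp (LinearMap.ker (projCoverMap M)).subtype
  have hj : Function.Injective j := hi.comp Subtype.val_injective
  have := (isScalarExtension_toReduce D.π (projCover M)).finite
  obtain ⟨X, g, hg, hsup⟩ := D.exists_lift_range_sup_eq_top hj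
  have := (D.exists_retraction_ker_proj hj).1
  obtain ⟨hS, e⟩ := nonempty_equiv_prod_quotient_range hg hsup
  exact ⟨X, FGModuleCat.of C (syzygy M ⧸ LinearMap.range (D.lift g)), hS, e⟩

end SquareZeroExtension

/-! ### Split extensions of Igusa-Todorov rings -/

section Semisimple

variable {C : Type u} [Ring C] [IsArtinianRing C]

/-- The quotient of a ring by its Jacobson radical, as a left module. -/
def semisimpleQuotient (C : Type u) [Ring C] : FGModuleCat.{u} C :=
  FGModuleCat.of C (C ⧸ Module.jacobson C C)

theorem isSummand_semisimpleQuotient (S : FGModuleCat.{u} C) [IsSimpleModule C S] :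
    IsSummand S (semisimpleQuotient C) := by
  have : IsSemisimpleModule C (C ⧸ Module.jacobson C C) :=
    (IsArtinian.isSemisimpleModule_iff_jacobson C _).mpr (Module.jacobson_quotient_jacobson C C)
  have : Nontrivial S := IsSimpleModule.nontrivial C S
  obtain ⟨x, hx⟩ := exists_ne (0 : S)
  let g : (C ⧸ Module.jacobson C C) →ₗ[C] S := (Module.jacobson C C).liftQ
    (LinearMap.toSpanSingleton C S x) (IsSemisimpleModule.jacobson_le_ker _ _ _ _ _)
  have hg : Function.Surjective g := fun y => by
    obtain ⟨c, rfl⟩ := IsSimpleModule.toSpanSingleton_surjective C hx y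
    exact ⟨Submodule.Quotient.mk c, rfl⟩
  obtain ⟨h, hh⟩ := IsSemisimpleModule.lifting_property g hg LinearMap.id
  let e := ((LinearMap.exact_subtype_ker_map g).splitSurjectiveEquiv Subtype.val_injective
    ⟨h, hh⟩).1
  exact ⟨FGModuleCat.of C (LinearMap.ker g), ⟨e.trans (LinearEquiv.prodComm C _ _)⟩⟩

theorem mem_addClosure_semisimpleQuotient (S : FGModuleCat.{u} C) [IsSemisimpleModule C S] :
    S ∈ addClosure {semisimpleQuotient C} := by
  obtain ⟨n, T, e, hT⟩ := IsSemisimpleModule.exists_linearEquiv_fin_dfinsupp C S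
  refine ⟨n, fun i => FGModuleCat.of C (T i), fun i => ⟨_, rfl, ?_⟩,
    ⟨e.trans (DFinsupp.linearEquivFunOnFintype (R := C))⟩⟩
  have : IsSimpleModule C (FGModuleCat.of C (T i)) := hT i
  exact isSummand_semisimpleQuotient _

end Semisimple

namespace SquareZeroExtension

variable {k R C I : Type u} [Field k] [Ring R] [Algebra k R] [Ring C] [Fintype I] [DecidableEq I]
  (D : SquareZeroExtension k R C I)

theorem exists_ind_equiv_of_isSummand {X : FGModuleCat.{u} R} {N : FGModuleCat.{u} C}
    (h : IsSummand N (D.ind.obj X)) :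
    ∃ X' : FGModuleCat.{u} R, IsSummand X' X ∧ Nonempty (D.ind.obj X' ≃ₗ[C] N) := by
  obtain ⟨d⟩ := D.ind.nonempty_obj_obj_equiv (reduce D.π) X
  have hsummand := (reduce D.π).functor.isAdditiveOp.isSummand h
  obtain ⟨Z, ⟨e⟩⟩ := h
  refine ⟨(reduce D.π).obj N,
    hsummand.trans (IsSummand.of_equiv (M := (reduce D.π).obj (D.ind.obj X)) d), ?_⟩
  exact D.nonempty_ind_reduce_equiv (X := X) (i := e.symm.toLinearMap.comp (LinearMap.inl C N Z))
    (p := (LinearMap.fst C N Z).comp e.toLinearMap)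
    fun n => congrArg Prod.fst (e.apply_symm_apply (n, 0))

/-- The modules induced from the modules in a given class. -/
def indClass (E : Set (FGModuleCat.{u} R)) : Set (FGModuleCat.{u} C) :=
  {M | ∃ X ∈ E, Nonempty (D.ind.obj X ≃ₗ[C] M)}

theorem mem_indClass_of_subsingleton {E : Set (FGModuleCat.{u} R)}
    (hE : ∀ X : FGModuleCat.{u} R, Subsingleton X → X ∈ E) (M : FGModuleCat.{u} C)
    [Subsingleton M] : M ∈ D.indClass E := by
  have := D.ind.functor.obj_subsingleton (FGModuleCat.of R PUnit)
  have : Subsingleton (D.ind.obj (FGModuleCat.of R PUnit)) := this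
  exact ⟨FGModuleCat.of R PUnit, hE _ inferInstance, ⟨0⟩⟩

theorem indClass_subsingleton : D.indClass {X : FGModuleCat.{u} R | Subsingleton X} =
    {M : FGModuleCat.{u} C | Subsingleton M} := by
  refine Set.ext fun M => ⟨?_, fun (hM : Subsingleton M) =>
    D.mem_indClass_of_subsingleton (fun _ h => h) M⟩
  rintro ⟨X, hX : Subsingleton X, ⟨e⟩⟩
  have : Subsingleton (D.ind.obj X) := D.ind.functor.obj_subsingleton X
  exact e.symm.toEquiv.subsingleton

theorem K0map_ind_injective :
    Function.Injective (K0map D.ind.functor.isAdditiveOp D.ind.preservesProjective) := by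
  let Φ := K0map D.ind.functor.isAdditiveOp D.ind.preservesProjective
  let Ψ := K0map (reduce D.π).functor.isAdditiveOp (reduce D.π).preservesProjective
  have hΨΦ : Ψ.comp Φ = AddMonoidHom.id _ := K0_hom_ext fun X => by
    obtain ⟨d⟩ := D.ind.nonempty_obj_obj_equiv (reduce D.π) X
    rw [AddMonoidHom.comp_apply, K0map_cls, K0map_cls]
    exact cls_congr d
  exact Function.LeftInverse.injective (DFunLike.congr_fun hΨΦ)

variable [IsArtinianRing R] [IsArtinianRing C]

theorem addSubgroupOf_ind_le (X : FGModuleCat.{u} R) : addSubgroupOf (D.ind.obj X) ≤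
    (addSubgroupOf X).map (K0map D.ind.functor.isAdditiveOp D.ind.preservesProjective) := by
  refine addSubgroupOf_le.mpr fun N hN => ?_
  obtain ⟨X', hX', ⟨e⟩⟩ := D.exists_ind_equiv_of_isSummand hN
  exact ⟨cls X', cls_mem_addSubgroupOf hX', (K0map_cls X').trans (cls_congr e)⟩

theorem injOn_iterate_omegaBar_ind {X : FGModuleCat.{u} R} {m : ℕ}
    (h : Set.InjOn (omegaBar R)^[m] (addSubgroupOf X : Set (K0 R))) :
    Set.InjOn (omegaBar C)^[m] (addSubgroupOf (D.ind.obj X) : Set (K0 C)) := by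
  intro x hx y hy hxy
  obtain ⟨a, ha, rfl⟩ := D.addSubgroupOf_ind_le X hx
  obtain ⟨b, hb, rfl⟩ := D.addSubgroupOf_ind_le X hy
  have hsemiconj := (D.ind_preservesCover.semiconj_K0map D.ind_isExact).iterate_right m
  have hab : (omegaBar R)^[m] a = (omegaBar R)^[m] b :=
    D.K0map_ind_injective ((hsemiconj a).trans (hxy.trans (hsemiconj b).symm))
  rw [h ha hb hab]

variable {E : Set (FGModuleCat.{u} R)}

theorem indClass_isZeroIT (hE : IsZeroIT E) : IsZeroIT (D.indClass E) where
  add_eq := by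
    refine eq_addClosure (fun M _ => D.mem_indClass_of_subsingleton
      (fun X _ => hE.of_subsingleton X) M) ?_ ?_
    · rintro N M hN ⟨X, hX, ⟨e⟩⟩
      obtain ⟨X', hX', e'⟩ := D.exists_ind_equiv_of_isSummand (hN.trans (IsSummand.of_equiv e.symm))
      exact ⟨X', hE.of_isSummand hX' hX, e'⟩
    · rintro M N ⟨X, hX, ⟨e⟩⟩ ⟨Y, hY, ⟨e'⟩⟩
      exact ⟨FGModuleCat.of R (X × Y), hE.prod hX hY,
        ⟨(D.ind.functor.prodEquiv X Y).trans (e.prodCongr e')⟩⟩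
  syzygy_mem := by
    rintro M ⟨X, hX, ⟨e⟩⟩
    obtain ⟨d⟩ := D.ind_preservesCover.nonempty_syzygy_equiv D.ind_isExact X
    obtain ⟨d'⟩ := syzygy_congr e
    exact ⟨syzygy X, hE.syzygy_mem X hX, ⟨d.symm.trans d'⟩⟩
  phiDim_eq := by
    refine (phiDim_eq_zero_iff _).mpr ?_
    rintro M ⟨X, hX, ⟨e⟩⟩ m
    refine (D.injOn_iterate_omegaBar_ind (hE.injOn hX m)).mono (addSubgroupOf_le.mpr fun N hN => ?_)
    exact cls_mem_addSubgroupOf (hN.trans (IsSummand.of_equiv e.symm))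

theorem isLITWith {n : ℕ} {V : FGModuleCat.{u} R} (hV : IsLITWith n V E Set.univ) :
    IsLITWith (n + 1)
      (FGModuleCat.of C (D.ind.obj V × (syzygy^[n] (semisimpleQuotient C) : FGModuleCat.{u} C)))
      (D.indClass E) Set.univ := by
  have hC := D.indClass_isZeroIT hV.1
  have hΩ := isAdditiveOp_iterate_syzygy (R := C) n
  let W : FGModuleCat.{u} C :=
    FGModuleCat.of C (D.ind.obj V × (syzygy^[n] (semisimpleQuotient C) : FGModuleCat.{u} C))
  refine ⟨hC, fun M _ => ?_⟩
  obtain ⟨X, S, hS, ⟨e⟩⟩ := D.exists_syzygy_equiv_ind_prod M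
  obtain ⟨e₁⟩ := hΩ.nonempty_equiv_prod e
  obtain ⟨e₂⟩ := D.ind_preservesCover.nonempty_iterate_syzygy_equiv D.ind_isExact n X
  have hX : IsLITPresented V E (syzygy^[n] X) := hV.2 X trivial
  have hind : IsLITPresented W (D.indClass E) (syzygy^[n] (D.ind.obj X)) :=
    (hX.map D.ind_isExact (IsSummand.fst _ (syzygy^[n] (semisimpleQuotient C)))
      (D' := D.indClass E) (fun Y hY => ⟨Y, hY, ⟨LinearEquiv.refl C _⟩⟩)).congr e₂.symm
  have hadd : ∀ Y ∈ ({semisimpleQuotient C} : Set (FGModuleCat.{u} C)),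
      ∃ Z ∈ ({W} : Set (FGModuleCat.{u} C)), IsSummand (syzygy^[n] Y) Z := by
    rintro _ rfl
    exact ⟨W, rfl, IsSummand.snd (D.ind.obj V) _⟩
  have hsemisimple : IsLITPresented W (D.indClass E) (syzygy^[n] S) :=
    .of_mem_addClosure (fun Z _ => hC.of_subsingleton Z)
      (hΩ.mem_addClosure hadd (mem_addClosure_semisimpleQuotient S))
  exact (hind.prod (fun _ _ => hC.prod) hsemisimple).congr e₁.symm

end SquareZeroExtension

end IgusaTodorov

/-! ### Homomorphisms from path algebras -/

namespace PathAlgebra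

variable {k : Type u} [Field k] {V W : Type u} [Quiver.{u} V] [Quiver.{u} W]

theorem ofPath_cons {a b c : V} (p : Quiver.Path a b) (e : b ⟶ c) :
    (ofPath (p.cons e) : PathAlgebra k V) = ofPath p * ofArrow e := by
  rw [ofArrow, ofPath_mul_ofPath]
  rfl

theorem linearMap_ext {M : Type*} [AddCommMonoid M] [Module k M] {f g : PathAlgebra k V →ₗ[k] M}
    (h : ∀ (a b : V) (p : Quiver.Path a b), f (ofPath p) = g (ofPath p)) : f = g :=
  Finsupp.lhom_ext' fun p => LinearMap.ext_ring (h p.1 p.2.1 p.2.2)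

theorem arrowIdealPow_anti {m n : ℕ} (h : m ≤ n) :
    arrowIdealPow k V n ≤ arrowIdealPow k V m :=
  TwoSidedIdeal.span_mono fun _ ⟨a, b, p, hp, hx⟩ => ⟨a, b, p, h.trans hp, hx⟩

theorem map_ofPath (F : V ⥤q W) {a b : V} (p : Quiver.Path a b) :
    map F (ofPath p : PathAlgebra k V) = ofPath (F.mapPath p) :=
  (Finsupp.linearCombination_single k (1 : k) (⟨a, b, p⟩ : QuiverPath V)).trans (one_smul _ _)

/-- Images in a ring of the trivial paths and of the arrows of a quiver which respect the relations
of the path algebra. There is no condition on the sum of the images of the trivial paths, so that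
the induced homomorphism need not preserve the identity. -/
structure PathFamily (V T : Type u) [Quiver.{u} V] [Ring T] where
  vertex : V → T
  arrow : ∀ {v w : V}, (v ⟶ w) → T
  orthogonal : OrthogonalIdempotents vertex
  vertex_mul_arrow : ∀ {v w : V} (e : v ⟶ w), vertex v * arrow e = arrow e
  arrow_mul_vertex : ∀ {v w : V} (e : v ⟶ w), arrow e * vertex w = arrow e

namespace PathFamily

section Path

variable {T : Type u} [Ring T] (d : PathFamily V T)

/-- The image of a path: the product of the images of its arrows. -/
def path {a : V} : ∀ {b : V}, Quiver.Path a b → T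
  | _, Quiver.Path.nil => d.vertex a
  | _, Quiver.Path.cons p e => path p * d.arrow e

theorem path_cons {a b c : V} (p : Quiver.Path a b) (e : b ⟶ c) :
    d.path (p.cons e) = d.path p * d.arrow e := rfl

theorem vertex_mul_path {a b : V} (p : Quiver.Path a b) : d.vertex a * d.path p = d.path p := by
  induction p with
  | nil => exact d.orthogonal.idem a
  | cons p e ih => rw [path_cons, ← mul_assoc, ih]

theorem path_mul_vertex {a b : V} (p : Quiver.Path a b) : d.path p * d.vertex b = d.path p := by
  cases p with
  | nil => exact d.orthogonal.idem a
  | cons p e => rw [path_cons, mul_assoc, d.arrow_mul_vertex]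

theorem path_comp {a b c : V} (p : Quiver.Path a b) (q : Quiver.Path b c) :
    d.path (p.comp q) = d.path p * d.path q := by
  induction q with
  | nil => exact (d.path_mul_vertex p).symm
  | cons q e ih => rw [Quiver.Path.comp_cons, path_cons, path_cons, ih, mul_assoc]

theorem path_mul_eq_zero {v w a : V} (p : Quiver.Path a w) {t : T} (ht : d.vertex v * t = t)
    (h : w ≠ v) : d.path p * t = 0 := by
  rw [← d.path_mul_vertex p, ← ht, mul_assoc, ← mul_assoc (d.vertex w), d.orthogonal.ortho h,
    zero_mul, mul_zero]

/-- The restriction of a family along a morphism of quivers. -/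
def comap (F : W ⥤q V) (hF : Function.Injective F.obj) : PathFamily W T where
  vertex w := d.vertex (F.obj w)
  arrow e := d.arrow (F.map e)
  orthogonal := d.orthogonal.embedding ⟨F.obj, hF⟩
  vertex_mul_arrow e := d.vertex_mul_arrow (F.map e)
  arrow_mul_vertex e := d.arrow_mul_vertex (F.map e)

theorem path_comap (F : W ⥤q V) (hF : Function.Injective F.obj) {a b : W}
    (p : Quiver.Path a b) : (d.comap F hF).path p = d.path (F.mapPath p) := by
  induction p with
  | nil => rfl
  | cons p e ih => rw [path_cons, ih, Prefunctor.mapPath_cons, path_cons]; rfl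

end Path

variable {T T' : Type u} [Ring T] [Algebra k T] [Ring T'] [Algebra k T'] (d : PathFamily V T)

/-- The linear extension of the images of paths. -/
def liftLinear : PathAlgebra k V →ₗ[k] T :=
  Finsupp.linearCombination k fun p : QuiverPath V => d.path p.2.2

theorem liftLinear_ofPath {a b : V} (p : Quiver.Path a b) :
    d.liftLinear (ofPath p : PathAlgebra k V) = d.path p :=
  (Finsupp.linearCombination_single k (1 : k) (⟨a, b, p⟩ : QuiverPath V)).trans (one_smul _ _)

theorem liftLinear_mul (x y : PathAlgebra k V) :
    d.liftLinear (x * y) = d.liftLinear x * d.liftLinear y := by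
  have h : mulLin.compr₂ d.liftLinear =
      (LinearMap.mul k T).compl₁₂ (d.liftLinear (k := k)) d.liftLinear := by
    refine linearMap_ext fun a b p => linearMap_ext fun c e q => ?_
    change d.liftLinear (ofPath p * ofPath q) = d.liftLinear (ofPath p) * d.liftLinear (ofPath q)
    rw [liftLinear_ofPath, liftLinear_ofPath]
    obtain rfl | hcb := eq_or_ne c b
    · rw [ofPath_mul_ofPath, liftLinear_ofPath, path_comp]
    · rw [ofPath_mul_ofPath_of_ne _ _ hcb, map_zero,
        d.path_mul_eq_zero p (d.vertex_mul_path q) hcb.symm]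
  exact LinearMap.congr_fun₂ h x y

/-- The homomorphism from the path algebra determined by the images of the trivial paths and of the
arrows. -/
def lift : PathAlgebra k V →ₙₐ[k] T :=
  { d.liftLinear with
    map_zero' := map_zero d.liftLinear
    map_mul' := d.liftLinear_mul }

theorem lift_ofPath {a b : V} (p : Quiver.Path a b) :
    d.lift (ofPath p : PathAlgebra k V) = d.path p :=
  d.liftLinear_ofPath p

theorem lift_vertex (v : V) :
    d.lift (ofPath (Quiver.Path.nil : Quiver.Path v v) : PathAlgebra k V) = d.vertex v :=
  d.lift_ofPath _

theorem lift_arrow {v w : V} (e : v ⟶ w) :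
    d.lift (ofArrow e : PathAlgebra k V) = d.arrow e :=
  (d.lift_ofPath e.toPath).trans (d.vertex_mul_arrow e)

theorem lift_comap (F : W ⥤q V) (hF : Function.Injective F.obj) (x : PathAlgebra k W) :
    (d.comap F hF).lift x = d.lift (PathAlgebra.map F x) := by
  have h : (d.comap F hF).liftLinear = d.liftLinear ∘ₗ PathAlgebra.map (k := k) F :=
    linearMap_ext fun a b p => by
      rw [LinearMap.comp_apply, map_ofPath, liftLinear_ofPath, liftLinear_ofPath, path_comap]
  exact LinearMap.congr_fun h x

/-- The image of a family under a homomorphism of algebras, which need not preserve the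
identity. -/
def map (φ : T →ₙₐ[k] T') : PathFamily V T' where
  vertex v := φ (d.vertex v)
  arrow e := φ (d.arrow e)
  orthogonal :=
    { idem := fun v => (map_mul φ _ _).symm.trans (congrArg φ (d.orthogonal.idem v))
      ortho := fun v w h =>
        (map_mul φ _ _).symm.trans ((congrArg φ (d.orthogonal.ortho h)).trans (map_zero φ)) }
  vertex_mul_arrow e := by rw [← map_mul, d.vertex_mul_arrow]
  arrow_mul_vertex e := by rw [← map_mul, d.arrow_mul_vertex]

end PathFamily

theorem hom_ext {T : Type u} [Ring T] [Algebra k T] {f g : PathAlgebra k V →ₙₐ[k] T}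
    (hv : ∀ v : V, f (ofPath (Quiver.Path.nil : Quiver.Path v v)) =
      g (ofPath (Quiver.Path.nil : Quiver.Path v v)))
    (he : ∀ (v w : V) (e : v ⟶ w), f (ofArrow e) = g (ofArrow e)) : f = g := by
  have h (a b : V) (p : Quiver.Path a b) : f (ofPath p) = g (ofPath p) := by
    induction p with
    | nil => exact hv a
    | cons p e ih => rw [ofPath_cons, map_mul, map_mul, ih, he]
  exact NonUnitalAlgHom.ext
    (LinearMap.congr_fun (linearMap_ext (f := (f : PathAlgebra k V →ₗ[k] T)) (g := g) h))

namespace PathFamily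

variable {T T' : Type u} [Ring T] [Algebra k T] [Ring T'] [Algebra k T'] (d : PathFamily V T)

theorem lift_map (φ : T →ₙₐ[k] T') (x : PathAlgebra k V) : (d.map φ).lift x = φ (d.lift x) :=
  DFunLike.congr_fun (f := (d.map φ).lift) (g := φ.comp d.lift)
    (hom_ext (fun v => by rw [lift_vertex, NonUnitalAlgHom.comp_apply, lift_vertex]; rfl)
      fun v w e => by rw [lift_arrow, NonUnitalAlgHom.comp_apply, lift_arrow]; rfl) x

theorem lift_eq_zero_of_mem_arrowIdealPow (h : ∀ {v w : V} (e : v ⟶ w), d.arrow e = 0)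
    {x : PathAlgebra k V} (hx : x ∈ arrowIdealPow k V 1) : d.lift x = 0 := by
  have hle : arrowIdealPow k V 1 ≤ TwoSidedIdeal.ker (d.lift (k := k)) := by
    rw [arrowIdealPow, TwoSidedIdeal.span_le]
    rintro _ ⟨a, b, p, hp, rfl⟩
    refine (TwoSidedIdeal.mem_ker _).mpr ?_
    cases p with
    | nil => exact absurd hp (Nat.not_succ_le_zero 0)
    | cons p e => rw [ofPath_cons, map_mul, lift_arrow, h, mul_zero]
  exact (TwoSidedIdeal.mem_ker _).mp (hle hx)

open Classical in
/-- The family defining the character of the path algebra attached to a vertex: it takes the value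
`1` at the trivial path of this vertex, and vanishes at all other paths. -/
def atVertex (k : Type u) [Field k] (v : V) : PathFamily V k where
  vertex := Pi.single v 1
  arrow _ := 0
  orthogonal := OrthogonalIdempotents.iff_mul_eq.mpr fun w w' => by
    simp only [Pi.single_apply]
    split_ifs <;> simp_all
  vertex_mul_arrow _ := mul_zero _
  arrow_mul_vertex _ := zero_mul _

theorem atVertex_vertex_self (v : V) : (atVertex k v).vertex v = 1 := by
  classical exact Pi.single_eq_same v 1

theorem atVertex_vertex_of_ne {v w : V} (h : w ≠ v) : (atVertex k v).vertex w = 0 := by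
  classical exact Pi.single_eq_of_ne h 1

theorem atVertex_path_cons (v : V) {a b c : V} (p : Quiver.Path a b) (e : b ⟶ c) :
    (atVertex k v).path (p.cons e) = 0 :=
  mul_zero _

theorem lift_mul_eq_smul {v : V} {t : T} (ht : d.vertex v * t = t)
    (h : ∀ {u : V} (e : u ⟶ v), d.arrow e * t = 0) (x : PathAlgebra k V) :
    d.lift x * t = (atVertex k v).lift x • t := by
  have hlin : LinearMap.mulRight k t ∘ₗ d.liftLinear =
      ((atVertex k v).liftLinear (k := k)).smulRight t := by
    refine linearMap_ext fun a b p => ?_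
    rw [LinearMap.comp_apply, LinearMap.smulRight_apply, liftLinear_ofPath, liftLinear_ofPath,
      LinearMap.mulRight_apply]
    obtain rfl | hb := eq_or_ne b v
    · cases p with
      | nil => rw [path, path, ht, atVertex_vertex_self, one_smul]
      | cons p e => rw [atVertex_path_cons, path_cons, mul_assoc, h, mul_zero, zero_smul]
    · rw [d.path_mul_eq_zero p ht hb]
      cases p with
      | nil => rw [path, atVertex_vertex_of_ne hb, zero_smul]
      | cons p e => rw [atVertex_path_cons, zero_smul]
  exact LinearMap.congr_fun hlin x

end PathFamily

end PathAlgebra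

open PathAlgebra

namespace BoundQuiverAlgebra

variable {k : Type u} [Field k] {V : Type u} [Quiver.{u} V] [Fintype V]
  (I : TwoSidedIdeal (PathAlgebra k V))

/-- The quotient map from the path algebra to a bound quiver algebra. -/
def mk : PathAlgebra k V →ₐ[k] BoundQuiverAlgebra I := I.ringCon.mkₐ k

theorem mk_surjective : Function.Surjective (mk I) := RingCon.mkₐ_surjective _

theorem mk_eq_zero {x : PathAlgebra k V} (hx : x ∈ I) : mk I x = 0 :=
  (RingCon.eq I.ringCon).mpr ((TwoSidedIdeal.mem_iff I x).mp hx)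

/-- The classes of the trivial paths and of the arrows in a bound quiver algebra. -/
def family : PathFamily V (BoundQuiverAlgebra I) where
  vertex v := mk I (ofPath (Quiver.Path.nil : Quiver.Path v v))
  arrow e := mk I (ofArrow e)
  orthogonal :=
    { idem := fun v => by
        rw [IsIdempotentElem, ← map_mul, ofPath_mul_ofPath, Quiver.Path.comp_nil]
      ortho := fun v w h => by
        beta_reduce
        rw [← map_mul, ofPath_mul_ofPath_of_ne _ _ h.symm, map_zero] }
  vertex_mul_arrow e := by rw [← map_mul, ofArrow, ofPath_mul_ofPath, Quiver.Path.nil_comp]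
  arrow_mul_vertex e := by rw [← map_mul, ofArrow, ofPath_mul_ofPath, Quiver.Path.comp_nil]

theorem family_lift (x : PathAlgebra k V) : (family I).lift x = mk I x :=
  DFunLike.congr_fun (g := (mk I : PathAlgebra k V →ₙₐ[k] BoundQuiverAlgebra I))
    (hom_ext (fun v => (family I).lift_vertex v) fun _ _ e => (family I).lift_arrow e) x

theorem sum_vertex : ∑ v, (family I).vertex v = 1 := by
  rw [← map_one (mk I), one_def, map_sum]
  rfl

variable {I} {T : Type u} [Ring T] [Algebra k T]

theorem hom_ext {f g : BoundQuiverAlgebra I →ₙₐ[k] T}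
    (hv : ∀ v : V, f ((family I).vertex v) = g ((family I).vertex v))
    (he : ∀ (v w : V) (e : v ⟶ w), f ((family I).arrow e) = g ((family I).arrow e)) : f = g := by
  refine NonUnitalAlgHom.ext fun x => ?_
  obtain ⟨x, rfl⟩ := mk_surjective I x
  let m : PathAlgebra k V →ₙₐ[k] BoundQuiverAlgebra I := mk I
  exact DFunLike.congr_fun (f := f.comp m) (g := g.comp m) (PathAlgebra.hom_ext hv he) x

/-- The homomorphism from a bound quiver algebra determined by a family satisfying the relations of
the algebra. It need not preserve the identity. -/
def lift (d : PathFamily V T) (h : ∀ x ∈ I, d.lift x = 0) : BoundQuiverAlgebra I →ₙₐ[k] T where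
  toFun := Quotient.lift (d.lift (k := k)) fun x y hxy => by
    rw [← sub_eq_zero, ← map_sub]
    exact h _ ((TwoSidedIdeal.rel_iff I x y).mp hxy)
  map_smul' c := by
    rintro ⟨x⟩
    exact map_smul d.lift c x
  map_zero' := map_zero d.lift
  map_add' := by
    rintro ⟨x⟩ ⟨y⟩
    exact map_add d.lift x y
  map_mul' := by
    rintro ⟨x⟩ ⟨y⟩
    exact map_mul d.lift x y

section

variable (d : PathFamily V T) (h : ∀ x ∈ I, d.lift x = 0)

theorem lift_vertex (v : V) : lift d h ((family I).vertex v) = d.vertex v :=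
  d.lift_vertex v

theorem lift_arrow {v w : V} (e : v ⟶ w) : lift d h ((family I).arrow e) = d.arrow e :=
  d.lift_arrow e

theorem lift_one : lift d h 1 = ∑ v, d.vertex v := by
  rw [← sum_vertex, map_sum]
  exact Finset.sum_congr rfl fun v _ => lift_vertex d h v

/-- The homomorphism determined by a family of idempotents with sum `1` and images of arrows. -/
def liftAlgHom (hd : ∑ v, d.vertex v = 1) : BoundQuiverAlgebra I →ₐ[k] T :=
  { lift d h with
    map_one' := (lift_one d h).trans hd
    commutes' := fun c => by
      change lift d h (algebraMap k _ c) = algebraMap k T c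
      rw [Algebra.algebraMap_eq_smul_one, map_smul, lift_one, hd,
        Algebra.algebraMap_eq_smul_one] }

theorem liftAlgHom_vertex (hd : ∑ v, d.vertex v = 1) (v : V) :
    liftAlgHom d h hd ((family I).vertex v) = d.vertex v :=
  lift_vertex d h v

theorem liftAlgHom_arrow (hd : ∑ v, d.vertex v = 1) {v w : V} (e : v ⟶ w) :
    liftAlgHom d h hd ((family I).arrow e) = d.arrow e :=
  lift_arrow d h e

end

end BoundQuiverAlgebra

/-! ### The algebra of a glued quiver -/

namespace GluedQuiver

variable {VA VB : Type u} [Quiver.{u} VA] [Quiver.{u} VB]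
  {J : VA → VB → Type u} {K : VB → VA → Type u}

variable (J K) in
/-- The arrows of a glued quiver added to those of the two given quivers. -/
abbrev AddedArrow : Type u := (Σ (a : VA) (b : VB), J a b) ⊕ (Σ (b : VB) (a : VA), K b a)

/-- The source of an added arrow. -/
def src : AddedArrow J K → GluedQuiver J K
  | Sum.inl ⟨a, _, _⟩ => inA J K a
  | Sum.inr ⟨b, _, _⟩ => inB J K b

/-- The target of an added arrow. -/
def tgt : AddedArrow J K → GluedQuiver J K
  | Sum.inl ⟨_, b, _⟩ => inB J K b
  | Sum.inr ⟨_, a, _⟩ => inA J K a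

/-- An added arrow, as an arrow of the glued quiver. -/
def added : ∀ i : AddedArrow J K, src i ⟶ tgt i
  | Sum.inl ⟨_, _, j⟩ => arrowAB K j
  | Sum.inr ⟨_, _, l⟩ => arrowBA J l

theorem arrow_cases {motive : ∀ {v w : GluedQuiver J K}, (v ⟶ w) → Prop}
    (hA : ∀ {a a' : VA} (e : a ⟶ a'), motive ((inclA J K).map e))
    (hB : ∀ {b b' : VB} (e : b ⟶ b'), motive ((inclB J K).map e))
    (hadded : ∀ i : AddedArrow J K, motive (added i)) :
    ∀ (v w : GluedQuiver J K) (e : v ⟶ w), motive e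
  | Sum.inl _, Sum.inl _, e => hA e
  | Sum.inl a, Sum.inr b, j => hadded (Sum.inl ⟨a, b, j⟩)
  | Sum.inr b, Sum.inl a, l => hadded (Sum.inr ⟨b, a, l⟩)
  | Sum.inr _, Sum.inr _, e => hB e

theorem inclA_injective : Function.Injective (inclA J K).obj := Sum.inl_injective

theorem inclB_injective : Function.Injective (inclB J K).obj := Sum.inr_injective

section Glue

variable {T : Type u} [Ring T] (dA : PathFamily VA T) (dB : PathFamily VB T)
  (hAB : ∀ a b, dA.vertex a * dB.vertex b = 0) (hBA : ∀ b a, dB.vertex b * dA.vertex a = 0)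
  (x : AddedArrow J K → T) (hsrc : ∀ i, Sum.elim dA.vertex dB.vertex (src i) * x i = x i)
  (htgt : ∀ i, x i * Sum.elim dA.vertex dB.vertex (tgt i) = x i)

/-- The family on the path algebra of a glued quiver determined by families on the path algebras of
the two given quivers, which are orthogonal to each other, and by the images of the added
arrows. -/
def glue : PathFamily (GluedQuiver J K) T where
  vertex := Sum.elim dA.vertex dB.vertex
  arrow := fun {v w} e =>
    match v, w, e with
    | Sum.inl _, Sum.inl _, e => dA.arrow e
    | Sum.inl a, Sum.inr b, j => x (Sum.inl ⟨a, b, j⟩)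
    | Sum.inr b, Sum.inl a, l => x (Sum.inr ⟨b, a, l⟩)
    | Sum.inr _, Sum.inr _, e => dB.arrow e
  orthogonal :=
    { idem := Sum.rec dA.orthogonal.idem dB.orthogonal.idem
      ortho := by
        rintro (a | b) (a' | b') h
        · exact dA.orthogonal.ortho fun h' => h (congrArg Sum.inl h')
        · exact hAB a b'
        · exact hBA b a'
        · exact dB.orthogonal.ortho fun h' => h (congrArg Sum.inr h') }
  vertex_mul_arrow {v w} e :=
    match v, w, e with
    | Sum.inl _, Sum.inl _, e => dA.vertex_mul_arrow e
    | Sum.inl a, Sum.inr b, j => hsrc (Sum.inl ⟨a, b, j⟩)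
    | Sum.inr b, Sum.inl a, l => hsrc (Sum.inr ⟨b, a, l⟩)
    | Sum.inr _, Sum.inr _, e => dB.vertex_mul_arrow e
  arrow_mul_vertex {v w} e :=
    match v, w, e with
    | Sum.inl _, Sum.inl _, e => dA.arrow_mul_vertex e
    | Sum.inl a, Sum.inr b, j => htgt (Sum.inl ⟨a, b, j⟩)
    | Sum.inr b, Sum.inl a, l => htgt (Sum.inr ⟨b, a, l⟩)
    | Sum.inr _, Sum.inr _, e => dB.arrow_mul_vertex e

theorem glue_comap_inclA :
    (glue dA dB hAB hBA x hsrc htgt).comap (inclA J K) inclA_injective = dA := rfl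

theorem glue_comap_inclB :
    (glue dA dB hAB hBA x hsrc htgt).comap (inclB J K) inclB_injective = dB := rfl

theorem glue_arrow_added (i : AddedArrow J K) :
    (glue dA dB hAB hBA x hsrc htgt).arrow (added i) = x i := by
  rcases i with _ | _ <;> rfl

end Glue

variable {k : Type u} [Field k]
  {IA : TwoSidedIdeal (PathAlgebra k VA)} {IB : TwoSidedIdeal (PathAlgebra k VB)}

theorem map_inclA_mem_gluedIdeal {x : PathAlgebra k VA} (hx : x ∈ IA) :
    PathAlgebra.map (inclA J K) x ∈ gluedIdeal J K IA IB :=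
  TwoSidedIdeal.subset_span (Or.inl (Or.inl (Or.inl (Or.inl (Or.inl ⟨x, hx, rfl⟩)))))

theorem map_inclB_mem_gluedIdeal {x : PathAlgebra k VB} (hx : x ∈ IB) :
    PathAlgebra.map (inclB J K) x ∈ gluedIdeal J K IA IB :=
  TwoSidedIdeal.subset_span (Or.inl (Or.inl (Or.inl (Or.inl (Or.inr ⟨x, hx, rfl⟩)))))

theorem arrow_mul_added_mem_gluedIdeal (i : AddedArrow J K) (v : GluedQuiver J K) (e : v ⟶ src i) :
    ofArrow e * ofArrow (added i) ∈ gluedIdeal J K IA IB := by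
  refine TwoSidedIdeal.subset_span ?_
  rcases i with ⟨a, b, j⟩ | ⟨b, a, l⟩ <;> rcases v with a' | b'
  · exact Or.inl (Or.inl (Or.inl (Or.inr ⟨a', a, b, e, j, rfl⟩)))
  · exact Or.inr ⟨b', b, a, e, j, rfl⟩
  · exact Or.inl (Or.inr ⟨a', a, b, e, l, rfl⟩)
  · exact Or.inl (Or.inl (Or.inr ⟨b', b, a, e, l, rfl⟩))

theorem lift_eq_zero_of_mem_gluedIdeal {T : Type u} [Ring T] [Algebra k T]
    (d : PathFamily (GluedQuiver J K) T)
    (hA : ∀ x ∈ IA, (d.comap (inclA J K) inclA_injective).lift x = 0)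
    (hB : ∀ x ∈ IB, (d.comap (inclB J K) inclB_injective).lift x = 0)
    (hadded : ∀ (i : AddedArrow J K) (v : GluedQuiver J K) (e : v ⟶ src i),
      d.arrow e * d.arrow (added i) = 0)
    (x : PathAlgebra k (GluedQuiver J K)) (hx : x ∈ gluedIdeal J K IA IB) : d.lift x = 0 := by
  have hle : gluedIdeal J K IA IB ≤ TwoSidedIdeal.ker (d.lift (k := k)) := by
    have h {v : GluedQuiver J K} (i : AddedArrow J K) (e : v ⟶ src i) :
        d.lift (ofArrow e * ofArrow (added i) : PathAlgebra k (GluedQuiver J K)) = 0 := by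
      rw [map_mul, d.lift_arrow, d.lift_arrow, hadded]
    rw [gluedIdeal, TwoSidedIdeal.span_le]
    rintro _ (((((⟨x, hx, rfl⟩ | ⟨x, hx, rfl⟩) | ⟨a, a', b, e, j, rfl⟩) | ⟨b, b', a, e, l, rfl⟩) |
      ⟨a, a', b, j, l, rfl⟩) | ⟨b, b', a, l, j, rfl⟩) <;>
    refine (TwoSidedIdeal.mem_ker _).mpr ?_
    · exact (d.lift_comap _ inclA_injective x).symm.trans (hA x hx)
    · exact (d.lift_comap _ inclB_injective x).symm.trans (hB x hx)
    · exact h (Sum.inl ⟨a', b, j⟩) ((inclA J K).map e)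
    · exact h (Sum.inr ⟨b', a, l⟩) ((inclB J K).map e)
    · exact h (Sum.inr ⟨b, a', l⟩) (arrowAB K j)
    · exact h (Sum.inl ⟨a, b', j⟩) (arrowBA J l)
  exact (TwoSidedIdeal.mem_ker _).mp (hle hx)

end GluedQuiver

/-- The homomorphism on a product of two algebras whose restrictions to the factors are given
homomorphisms, which need not preserve the identity. -/
def IgusaTodorov.prodAlgHom {k A B T : Type u} [Field k] [Ring A] [Ring B] [Ring T] [Algebra k A]
    [Algebra k B] [Algebra k T] (f : A →ₙₐ[k] T) (g : B →ₙₐ[k] T) (h : f 1 + g 1 = 1) :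
    A × B →ₐ[k] T :=
  AlgHom.ofLinearMap ((f : A →ₗ[k] T).coprod (g : B →ₗ[k] T)) h fun x y => by
    have hf : f 1 * f 1 = f 1 := by rw [← map_mul, one_mul]
    have hg : g 1 * g 1 = g 1 := by rw [← map_mul, one_mul]
    have hfg : f 1 * g 1 = 0 := by
      rw [eq_sub_of_add_eq' h, mul_sub, mul_one, hf, sub_self]
    have hgf : g 1 * f 1 = 0 := by
      rw [eq_sub_of_add_eq h, mul_sub, mul_one, hg, sub_self]
    have hfg' (a : A) (b : B) : f a * g b = 0 := by
      rw [← mul_one a, ← one_mul b, map_mul, map_mul, mul_assoc, ← mul_assoc (f 1), hfg, zero_mul,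
        mul_zero]
    have hgf' (a : A) (b : B) : g b * f a = 0 := by
      rw [← mul_one b, ← one_mul a, map_mul, map_mul, mul_assoc, ← mul_assoc (g 1), hgf, zero_mul,
        mul_zero]
    change f (x.1 * y.1) + g (x.2 * y.2) = (f x.1 + g x.2) * (f y.1 + g y.2)
    rw [map_mul, map_mul, add_mul, mul_add, mul_add, hfg', hgf', add_zero, zero_add]

namespace GluedQuiver

open BoundQuiverAlgebra (family mk)

variable {VA VB : Type u} [Fintype VA] [Fintype VB] [Quiver.{u} VA] [Quiver.{u} VB]
  {J : VA → VB → Type u} {K : VB → VA → Type u} {k : Type u} [Field k]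
  (IA : TwoSidedIdeal (PathAlgebra k VA)) (IB : TwoSidedIdeal (PathAlgebra k VB))

variable (J K) in
/-- The algebra `C = kQ_C / I_C`. -/
abbrev GluedAlgebra : Type u := BoundQuiverAlgebra (gluedIdeal J K IA IB)

/-- An added arrow, as an element of the glued algebra. -/
def addedArrow (i : AddedArrow J K) : GluedAlgebra J K IA IB :=
  (family (gluedIdeal J K IA IB)).arrow (added i)

variable (J K) in
/-- The inclusion of the algebra `A` into the glued algebra. -/
def homA : BoundQuiverAlgebra IA →ₙₐ[k] GluedAlgebra J K IA IB :=
  BoundQuiverAlgebra.lift ((family _).comap (inclA J K) inclA_injective) fun x hx => by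
    rw [PathFamily.lift_comap, BoundQuiverAlgebra.family_lift,
      BoundQuiverAlgebra.mk_eq_zero _ (map_inclA_mem_gluedIdeal hx)]

variable (J K) in
/-- The inclusion of the algebra `B` into the glued algebra. -/
def homB : BoundQuiverAlgebra IB →ₙₐ[k] GluedAlgebra J K IA IB :=
  BoundQuiverAlgebra.lift ((family _).comap (inclB J K) inclB_injective) fun x hx => by
    rw [PathFamily.lift_comap, BoundQuiverAlgebra.family_lift,
      BoundQuiverAlgebra.mk_eq_zero _ (map_inclB_mem_gluedIdeal hx)]

theorem homA_vertex (a : VA) : homA J K IA IB ((family IA).vertex a) =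
    (family (gluedIdeal J K IA IB)).vertex (inA J K a) :=
  BoundQuiverAlgebra.lift_vertex _ _ a

theorem homB_vertex (b : VB) : homB J K IA IB ((family IB).vertex b) =
    (family (gluedIdeal J K IA IB)).vertex (inB J K b) :=
  BoundQuiverAlgebra.lift_vertex _ _ b

theorem homA_arrow {a a' : VA} (e : a ⟶ a') : homA J K IA IB ((family IA).arrow e) =
    (family (gluedIdeal J K IA IB)).arrow ((inclA J K).map e) :=
  BoundQuiverAlgebra.lift_arrow _ _ e

theorem homB_arrow {b b' : VB} (e : b ⟶ b') : homB J K IA IB ((family IB).arrow e) =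
    (family (gluedIdeal J K IA IB)).arrow ((inclB J K).map e) :=
  BoundQuiverAlgebra.lift_arrow _ _ e

theorem homA_one_add_homB_one : homA J K IA IB 1 + homB J K IA IB 1 = 1 := by
  rw [homA, homB, BoundQuiverAlgebra.lift_one, BoundQuiverAlgebra.lift_one,
    ← BoundQuiverAlgebra.sum_vertex]
  exact (Fintype.sum_sum_type
    fun v : VA ⊕ VB => (family (gluedIdeal J K IA IB)).vertex v).symm

variable (J K) in
/-- The inclusion of the algebra `A × B` into the glued algebra. -/
def baseHom : BoundQuiverAlgebra IA × BoundQuiverAlgebra IB →ₐ[k] GluedAlgebra J K IA IB :=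
  IgusaTodorov.prodAlgHom (homA J K IA IB) (homB J K IA IB) (homA_one_add_homB_one IA IB)

theorem baseHom_inl (x : BoundQuiverAlgebra IA) : baseHom J K IA IB (x, 0) = homA J K IA IB x :=
  (congrArg (_ + ·) (map_zero (homB J K IA IB))).trans (add_zero _)

theorem baseHom_inr (y : BoundQuiverAlgebra IB) : baseHom J K IA IB (0, y) = homB J K IA IB y :=
  (congrArg (· + _) (map_zero (homA J K IA IB))).trans (zero_add _)

/-- The idempotent of `A × B` attached to a vertex of the glued quiver. -/
def baseVertex : GluedQuiver J K → BoundQuiverAlgebra IA × BoundQuiverAlgebra IB :=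
  Sum.elim (fun a => ((family IA).vertex a, 0)) fun b => (0, (family IB).vertex b)

theorem baseHom_baseVertex (v : GluedQuiver J K) :
    baseHom J K IA IB (baseVertex IA IB v) = (family (gluedIdeal J K IA IB)).vertex v := by
  rcases v with a | b
  · exact (baseHom_inl IA IB _).trans (homA_vertex IA IB a)
  · exact (baseHom_inr IA IB _).trans (homB_vertex IA IB b)

theorem arrow_mul_addedArrow (i : AddedArrow J K) {v : GluedQuiver J K} (e : v ⟶ src i) :
    (family (gluedIdeal J K IA IB)).arrow e * addedArrow IA IB i = 0 :=
  (map_mul (mk _) _ _).symm.trans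
    (BoundQuiverAlgebra.mk_eq_zero _ (arrow_mul_added_mem_gluedIdeal i v e))

section Character

variable {IA IB} (hA : IA ≤ arrowIdealPow k VA 1) (hB : IB ≤ arrowIdealPow k VB 1)

/-- The character of the glued algebra attached to a vertex. -/
def gluedCharacter (v : GluedQuiver J K) : GluedAlgebra J K IA IB →ₐ[k] k :=
  BoundQuiverAlgebra.liftAlgHom (PathFamily.atVertex k v)
    (lift_eq_zero_of_mem_gluedIdeal _
      (fun _ hx => PathFamily.lift_eq_zero_of_mem_arrowIdealPow _ (fun _ => rfl) (hA hx))
      (fun _ hx => PathFamily.lift_eq_zero_of_mem_arrowIdealPow _ (fun _ => rfl) (hB hx))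
      fun _ _ _ => mul_zero _)
    ((Fintype.sum_eq_single v fun _ => PathFamily.atVertex_vertex_of_ne).trans
      (PathFamily.atVertex_vertex_self v))

theorem gluedCharacter_arrow {v w : GluedQuiver J K} (e : v ⟶ w) (u : GluedQuiver J K) :
    gluedCharacter hA hB u ((family (gluedIdeal J K IA IB)).arrow e) = 0 :=
  BoundQuiverAlgebra.liftAlgHom_arrow _ _ _ e

theorem mul_addedArrow (c : GluedAlgebra J K IA IB) (i : AddedArrow J K) :
    c * addedArrow IA IB i = gluedCharacter hA hB (src i) c • addedArrow IA IB i := by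
  obtain ⟨x, rfl⟩ := BoundQuiverAlgebra.mk_surjective _ c
  rw [← BoundQuiverAlgebra.family_lift]
  exact ((family _).lift_mul_eq_smul ((family _).vertex_mul_arrow (added i))
    (arrow_mul_addedArrow IA IB i) x).trans (by rw [BoundQuiverAlgebra.family_lift]; rfl)

include hA hB in
theorem addedArrow_mul_addedArrow (i j : AddedArrow J K) :
    addedArrow IA IB i * addedArrow IA IB j = 0 := by
  rw [mul_addedArrow hA hB, addedArrow, gluedCharacter_arrow, zero_smul]

end Character

end GluedQuiver

/-! ### The glued algebra as a square-zero extension -/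

namespace IgusaTodorov

section Twist

variable {k R I : Type u} [Field k] [Ring R] [Algebra k R] [DecidableEq I] (χ : I → R →ₐ[k] k)

/-- The element `s` of the `i`-th component of the ideal of a trivial square-zero extension. -/
def single (i : I) (s : R) : TrivSqZeroExt R (∀ i, Twist (χ i)) :=
  TrivSqZeroExt.inr (Pi.single (M := fun i => Twist (χ i)) i s)

theorem inl_mul_single (r : R) (i : I) (s : R) :
    TrivSqZeroExt.inl r * single χ i s = single χ i (χ i r • s) :=
  (TrivSqZeroExt.inl_mul_inr r _).trans (congrArg TrivSqZeroExt.inr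
    (Pi.single_smul (f := fun i => Twist (χ i)) i r s).symm)

theorem single_zero (i : I) : single χ i 0 = 0 :=
  congrArg TrivSqZeroExt.inr (Pi.single_zero (M := fun i => Twist (χ i)) i)

theorem single_mul_inl (i : I) (s r : R) :
    single χ i s * TrivSqZeroExt.inl r = single χ i (s * r) :=
  (TrivSqZeroExt.inr_mul_inl r _).trans (congrArg TrivSqZeroExt.inr
    (Pi.single_smul (f := fun i => Twist (χ i)) i (MulOpposite.op r) s).symm)

end Twist

/-- The structure of a split square-zero extension given by homomorphisms of algebras. -/
def SquareZeroExtension.ofAlgHom {k R C I : Type u} [Field k] [Ring R] [Algebra k R] [Ring C]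
    [Algebra k C] [Fintype I] [DecidableEq I] (ι : R →ₐ[k] C) (ε : I → C) (f : I → R)
    (χ : I → R →ₐ[k] k) (toExt : C →ₐ[k] TrivSqZeroExt R (∀ i, Twist (χ i)))
    (toExt_ι : ∀ r, toExt (ι r) = TrivSqZeroExt.inl r)
    (toExt_ε : ∀ i, toExt (ε i) = single χ i (f i))
    (eq_add_sum : ∀ c, c = ι (toExt c).fst + ∑ i, ε i * ι (coeff i (toExt c))) :
    SquareZeroExtension k R C I :=
  { ι, ε, f, χ, toExt, toExt_ι, toExt_ε, eq_add_sum }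

end IgusaTodorov

namespace GluedQuiver

open BoundQuiverAlgebra (family)
open IgusaTodorov (Twist SquareZeroExtension single inl_mul_single single_zero single_mul_inl coeff)

variable {VA VB : Type u} [Fintype VA] [Fintype VB] [Quiver.{u} VA] [Quiver.{u} VB]
  {J : VA → VB → Type u} {K : VB → VA → Type u} {k : Type u} [Field k]
  {IA : TwoSidedIdeal (PathAlgebra k VA)} {IB : TwoSidedIdeal (PathAlgebra k VB)}
  (hA : IA ≤ arrowIdealPow k VA 1) (hB : IB ≤ arrowIdealPow k VB 1)

/-- The character through which `A × B` acts on the left on an added arrow. -/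
def baseCharacter (i : AddedArrow J K) : BoundQuiverAlgebra IA × BoundQuiverAlgebra IB →ₐ[k] k :=
  (gluedCharacter hA hB (src i)).comp (baseHom J K IA IB)

theorem baseCharacter_baseVertex (i : AddedArrow J K) :
    baseCharacter hA hB i (baseVertex IA IB (src i)) = 1 := by
  rw [baseCharacter, AlgHom.comp_apply, baseHom_baseVertex, gluedCharacter,
    BoundQuiverAlgebra.liftAlgHom_vertex, PathFamily.atVertex_vertex_self]

theorem baseCharacter_inclA_arrow (i : AddedArrow J K) {a a' : VA} (e : a ⟶ a') :
    baseCharacter hA hB i ((family IA).arrow e, 0) = 0 := by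
  rw [baseCharacter, AlgHom.comp_apply, baseHom_inl, homA_arrow]
  exact gluedCharacter_arrow hA hB ((inclA J K).map e) (src i)

theorem baseCharacter_inclB_arrow (i : AddedArrow J K) {b b' : VB} (e : b ⟶ b') :
    baseCharacter hA hB i (0, (family IB).arrow e) = 0 := by
  rw [baseCharacter, AlgHom.comp_apply, baseHom_inr, homB_arrow]
  exact gluedCharacter_arrow hA hB ((inclB J K).map e) (src i)

theorem baseHom_mul_addedArrow_mul (i : AddedArrow J K)
    (r s : BoundQuiverAlgebra IA × BoundQuiverAlgebra IB) :
    baseHom J K IA IB r * (addedArrow IA IB i * baseHom J K IA IB s) =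
      addedArrow IA IB i * baseHom J K IA IB (baseCharacter hA hB i r • s) := by
  rw [← mul_assoc, mul_addedArrow hA hB, smul_mul_assoc, ← mul_smul_comm, ← map_smul]
  rfl

include hA hB in
theorem addedArrow_mul_baseHom_mul_addedArrow (i j : AddedArrow J K)
    (r s : BoundQuiverAlgebra IA × BoundQuiverAlgebra IB) :
    addedArrow IA IB i * baseHom J K IA IB r * (addedArrow IA IB j * baseHom J K IA IB s) = 0 := by
  rw [mul_assoc, baseHom_mul_addedArrow_mul hA hB, ← mul_assoc, addedArrow_mul_addedArrow hA hB,
    zero_mul]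

theorem addedArrow_mul_baseVertex (i : AddedArrow J K) :
    addedArrow IA IB i * baseHom J K IA IB (baseVertex IA IB (tgt i)) = addedArrow IA IB i := by
  rw [baseHom_baseVertex]
  exact (family _).arrow_mul_vertex (added i)

theorem baseVertex_mul_self (v : GluedQuiver J K) :
    baseVertex IA IB v * baseVertex IA IB v = baseVertex IA IB v := by
  rcases v with a | b
  · exact Prod.ext ((family IA).orthogonal.idem a) (mul_zero _)
  · exact Prod.ext (mul_zero _) ((family IB).orthogonal.idem b)

theorem sum_baseVertex : ∑ v : GluedQuiver J K, baseVertex IA IB v = 1 := by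
  refine (Fintype.sum_sum_type fun v : VA ⊕ VB => baseVertex (J := J) (K := K) IA IB v).trans ?_
  change ∑ a, ((family IA).vertex a, (0 : BoundQuiverAlgebra IB)) +
    ∑ b, ((0 : BoundQuiverAlgebra IA), (family IB).vertex b) = 1
  simp [Prod.ext_iff, Prod.fst_sum, Prod.snd_sum, BoundQuiverAlgebra.sum_vertex]

/-- The trivial square-zero extension of `A × B` with which the glued algebra is identified. -/
abbrev GluedExt : Type u :=
  TrivSqZeroExt (BoundQuiverAlgebra IA × BoundQuiverAlgebra IB)
    (∀ i : AddedArrow J K, Twist (baseCharacter hA hB i))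

variable (J K) in
/-- The inclusion of `A` into the trivial square-zero extension. -/
def extHomA : BoundQuiverAlgebra IA →ₙₐ[k] GluedExt (J := J) (K := K) hA hB :=
  NonUnitalAlgHom.comp
    (TrivSqZeroExt.inlAlgHom k (BoundQuiverAlgebra IA × BoundQuiverAlgebra IB)
      (∀ i : AddedArrow J K, Twist (baseCharacter hA hB i))).toNonUnitalAlgHom
    (NonUnitalAlgHom.inl k _ _)

variable (J K) in
/-- The inclusion of `B` into the trivial square-zero extension. -/
def extHomB : BoundQuiverAlgebra IB →ₙₐ[k] GluedExt (J := J) (K := K) hA hB :=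
  NonUnitalAlgHom.comp
    (TrivSqZeroExt.inlAlgHom k (BoundQuiverAlgebra IA × BoundQuiverAlgebra IB)
      (∀ i : AddedArrow J K, Twist (baseCharacter hA hB i))).toNonUnitalAlgHom
    (NonUnitalAlgHom.inr k _ _)

theorem elim_ext_vertex (v : GluedQuiver J K) :
    Sum.elim ((family IA).map (k := k) (extHomA J K hA hB)).vertex
      ((family IB).map (k := k) (extHomB J K hA hB)).vertex v =
      (TrivSqZeroExt.inl (baseVertex IA IB v) : GluedExt (J := J) (K := K) hA hB) := by
  rcases v with a | b <;> rfl

section OfExt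

variable [Fintype (AddedArrow J K)]

/-- The linear map from the ideal of the trivial square-zero extension to the glued algebra. -/
def ofExtIdeal :
    (∀ i : AddedArrow J K, Twist (baseCharacter hA hB i)) →ₗ[k] GluedAlgebra J K IA IB :=
  ∑ i, LinearMap.mulLeft k (addedArrow IA IB i) ∘ₗ (baseHom J K IA IB).toLinearMap ∘ₗ
    LinearMap.proj (φ := fun i => Twist (baseCharacter hA hB i)) i

theorem ofExtIdeal_apply (m : ∀ i : AddedArrow J K, Twist (baseCharacter hA hB i)) :
    ofExtIdeal hA hB m =
      ∑ i, addedArrow IA IB i * baseHom J K IA IB (coeff i (TrivSqZeroExt.inr m)) := by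
  rw [ofExtIdeal, LinearMap.sum_apply]
  rfl

/-- The homomorphism from the trivial square-zero extension to the glued algebra. -/
def ofExt : GluedExt (J := J) (K := K) hA hB →ₐ[k] GluedAlgebra J K IA IB :=
  TrivSqZeroExt.lift (baseHom J K IA IB) (ofExtIdeal hA hB)
    (fun x y => by
      rw [ofExtIdeal_apply, ofExtIdeal_apply, Finset.sum_mul_sum]
      exact Finset.sum_eq_zero fun i _ => Finset.sum_eq_zero fun j _ =>
        addedArrow_mul_baseHom_mul_addedArrow hA hB i j _ _)
    (fun r x => by
      rw [ofExtIdeal_apply, ofExtIdeal_apply, Finset.mul_sum]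
      exact Finset.sum_congr rfl fun i _ => (baseHom_mul_addedArrow_mul hA hB i r _).symm)
    (fun r x => by
      rw [ofExtIdeal_apply, ofExtIdeal_apply, Finset.sum_mul]
      refine Finset.sum_congr rfl fun i _ => ?_
      rw [mul_assoc, ← map_mul]
      rfl)

theorem ofExt_apply (z : GluedExt (J := J) (K := K) hA hB) :
    ofExt hA hB z = baseHom J K IA IB z.fst +
      ∑ i, addedArrow IA IB i * baseHom J K IA IB (coeff i z) :=
  congrArg (_ + ·) (ofExtIdeal_apply hA hB z.snd)

theorem ofExt_inl (r : BoundQuiverAlgebra IA × BoundQuiverAlgebra IB) :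
    ofExt (J := J) (K := K) hA hB (TrivSqZeroExt.inl r) = baseHom J K IA IB r :=
  TrivSqZeroExt.lift_apply_inl ..

end OfExt

variable [DecidableEq (AddedArrow J K)]

/-- The images of the vertices and arrows in the trivial square-zero extension. -/
def extFamily : PathFamily (GluedQuiver J K) (GluedExt (J := J) (K := K) hA hB) :=
  glue ((family IA).map (k := k) (extHomA J K hA hB)) ((family IB).map (k := k) (extHomB J K hA hB))
    (fun a b => by
      change (TrivSqZeroExt.inl _ * TrivSqZeroExt.inl _ : GluedExt hA hB) = 0
      rw [← TrivSqZeroExt.inl_mul]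
      exact congrArg TrivSqZeroExt.inl (Prod.ext (mul_zero _) (zero_mul _)))
    (fun b a => by
      change (TrivSqZeroExt.inl _ * TrivSqZeroExt.inl _ : GluedExt hA hB) = 0
      rw [← TrivSqZeroExt.inl_mul]
      exact congrArg TrivSqZeroExt.inl (Prod.ext (zero_mul _) (mul_zero _)))
    (fun i => single (baseCharacter hA hB) i (baseVertex IA IB (tgt i)))
    (fun i => by rw [elim_ext_vertex, inl_mul_single, baseCharacter_baseVertex, one_smul])
    (fun i => by rw [elim_ext_vertex, single_mul_inl, baseVertex_mul_self])

theorem extFamily_vertex (v : GluedQuiver J K) :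
    (extFamily hA hB).vertex v = TrivSqZeroExt.inl (baseVertex IA IB v) :=
  elim_ext_vertex hA hB v

theorem extFamily_added (i : AddedArrow J K) :
    (extFamily hA hB).arrow (added i) =
      single (baseCharacter hA hB) i (baseVertex IA IB (tgt i)) :=
  glue_arrow_added ..

theorem extFamily_arrow_inclA {a a' : VA} (e : a ⟶ a') :
    (extFamily hA hB).arrow ((inclA J K).map e) = TrivSqZeroExt.inl ((family IA).arrow e, 0) :=
  rfl

theorem extFamily_arrow_inclB {b b' : VB} (e : b ⟶ b') :
    (extFamily hA hB).arrow ((inclB J K).map e) = TrivSqZeroExt.inl (0, (family IB).arrow e) :=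
  rfl

theorem extFamily_arrow_mul_added (i : AddedArrow J K) {v w : GluedQuiver J K} (e : v ⟶ w) :
    (extFamily hA hB).arrow e * (extFamily hA hB).arrow (added i) = 0 := by
  rw [extFamily_added]
  refine arrow_cases (motive := fun e => (extFamily hA hB).arrow e * single _ i _ = 0)
    (fun e => ?_) (fun e => ?_) (fun j => ?_) v w e
  · rw [extFamily_arrow_inclA, inl_mul_single, baseCharacter_inclA_arrow, zero_smul, single_zero]
  · rw [extFamily_arrow_inclB, inl_mul_single, baseCharacter_inclB_arrow, zero_smul, single_zero]
  · rw [extFamily_added]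
    exact TrivSqZeroExt.inr_mul_inr ..

theorem lift_extFamily_eq_zero (x : PathAlgebra k (GluedQuiver J K))
    (hx : x ∈ gluedIdeal J K IA IB) : (extFamily hA hB).lift x = 0 := by
  refine lift_eq_zero_of_mem_gluedIdeal _ (fun x hx => ?_) (fun x hx => ?_)
    (fun i _ => extFamily_arrow_mul_added hA hB i) x hx
  · rw [extFamily, glue_comap_inclA, PathFamily.lift_map, BoundQuiverAlgebra.family_lift,
      BoundQuiverAlgebra.mk_eq_zero _ hx, map_zero]
  · rw [extFamily, glue_comap_inclB, PathFamily.lift_map, BoundQuiverAlgebra.family_lift,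
      BoundQuiverAlgebra.mk_eq_zero _ hx, map_zero]

/-- The homomorphism from the glued algebra to the trivial square-zero extension. -/
def toExt : GluedAlgebra J K IA IB →ₐ[k] GluedExt (J := J) (K := K) hA hB :=
  BoundQuiverAlgebra.liftAlgHom (extFamily hA hB) (lift_extFamily_eq_zero hA hB) (by
    simp only [extFamily_vertex]
    rw [← TrivSqZeroExt.inl_sum, sum_baseVertex, TrivSqZeroExt.inl_one])

theorem toExt_vertex (v : GluedQuiver J K) :
    toExt hA hB ((family (gluedIdeal J K IA IB)).vertex v) =
      TrivSqZeroExt.inl (baseVertex IA IB v) :=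
  (BoundQuiverAlgebra.liftAlgHom_vertex _ _ _ v).trans (extFamily_vertex hA hB v)

theorem toExt_arrow {v w : GluedQuiver J K} (e : v ⟶ w) :
    toExt hA hB ((family (gluedIdeal J K IA IB)).arrow e) = (extFamily hA hB).arrow e :=
  BoundQuiverAlgebra.liftAlgHom_arrow _ _ _ e

theorem toExt_homA (x : BoundQuiverAlgebra IA) :
    toExt hA hB (homA J K IA IB x) = extHomA J K hA hB x := by
  refine DFunLike.congr_fun (f := NonUnitalAlgHom.comp (toExt hA hB).toNonUnitalAlgHom
    (homA J K IA IB)) (BoundQuiverAlgebra.hom_ext (k := k) (I := IA) (T := GluedExt hA hB)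
      (fun a => ?_) fun a a' e => ?_) x
  · exact (congrArg (toExt hA hB) (homA_vertex IA IB a)).trans (toExt_vertex hA hB (inA J K a))
  · exact (congrArg (toExt hA hB) (homA_arrow IA IB e)).trans
      (toExt_arrow hA hB ((inclA J K).map e))

theorem toExt_homB (x : BoundQuiverAlgebra IB) :
    toExt hA hB (homB J K IA IB x) = extHomB J K hA hB x := by
  refine DFunLike.congr_fun (f := NonUnitalAlgHom.comp (toExt hA hB).toNonUnitalAlgHom
    (homB J K IA IB)) (BoundQuiverAlgebra.hom_ext (k := k) (I := IB) (T := GluedExt hA hB)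
      (fun b => ?_) fun b b' e => ?_) x
  · exact (congrArg (toExt hA hB) (homB_vertex IA IB b)).trans (toExt_vertex hA hB (inB J K b))
  · exact (congrArg (toExt hA hB) (homB_arrow IA IB e)).trans
      (toExt_arrow hA hB ((inclB J K).map e))

theorem toExt_baseHom (r : BoundQuiverAlgebra IA × BoundQuiverAlgebra IB) :
    toExt hA hB (baseHom J K IA IB r) = TrivSqZeroExt.inl r := by
  rw [← Prod.fst_add_snd r, map_add, baseHom_inl, baseHom_inr, map_add, toExt_homA, toExt_homB,
    TrivSqZeroExt.inl_add]
  rfl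

theorem toExt_addedArrow (i : AddedArrow J K) :
    toExt hA hB (addedArrow IA IB i) =
      single (baseCharacter hA hB) i (baseVertex IA IB (tgt i)) :=
  (toExt_arrow hA hB (added i)).trans (extFamily_added hA hB i)

theorem ofExt_single [Fintype (AddedArrow J K)] (i : AddedArrow J K)
    (r : BoundQuiverAlgebra IA × BoundQuiverAlgebra IB) :
    ofExt hA hB (single (baseCharacter hA hB) i r) = addedArrow IA IB i * baseHom J K IA IB r := by
  refine (TrivSqZeroExt.lift_apply_inr ..).trans ((ofExtIdeal_apply hA hB _).trans ?_)
  refine (Fintype.sum_eq_single i fun j hj => ?_).trans ?_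
  · refine (congrArg (_ * baseHom J K IA IB ·) (Pi.single_eq_of_ne hj _)).trans ?_
    exact (congrArg (_ * ·) (map_zero (baseHom J K IA IB))).trans (mul_zero _)
  · exact congrArg (_ * baseHom J K IA IB ·) (Pi.single_eq_same i _)

theorem ofExt_toExt [Fintype (AddedArrow J K)] (c : GluedAlgebra J K IA IB) :
    ofExt hA hB (toExt hA hB c) = c := by
  have hv (v : GluedQuiver J K) : ofExt hA hB (toExt hA hB ((family _).vertex v)) =
      (family (gluedIdeal J K IA IB)).vertex v := by
    rw [toExt_vertex, ofExt_inl, baseHom_baseVertex]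
  have he : ∀ (v w : GluedQuiver J K) (e : v ⟶ w),
      ofExt hA hB (toExt hA hB ((family _).arrow e)) =
        (family (gluedIdeal J K IA IB)).arrow e := by
    refine arrow_cases (fun e => ?_) (fun e => ?_) fun i => ?_
    · rw [toExt_arrow, extFamily_arrow_inclA, ofExt_inl, baseHom_inl, homA_arrow]
    · rw [toExt_arrow, extFamily_arrow_inclB, ofExt_inl, baseHom_inr, homB_arrow]
    · rw [toExt_arrow, extFamily_added, ofExt_single, addedArrow_mul_baseVertex]
      rfl
  exact DFunLike.congr_fun (f := ((ofExt hA hB).comp (toExt hA hB)).toNonUnitalAlgHom)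
    (g := NonUnitalAlgHom.id k _) (BoundQuiverAlgebra.hom_ext (k := k) hv he) c

theorem eq_baseHom_add_sum [Fintype (AddedArrow J K)] (c : GluedAlgebra J K IA IB) :
    c = baseHom J K IA IB (toExt hA hB c).fst +
      ∑ i, addedArrow IA IB i * baseHom J K IA IB (coeff i (toExt hA hB c)) :=
  (ofExt_toExt hA hB c).symm.trans (ofExt_apply hA hB _)

/-- The glued algebra is a square-zero extension of `A × B` by the ideal generated by the added
arrows. -/
def squareZeroExtension [Fintype (AddedArrow J K)] :
    SquareZeroExtension k (BoundQuiverAlgebra IA × BoundQuiverAlgebra IB)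
      (GluedAlgebra J K IA IB) (AddedArrow J K) :=
  .ofAlgHom (baseHom J K IA IB) (addedArrow IA IB) (fun i => baseVertex IA IB (tgt i))
    (baseCharacter hA hB) (toExt hA hB) (toExt_baseHom hA hB) (toExt_addedArrow hA hB)
    (eq_baseHom_add_sum hA hB)

end GluedQuiver

end

theorem proposition3p6_general {k : Type u} [Field k]
    {VA VB : Type u} [Fintype VA] [Fintype VB] [Quiver.{u} VA] [Quiver.{u} VB]
    (J : VA → VB → Type u) (K : VB → VA → Type u)
    [∀ a b, Finite (J a b)] [∀ b a, Finite (K b a)]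
    (IA : TwoSidedIdeal (PathAlgebra k VA)) (IB : TwoSidedIdeal (PathAlgebra k VB))
    (hIA : IA ≤ PathAlgebra.arrowIdealPow k VA 1) (hIB : IB ≤ PathAlgebra.arrowIdealPow k VB 1)
    [IsArtinianRing (BoundQuiverAlgebra IA)] [IsArtinianRing (BoundQuiverAlgebra IB)]
    [IsArtinianRing (BoundQuiverAlgebra (GluedQuiver.gluedIdeal J K IA IB))] (n : ℕ) :
    (IgusaTodorov.IsIgusaTodorovOp n (BoundQuiverAlgebra IA) →
      IgusaTodorov.IsIgusaTodorovOp n (BoundQuiverAlgebra IB) →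
      IgusaTodorov.IsIgusaTodorovOp (n + 1)
        (BoundQuiverAlgebra (GluedQuiver.gluedIdeal J K IA IB))) ∧
    (IgusaTodorov.IsLITOp n (BoundQuiverAlgebra IA) →
      IgusaTodorov.IsLITOp n (BoundQuiverAlgebra IB) →
      IgusaTodorov.IsLITOp (n + 1)
        (BoundQuiverAlgebra (GluedQuiver.gluedIdeal J K IA IB))) := by
  classical
  have : Fintype (GluedQuiver.AddedArrow J K) := Fintype.ofFinite _
  let D := GluedQuiver.squareZeroExtension (J := J) (K := K) hIA hIB
  have hp := IgusaTodorov.isDirectFactor_fst (BoundQuiverAlgebra IA) (BoundQuiverAlgebra IB)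
  have hq := IgusaTodorov.isDirectFactor_snd (BoundQuiverAlgebra IA) (BoundQuiverAlgebra IB)
  have he : ((1, 0) + (0, 1) : BoundQuiverAlgebra IA × BoundQuiverAlgebra IB) = 1 :=
    Prod.ext (add_zero 1) (zero_add 1)
  constructor
  · rintro ⟨VA, hVA⟩ ⟨VB, hVB⟩
    have hC := D.isLITWith (.of_factors hp hq he hVA hVB)
    rw [IgusaTodorov.factorClass_subsingleton hp hq he, D.indClass_subsingleton] at hC
    exact ⟨_, hC⟩
  · rintro ⟨VA, DA, hVA⟩ ⟨VB, DB, hVB⟩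
    exact ⟨_, _, D.isLITWith (.of_factors hp hq he hVA hVB)⟩

theorem proposition3p6 {k : Type u} [Field k]
    {VA VB : Type u} [Fintype VA] [Fintype VB] [Quiver.{u} VA] [Quiver.{u} VB]
    [∀ a a' : VA, Finite (a ⟶ a')] [∀ b b' : VB, Finite (b ⟶ b')]
    (J : VA → VB → Type u) (K : VB → VA → Type u)
    [∀ a b, Finite (J a b)] [∀ b a, Finite (K b a)]
    (IA : TwoSidedIdeal (PathAlgebra k VA)) (IB : TwoSidedIdeal (PathAlgebra k VB))
    (IC : TwoSidedIdeal (PathAlgebra k (GluedQuiver J K)))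
    (hIA : PathAlgebra.IsAdmissible IA) (hIB : PathAlgebra.IsAdmissible IB)
    (H3 : GluedQuiver.gluedIdeal J K IA IB = IC)
    [Module.Finite k (BoundQuiverAlgebra IA)] [Module.Finite k (BoundQuiverAlgebra IB)]
    [Module.Finite k (BoundQuiverAlgebra IC)] (n : ℕ) :
    (IgusaTodorov.IsIgusaTodorovOp n (BoundQuiverAlgebra IA) →
      IgusaTodorov.IsIgusaTodorovOp n (BoundQuiverAlgebra IB) →
      IgusaTodorov.IsIgusaTodorovOp (n + 1) (BoundQuiverAlgebra IC)) ∧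
    (IgusaTodorov.IsLITOp n (BoundQuiverAlgebra IA) →
      IgusaTodorov.IsLITOp n (BoundQuiverAlgebra IB) →
      IgusaTodorov.IsLITOp (n + 1) (BoundQuiverAlgebra IC)) := by
  subst H3
  exact proposition3p6_general J K IA IB (hIA.1.trans (PathAlgebra.arrowIdealPow_anti one_le_two))
    (hIB.1.trans (PathAlgebra.arrowIdealPow_anti one_le_two)) n
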